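/- Write $\langle x\rangle=(1+|x|^2)^{1/2}$. For a real matrix function $(a_{lk}(x))_{1\le l,k\le n}$ on $\mathbb{R}^n$ put $h(x,\xi)=\sum_{l,k}a_{lk}(x)\xi_l\xi_k$ and $$H_hp=\sum_{j=1}^n\bigl(\partial_{\xi_j}h\,\partial_{x_j}p-\partial_{x_j}h\,\partial_{\xi_j}p\bigr).$$ The class $S^0$ consists of the $p\in C^\infty(\mathbb{R}^n\times\mathbb{R}^n)$ such that, for all multi-indices $\alpha,\beta$, $|\partial_x^\beta\partial_\xi^\alpha p(x,\xi)|\le A_{\alpha,\beta}(1+|\xi|)^{-|\alpha|}$ for some constant $A_{\alpha,\beta}$ and all $x,\xi$. A bicharacteristic of $h$ is a solution $(X(s),\Xi(s))$, $s\in\mathbb{R}$, of $\dot X_j=\partial_{\xi_j}h(X,\Xi)$, $\dot\Xi_j=-\partial_{x_j}h(X,\Xi)$. Call $h$ non-trapping if $\{X(s):s\in\mathbb{R}\}$ is unbounded for every bicharacteristic with $\Xi(0)\neq0$. The non-trapping character of $h$ is its escape time function $T_h:\mathbb{R}\to[0,\infty]$, where $T_h(\mu)$ is the supremum (taken to be $0$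 if there are none) of the $|s|$ for which some bicharacteristic has $|X(0)|\le\mu$, $|\Xi(0)|=1$ and $|X(s)|<\mu$. **Doi's Lemma.** Let $n,M\in\mathbb{N}$. There is $N=N(n,M)$ such that for all $\gamma,C_1>0$ and every function $\tau:\mathbb{R}\to[0,\infty)$ there are constants $C_1^*$ and $B\in(0,1)$, depending only on $n,M,\gamma,C_1,\tau$, with the following property. Suppose that 1. (ellipticity) $h(x,\xi)\ge\gamma|\xi|^2$ for all $x,\xi\in\mathbb{R}^n$; 2. (regularity) $a_{lk}\in C_b^N(\mathbb{R}^n)$, with all partial derivatives of order at most $N$ bounded by $C_1$, for all $l,k$; 3. (asymptotic flatness) $|\nabla a_{lk}(x)|\le C_1\langle x\rangle^{-2}$ for all $x,l,k$; 4. $h$ is non-trapping. Then $T_h(\mu)<\infty$ for every $\mu$, and whenever $T_h\le\tau$ pointwise (for example $\tau=T_h$) there is a real valued symbol $p\in S^0$ with $|\partial_x^\beta\partial_\xi^\alpha p(x,\xi)|\le C_1^*(1+|\xi|)^{-|\alpha|}$ for $|\alpha|+|\beta|\le M$ and all $x,\xi$, such that $$H_hp(x,\xi)\ \ge\ \frac{B|\xi|}{\langle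 x\rangle^2}-\frac1B\qquad\text{for all }(x,\xi)\in\mathbb{R}^n\times\mathbb{R}^n .$$ -/

import Mathlib

open scoped NNReal ENNReal ContDiff

namespace Doi

/-- Euclidean space `ℝⁿ`. -/
abbrev E (n : ℕ) : Type := EuclideanSpace ℝ (Fin n)

variable {n : ℕ}

/-- The partial derivative `∂_i f` of a real function on `ℝⁿ`. -/
noncomputable def partialDeriv (i : Fin n) (f : E n → ℝ) : E n → ℝ :=
  fun x => fderiv ℝ f x (EuclideanSpace.single i 1)

/-- The iterated partial derivative `∂_{i₁} ⋯ ∂_{i_k} f` for a list `[i₁, …, i_k]` of coordinate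
indices; for smooth `f` this is `∂^α f` where `α` counts the indices, and `|α|` is the length of
the list. -/
noncomputable def iterPartial (α : List (Fin n)) (f : E n → ℝ) : E n → ℝ :=
  α.foldr partialDeriv f

/-- The mixed derivative `∂_x^β ∂_ξ^α p (x, ξ)` of a function `p (x, ξ)` on `ℝⁿ × ℝⁿ`. -/
noncomputable def symbolDeriv (p : E n → E n → ℝ) (β α : List (Fin n)) (x ξ : E n) : ℝ :=
  iterPartial β (fun y => iterPartial α (p y) ξ) x

/-- `p` is a real valued symbol of the standard class `S^m`: it is `C^∞` on `ℝⁿ × ℝⁿ` and for all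
`α`, `β` one has `|∂_x^β ∂_ξ^α p| ≤ A_{α,β} (1 + |ξ|)^(m - |α|)`. -/
def IsSymbol (m : ℝ) (p : E n → E n → ℝ) : Prop :=
  ContDiff ℝ ∞ (fun z : E n × E n => p z.1 z.2) ∧
    ∀ α β : List (Fin n), ∃ A : ℝ, ∀ x ξ : E n,
      |symbolDeriv p β α x ξ| ≤ A * (1 + ‖ξ‖) ^ (m - (α.length : ℝ))

/-- The quadratic symbol `h(x, ξ) = ∑_{l,k} a_{lk}(x) ξ_l ξ_k`. -/
noncomputable def quadSymbol (a : Fin n → Fin n → E n → ℝ) (x ξ : E n) : ℝ :=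
  ∑ l, ∑ k, a l k x * ξ l * ξ k

/-- The Hamiltonian vector field of `h` applied to `p`:
`H_h p = ∑_j (∂_{ξ_j} h ∂_{x_j} p - ∂_{x_j} h ∂_{ξ_j} p)`. -/
noncomputable def hamiltonian (h p : E n → E n → ℝ) (x ξ : E n) : ℝ :=
  ∑ j, (partialDeriv j (fun η => h x η) ξ * partialDeriv j (fun y => p y ξ) x -
    partialDeriv j (fun y => h y ξ) x * partialDeriv j (fun η => p x η) ξ)

/-- Ellipticity: `h(x, ξ) ≥ γ |ξ|²`. -/
def IsElliptic (γ : ℝ) (a : Fin n → Fin n → E n → ℝ) : Prop :=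
  ∀ x ξ : E n, γ * ‖ξ‖ ^ 2 ≤ quadSymbol a x ξ

/-- Regularity: every coefficient lies in `C_b^N(ℝⁿ)` with norm at most `C₁`. -/
def IsRegular (N : ℕ) (C₁ : ℝ) (a : Fin n → Fin n → E n → ℝ) : Prop :=
  ∀ l k, ContDiff ℝ N (a l k) ∧
    ∀ α : List (Fin n), α.length ≤ N → ∀ x, |iterPartial α (a l k) x| ≤ C₁

/-- Asymptotic flatness: `|∇ a_{lk}(x)| ≤ C₁ / ⟨x⟩²`, where `⟨x⟩² = 1 + |x|²`. -/
def IsAsymptoticallyFlat (C₁ : ℝ) (a : Fin n → Fin n → E n → ℝ) : Prop :=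
  ∀ l k x, ‖fderiv ℝ (a l k) x‖ ≤ C₁ / (1 + ‖x‖ ^ 2)

/-- `(X, Ξ)` is a bicharacteristic of `h`, i.e. a solution, for all times, of Hamilton's equations
`X_j' = ∂_{ξ_j} h(X, Ξ)`, `Ξ_j' = - ∂_{x_j} h(X, Ξ)`. -/
def IsBicharacteristic (h : E n → E n → ℝ) (X Ξ : ℝ → E n) : Prop :=
  ∀ s : ℝ, ∀ j : Fin n,
    HasDerivAt (fun t => X t j) (partialDeriv j (fun η => h (X s) η) (Ξ s)) s ∧
    HasDerivAt (fun t => Ξ t j) (-partialDeriv j (fun y => h y (Ξ s)) (X s)) s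

/-- The non-trapping condition: for every initial point `(x₀, ξ₀)` with `ξ₀ ≠ 0`, the set
`{X(s; x₀, ξ₀) : s ∈ ℝ}` is unbounded in `ℝⁿ`. -/
def NonTrapping (h : E n → E n → ℝ) : Prop :=
  ∀ X Ξ : ℝ → E n, IsBicharacteristic h X Ξ → Ξ 0 ≠ 0 → ¬ Bornology.IsBounded (Set.range X)

/-- The escape time of `h` from the ball of radius `μ`: the supremum of the `|s|` for which some
bicharacteristic with `|X(0)| ≤ μ` and `|Ξ(0)| = 1` still has `|X(s)| < μ`. The function
`μ ↦ escapeTime h μ` is the quantitative non-trapping character of `h`. -/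
noncomputable def escapeTime (h : E n → E n → ℝ) (μ : ℝ) : ℝ≥0∞ :=
  ⨆ (X : ℝ → E n) (Ξ : ℝ → E n) (s : ℝ) (_ : IsBicharacteristic h X Ξ) (_ : ‖X 0‖ ≤ μ)
    (_ : ‖Ξ 0‖ = 1) (_ : ‖X s‖ < μ), ENNReal.ofReal |s|

/-- The non-trapping character of `h` is controlled by the finite function `τ`. -/
def ControlsEscape (h : E n → E n → ℝ) (τ : ℝ → ℝ≥0) : Prop :=
  ∀ μ : ℝ, escapeTime h μ ≤ τ μ

end Doi

/-!
An escape function `p` is built from two pieces which both increase along the Hamiltonian flow: one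
works near infinity and needs no information on trapping, the other works on compact sets and is
controlled by the escape times. Only two bounded derivatives of the coefficients are used.

**Near infinity.** Let `q = x · ξ / |ξ|` be the radial momentum and `r = ⟨x⟩`. Ellipticity and
asymptotic flatness make `q` grow at a rate comparable to `|ξ|` for large `r`
(`exists_hasDerivAt_radial`). With `Φ` the one-dimensional function `outerProfile`, a smooth step in
`(q - 1/c) / r` times a bounded factor which increases at the rate `|ξ| / r²`, the symbol
`Φ(q, r) - Φ(-q, r)` is nondecreasing along the flow everywhere, and increases at a rate of at least
`κ |ξ| / ⟨x⟩²` outside a compact set in `x` (`outerSymbol_growth`). It is a smooth function of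
`1 / ⟨x⟩`, `x / ⟨x⟩` and `ξ / |ξ|`, and `x ↦ (1 / ⟨x⟩, x / ⟨x⟩)` solves an autonomous system with
values in a compact set, so that all its derivatives are bounded
(`exists_bound_iteratedFDeriv_comp_compactMap`).

**On compact sets.** Let `G` be minus the length, measured by `√h`, of the part of the forward orbit
of `(x, ξ)` which lies in a large ball. It is homogeneous of degree `0` in `ξ` and increases at the
rate `√h` along the flow (`innerFun_advance`). Its bounds and its Lipschitz constant near the unit
sphere bundle depend only on the constants of the problem and on the control `τ` of the escape
times. A Friedrichs mollification at a small fixed scale then is smooth, has derivative bounds of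
the same kind, and still increases along the flow on the sphere bundle (`exists_innerSymbol`).
Hence no smoothness of the flow is required. The flow exists globally because below a given energy
the Hamiltonian field coincides with a bounded, globally Lipschitz field conserving the energy
(`exists_lipschitz_field`).

**Gluing.** Put `P = K (Φ(q, r) - Φ(-q, r)) + χ(x) G(x, ξ / |ξ|)` with a cut-off `χ` and a large
constant `K`. The derivative of `χ` is supported where the first term grows, and is absorbed by it
(`growth_of_glue`). As `P` is homogeneous of degree `0` for `|ξ| ≥ 1`, bounds for its derivatives on
`|ξ| ≤ 2` are the estimates of `S⁰` (`abs_symbolDeriv_le_of_homogeneous`). The term `-1/B` takes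
care of `|ξ| ≤ 1`.

**Finiteness of the escape times.** An orbit which is far away and outgoing never comes back, so
between two visits to a ball it stays in a larger ball. If an escape time were infinite, orbits with
long stays, translated to the middle of the stay, would accumulate at an orbit which is bounded for
all times, against the non-trapping condition (`escapeTime_ne_top`).
-/

namespace Doi

open Set Filter Topology MeasureTheory

/-! ### Partial derivatives of symbols -/

section SymbolDeriv

variable {n : ℕ}

theorem iterPartial_congr (α : List (Fin n)) {f g : E n → ℝ} {x : E n} (h : f =ᶠ[𝓝 x] g) :
    iterPartial α f =ᶠ[𝓝 x] iterPartial α g := by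
  induction α with
  | nil => exact h
  | cons i α ih =>
    filter_upwards [ih.fderiv (𝕜 := ℝ)] with y hy
    simp only [iterPartial, List.foldr_cons, partialDeriv] at hy ⊢
    rw [hy]

theorem iterPartial_const_mul (α : List (Fin n)) (c : ℝ) (f : E n → ℝ) :
    iterPartial α (fun x => c * f x) = fun x => c * iterPartial α f x := by
  induction α with
  | nil => rfl
  | cons i α ih =>
    simp only [iterPartial, List.foldr_cons] at ih ⊢
    rw [ih]
    funext x
    have := fderiv_const_smul_field (𝕜 := ℝ) c (f := List.foldr partialDeriv f α)
    simp only [partialDeriv]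
    change fderiv ℝ (c • List.foldr partialDeriv f α) x _ = _
    rw [this]
    rfl

theorem iterPartial_comp_smul (α : List (Fin n)) (c : ℝ) (f : E n → ℝ) :
    iterPartial α (fun x => f (c • x)) = fun x => c ^ α.length * iterPartial α f (c • x) := by
  induction α with
  | nil => simp [iterPartial]
  | cons i α ih =>
    have h := iterPartial_const_mul [i] (c ^ α.length) (fun x => iterPartial α f (c • x))
    simp only [iterPartial, List.foldr_cons, List.foldr_nil] at ih h ⊢
    rw [ih, h]
    funext x
    simp only [partialDeriv, List.length_cons]
    rw [fderiv_comp_smul]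
    simp only [smul_apply, smul_eq_mul]
    ring

/-- Partial derivatives in the second variable are again smooth functions on the product, and their
Fréchet derivatives are controlled by those of the original function. -/
theorem exists_iterPartial_snd {P : E n × E n → ℝ} (hP : ContDiff ℝ ∞ P) (α : List (Fin n)) :
    ∃ Q : E n × E n → ℝ, ContDiff ℝ ∞ Q ∧
      (∀ x ξ, iterPartial α (fun η => P (x, η)) ξ = Q (x, ξ)) ∧
      ∀ k z, ‖iteratedFDeriv ℝ k Q z‖ ≤ ‖iteratedFDeriv ℝ (k + α.length) P z‖ := by
  induction α with
  | nil => exact ⟨P, hP, fun _ _ => rfl, fun _ _ => le_rfl⟩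
  | cons i α ih =>
    obtain ⟨Q, hQ, hval, hbd⟩ := ih
    have hQ' : ContDiff ℝ ∞ (fderiv ℝ Q) := hQ.fderiv_right (by simp)
    refine ⟨fun z => fderiv ℝ Q z (0, EuclideanSpace.single i 1), hQ'.clm_apply contDiff_const,
      fun x ξ => ?_, fun k z => ?_⟩
    · have h1 : iterPartial α (fun η => P (x, η)) = fun ξ => Q (x, ξ) := funext (hval x)
      simp only [iterPartial, List.foldr_cons] at h1 ⊢
      rw [h1]
      have h2 : HasFDerivAt (fun ξ => Q (x, ξ))
          ((fderiv ℝ Q (x, ξ)).comp (ContinuousLinearMap.inr ℝ (E n) (E n))) ξ :=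
        ((hQ.differentiable (by simp)) (x, ξ)).hasFDerivAt.comp ξ (hasFDerivAt_prodMk_right x ξ)
      simp only [partialDeriv]
      rw [h2.fderiv]
      simp
    · refine (norm_iteratedFDeriv_clm_apply_const (N := ∞) hQ'.contDiffAt
        (by exact_mod_cast le_top)).trans ?_
      rw [norm_iteratedFDeriv_fderiv]
      have h3 : ‖((0 : E n), EuclideanSpace.single i (1 : ℝ))‖ = 1 := by
        simp [Prod.norm_def]
      rw [h3, one_mul]
      have h4 := hbd (k + 1) z
      rwa [show k + 1 + α.length = k + (i :: α).length by rw [List.length_cons]; ring] at h4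

theorem exists_iterPartial_fst {P : E n × E n → ℝ} (hP : ContDiff ℝ ∞ P) (α : List (Fin n)) :
    ∃ Q : E n × E n → ℝ, ContDiff ℝ ∞ Q ∧
      (∀ x ξ, iterPartial α (fun y => P (y, ξ)) x = Q (x, ξ)) ∧
      ∀ k z, ‖iteratedFDeriv ℝ k Q z‖ ≤ ‖iteratedFDeriv ℝ (k + α.length) P z‖ := by
  induction α with
  | nil => exact ⟨P, hP, fun _ _ => rfl, fun _ _ => le_rfl⟩
  | cons i α ih =>
    obtain ⟨Q, hQ, hval, hbd⟩ := ih
    have hQ' : ContDiff ℝ ∞ (fderiv ℝ Q) := hQ.fderiv_right (by simp)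
    refine ⟨fun z => fderiv ℝ Q z (EuclideanSpace.single i 1, 0), hQ'.clm_apply contDiff_const,
      fun x ξ => ?_, fun k z => ?_⟩
    · have h1 : iterPartial α (fun y => P (y, ξ)) = fun x => Q (x, ξ) :=
        funext fun x => hval x ξ
      simp only [iterPartial, List.foldr_cons] at h1 ⊢
      rw [h1]
      have h2 : HasFDerivAt (fun x => Q (x, ξ))
          ((fderiv ℝ Q (x, ξ)).comp (ContinuousLinearMap.inl ℝ (E n) (E n))) x :=
        ((hQ.differentiable (by simp)) (x, ξ)).hasFDerivAt.comp x (hasFDerivAt_prodMk_left x ξ)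
      simp only [partialDeriv]
      rw [h2.fderiv]
      simp
    · refine (norm_iteratedFDeriv_clm_apply_const (N := ∞) hQ'.contDiffAt
        (by exact_mod_cast le_top)).trans ?_
      rw [norm_iteratedFDeriv_fderiv]
      have h3 : ‖(EuclideanSpace.single i (1 : ℝ), (0 : E n))‖ = 1 := by
        simp [Prod.norm_def]
      rw [h3, one_mul]
      have h4 := hbd (k + 1) z
      rwa [show k + 1 + α.length = k + (i :: α).length by rw [List.length_cons]; ring] at h4

theorem abs_symbolDeriv_le {P : E n × E n → ℝ} (hP : ContDiff ℝ ∞ P) (β α : List (Fin n))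
    (x ξ : E n) :
    |symbolDeriv (fun x ξ => P (x, ξ)) β α x ξ| ≤
      ‖iteratedFDeriv ℝ (β.length + α.length) P (x, ξ)‖ := by
  obtain ⟨Q, hQ, hval, hbd⟩ := exists_iterPartial_snd hP α
  obtain ⟨Q', hQ', hval', hbd'⟩ := exists_iterPartial_fst hQ β
  have h : symbolDeriv (fun x ξ => P (x, ξ)) β α x ξ = Q' (x, ξ) := by
    simp only [symbolDeriv, hval, hval']
  rw [h]
  have h0 := hbd' 0 (x, ξ)
  rw [zero_add, norm_iteratedFDeriv_zero, Real.norm_eq_abs] at h0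
  exact h0.trans (hbd _ _)

/-- Homogeneity relates the derivatives at `ξ` to those at the point of norm `2` on the same ray,
each `ξ`-derivative costing a factor `2 / |ξ|`. -/
theorem symbolDeriv_eq_of_homogeneous {p : E n → E n → ℝ}
    (hp : ∀ x ξ, 1 ≤ ‖ξ‖ → ∀ c : ℝ, 1 ≤ c → p x (c • ξ) = p x ξ)
    (β α : List (Fin n)) (x ξ : E n) (hξ : 2 ≤ ‖ξ‖) :
    symbolDeriv p β α x ξ =
      (2 / ‖ξ‖) ^ α.length * symbolDeriv p β α x ((2 / ‖ξ‖) • ξ) := by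
  set c : ℝ := 2 / ‖ξ‖ with hc
  have hc0 : 0 < c := by positivity
  have hc1 : c ≤ 1 := (div_le_one (by linarith)).2 hξ
  have hloc : ∀ y, p y =ᶠ[𝓝 ξ] fun η => p y (c • η) := by
    intro y
    have h1 : ∀ᶠ η in 𝓝 ξ, 1 < ‖c • η‖ := by
      refine ContinuousAt.eventually_lt continuousAt_const (by fun_prop) ?_
      rw [norm_smul, Real.norm_of_nonneg hc0.le, hc, div_mul_cancel₀ _ (by linarith)]
      norm_num
    filter_upwards [h1] with η hη
    have h := hp y (c • η) hη.le c⁻¹ ((one_le_inv₀ hc0).2 hc1)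
    rw [smul_smul, inv_mul_cancel₀ hc0.ne', one_smul] at h
    exact h
  have h2 : ∀ y, iterPartial α (p y) ξ = c ^ α.length * iterPartial α (p y) (c • ξ) := by
    intro y
    rw [(iterPartial_congr α (hloc y)).eq_of_nhds, iterPartial_comp_smul]
  simp only [symbolDeriv, h2]
  rw [iterPartial_const_mul]

/-- A smooth function which is positively homogeneous of degree `0` in `ξ` for `|ξ| ≥ 1` satisfies
the estimates of `S⁰` as soon as its derivatives are bounded for `|ξ| ≤ 2`. -/
theorem abs_symbolDeriv_le_of_homogeneous {P : E n × E n → ℝ} (hP : ContDiff ℝ ∞ P)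
    (hhom : ∀ x ξ, 1 ≤ ‖ξ‖ → ∀ c : ℝ, 1 ≤ c → P (x, c • ξ) = P (x, ξ))
    (β α : List (Fin n)) {A : ℝ}
    (hA : ∀ x ξ, ‖ξ‖ ≤ 2 → ‖iteratedFDeriv ℝ (β.length + α.length) P (x, ξ)‖ ≤ A) (x ξ : E n) :
    |symbolDeriv (fun x ξ => P (x, ξ)) β α x ξ| ≤
      (3 ^ α.length * A) * (1 + ‖ξ‖) ^ (-(α.length : ℝ)) := by
  have hpos : 0 < 1 + ‖ξ‖ := by positivity
  have hA0 : 0 ≤ A := (norm_nonneg _).trans (hA 0 0 (by simp))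
  have hR : (3 ^ α.length * A) * (1 + ‖ξ‖) ^ (-(α.length : ℝ)) =
      (3 / (1 + ‖ξ‖)) ^ α.length * A := by
    rw [Real.rpow_neg hpos.le, Real.rpow_natCast, div_pow]
    field_simp
  rw [hR]
  rcases le_total ‖ξ‖ 2 with h | h
  · refine ((abs_symbolDeriv_le hP β α x ξ).trans (hA x ξ h)).trans ?_
    refine le_mul_of_one_le_left hA0 (one_le_pow₀ ?_)
    rw [one_le_div hpos]; linarith
  · rw [symbolDeriv_eq_of_homogeneous (p := fun x ξ => P (x, ξ)) hhom β α x ξ h, abs_mul, abs_pow,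
      abs_of_nonneg (by positivity : 0 ≤ 2 / ‖ξ‖)]
    have h3 : ‖(2 / ‖ξ‖) • ξ‖ ≤ 2 := by
      rw [norm_smul, Real.norm_of_nonneg (by positivity), div_mul_cancel₀ _ (by linarith)]
    refine mul_le_mul ?_ ((abs_symbolDeriv_le hP β α x _).trans (hA x _ h3)) (abs_nonneg _)
      (by positivity)
    refine pow_le_pow_left₀ (by positivity) ?_ _
    rw [div_le_div_iff₀ (by linarith) hpos]
    linarith

end SymbolDeriv

/-! ### Bounds for derivatives of all orders -/

section DerivBounds

/-- Composition with a fixed map whose derivatives are bounded on `S` preserves bounds on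
derivatives, uniformly in the outer function. -/
theorem exists_bound_iteratedFDeriv_comp {X Y W : Type*} [NormedAddCommGroup X] [NormedSpace ℝ X]
    [NormedAddCommGroup Y] [NormedSpace ℝ Y] [NormedAddCommGroup W] [NormedSpace ℝ W]
    {S : Set X} {N : X → Y} (hN : ContDiff ℝ ∞ N) {k : ℕ}
    (hb : ∀ i, 1 ≤ i → i ≤ k → ∃ C, ∀ x ∈ S, ‖iteratedFDeriv ℝ i N x‖ ≤ C) (A : ℝ) :
    ∃ C, ∀ f : Y → W, ContDiff ℝ ∞ f →
      (∀ i ≤ k, ∀ x ∈ S, ‖iteratedFDeriv ℝ i f (N x)‖ ≤ A) →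
      ∀ x ∈ S, ‖iteratedFDeriv ℝ k (f ∘ N) x‖ ≤ C := by
  have hb' : ∀ i, ∃ C, 1 ≤ i → i ≤ k → ∀ x ∈ S, ‖iteratedFDeriv ℝ i N x‖ ≤ C := by
    intro i
    by_cases h : 1 ≤ i ∧ i ≤ k
    · obtain ⟨C, hC⟩ := hb i h.1 h.2
      exact ⟨C, fun _ _ => hC⟩
    · exact ⟨0, fun h1 h2 => (h ⟨h1, h2⟩).elim⟩
  choose c hc using hb'
  set D : ℝ := 1 + ∑ i ∈ Finset.range (k + 1), |c i| with hD
  have hs : 0 ≤ ∑ i ∈ Finset.range (k + 1), |c i| := Finset.sum_nonneg fun i _ => abs_nonneg _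
  refine ⟨k.factorial * A * D ^ k, fun f hf hA x hx => ?_⟩
  refine norm_iteratedFDeriv_comp_le (N := ∞) hf hN (by exact_mod_cast le_top) x
    (fun i hi => hA i hi x hx) fun i h1 hi => ?_
  calc ‖iteratedFDeriv ℝ i N x‖ ≤ |c i| := (hc i h1 hi x hx).trans (le_abs_self _)
    _ ≤ ∑ i ∈ Finset.range (k + 1), |c i| :=
      Finset.single_le_sum (f := fun i => |c i|) (fun i _ => abs_nonneg _)
        (Finset.mem_range.2 (Nat.lt_succ_of_le hi))
    _ ≤ D := by linarith
    _ ≤ D ^ i := le_self_pow₀ (by linarith) (by omega)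

theorem exists_bound_iteratedFDeriv_of_isCompact {X W : Type*} [NormedAddCommGroup X]
    [NormedSpace ℝ X] [NormedAddCommGroup W] [NormedSpace ℝ W] {K : Set X} (hK : IsCompact K)
    {f : X → W} (hf : ContDiff ℝ ∞ f) (k : ℕ) :
    ∃ C, ∀ i ≤ k, ∀ x ∈ K, ‖iteratedFDeriv ℝ i f x‖ ≤ C := by
  have h : ∀ i : ℕ, ∃ C, ∀ x ∈ K, ‖iteratedFDeriv ℝ i f x‖ ≤ C := fun i =>
    hK.exists_bound_of_continuousOn
      (hf.continuous_iteratedFDeriv (by exact_mod_cast le_top)).continuousOn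
  choose c hc using h
  refine ⟨∑ i ∈ Finset.range (k + 1), |c i|, fun i hi x hx => ?_⟩
  calc ‖iteratedFDeriv ℝ i f x‖ ≤ |c i| := (hc i x hx).trans (le_abs_self _)
    _ ≤ _ := Finset.single_le_sum (f := fun i => |c i|) (fun i _ => abs_nonneg _)
        (Finset.mem_range.2 (Nat.lt_succ_of_le hi))

/-- If a map `N` solves an autonomous system `DN = R ∘ N` with smooth `R` and stays in a compact
set on `S`, then all its derivatives are bounded on `S`: each differentiation expresses the next
derivative as a smooth function of lower ones. -/
theorem exists_bound_iteratedFDeriv_of_fderiv_eq_comp {X Y : Type*} [NormedAddCommGroup X]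
    [NormedSpace ℝ X] [NormedAddCommGroup Y] [NormedSpace ℝ Y] {S : Set X} {K : Set Y}
    (hK : IsCompact K) {N : X → Y} (hN : ContDiff ℝ ∞ N) (hNK : MapsTo N S K)
    {R : Y → X →L[ℝ] Y} (hR : ContDiff ℝ ∞ R) (hNR : fderiv ℝ N = R ∘ N) (k : ℕ) :
    ∃ C, ∀ x ∈ S, ‖iteratedFDeriv ℝ k N x‖ ≤ C := by
  induction k using Nat.strong_induction_on with
  | _ k ih =>
    rcases k with _ | k
    · obtain ⟨C, hC⟩ := hK.exists_bound_of_continuousOn (f := fun y => y) continuousOn_id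
      exact ⟨C, fun x hx => by simpa using hC _ (hNK hx)⟩
    · obtain ⟨A, hA⟩ := exists_bound_iteratedFDeriv_of_isCompact hK hR k
      obtain ⟨C, hC⟩ := exists_bound_iteratedFDeriv_comp (W := X →L[ℝ] Y) (S := S) hN (k := k)
        (fun i _ hi => ih i (by omega)) A
      refine ⟨C, fun x hx => ?_⟩
      rw [← norm_iteratedFDeriv_fderiv, hNR]
      exact hC R hR (fun i hi x hx => hA i hi _ (hNK hx)) x hx

universe u in
/-- Convolution with a fixed smooth compactly supported kernel bounds all derivatives in terms of
the supremum of the function. -/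
theorem exists_bound_iteratedFDeriv_convolution {G : Type u} [NormedAddCommGroup G]
    [NormedSpace ℝ G] [FiniteDimensional ℝ G] [MeasurableSpace G] [BorelSpace G]
    (μ : Measure G) [μ.IsAddHaarMeasure] (A : ℝ) (k : ℕ) :
    ∀ {E₁ F : Type u} [NormedAddCommGroup E₁] [NormedSpace ℝ E₁] [NormedAddCommGroup F]
      [NormedSpace ℝ F] (L : E₁ →L[ℝ] ℝ →L[ℝ] F) (ρ : G → E₁), ContDiff ℝ ∞ ρ →
      HasCompactSupport ρ → ∃ C, ∀ g : G → ℝ, Continuous g → (∀ x, |g x| ≤ A) → ∀ x,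
        ‖iteratedFDeriv ℝ k (convolution ρ g L μ) x‖ ≤ C := by
  induction k with
  | zero =>
    intro E₁ F _ _ _ _ L ρ hρ hρc
    refine ⟨∫ t, ‖L‖ * ‖ρ t‖ * A ∂μ, fun g hg hgA x => ?_⟩
    rw [norm_iteratedFDeriv_zero, convolution_def]
    refine norm_integral_le_of_norm_le ?_ (ae_of_all _ fun t => ?_)
    · exact ((hρ.continuous.norm.integrable_of_hasCompactSupport hρc.norm).const_mul _).mul_const _
    · refine ((L (ρ t)).le_opNorm _).trans ?_
      refine mul_le_mul (L.le_opNorm _) (by simpa using hgA (x - t)) (norm_nonneg _) (by positivity)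
  | succ k ih =>
    intro E₁ F _ _ _ _ L ρ hρ hρc
    obtain ⟨C, hC⟩ := ih (L.precompL G) (fderiv ℝ ρ) (hρ.fderiv_right (by simp))
      (hρc.fderiv (𝕜 := ℝ))
    refine ⟨C, fun g hg hgA x => ?_⟩
    have h : fderiv ℝ (convolution ρ g L μ) = convolution (fderiv ℝ ρ) g (L.precompL G) μ :=
      funext fun y => (hρc.hasFDerivAt_convolution_left L (hρ.of_le (by exact_mod_cast le_top))
        hg.locallyIntegrable y).fderiv
    rw [← norm_iteratedFDeriv_fderiv, h]
    exact hC g hg hgA x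

end DerivBounds

/-! ### The Hamiltonian vector field of a quadratic symbol -/

section Field

variable {n : ℕ}

/-- The hypotheses of the theorem on the coefficients, apart from non-trapping. Two bounded
derivatives are all that the argument uses. -/
structure Admissible (γ C₁ : ℝ) (a : Fin n → Fin n → E n → ℝ) : Prop where
  elliptic : IsElliptic γ a
  regular : IsRegular 2 C₁ a
  flat : IsAsymptoticallyFlat C₁ a

/-- The `x`-component `∂_ξ h` of the Hamiltonian vector field. -/
noncomputable def velX (a : Fin n → Fin n → E n → ℝ) (x ξ : E n) : E n :=
  WithLp.toLp 2 fun j => ∑ k, (a j k x + a k j x) * ξ k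

/-- The `ξ`-component `-∂_x h` of the Hamiltonian vector field. -/
noncomputable def velΞ (a : Fin n → Fin n → E n → ℝ) (x ξ : E n) : E n :=
  WithLp.toLp 2 fun j => -∑ l, ∑ k, partialDeriv j (a l k) x * ξ l * ξ k

/-- The Hamiltonian vector field `(∂_ξ h, -∂_x h)` on phase space. -/
noncomputable def hamField (a : Fin n → Fin n → E n → ℝ) (z : E n × E n) : E n × E n :=
  (velX a z.1 z.2, velΞ a z.1 z.2)

@[simp] theorem velX_apply (a : Fin n → Fin n → E n → ℝ) (x ξ : E n) (j : Fin n) :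
    velX a x ξ j = ∑ k, (a j k x + a k j x) * ξ k := rfl

@[simp] theorem velΞ_apply (a : Fin n → Fin n → E n → ℝ) (x ξ : E n) (j : Fin n) :
    velΞ a x ξ j = -∑ l, ∑ k, partialDeriv j (a l k) x * ξ l * ξ k := rfl

theorem abs_coord_le (v : E n) (j : Fin n) : |v j| ≤ ‖v‖ := by
  simpa using PiLp.norm_apply_le v j

theorem eq_sum_single (v : E n) : v = ∑ j, v j • EuclideanSpace.single j (1 : ℝ) := by
  ext i
  simp [Finset.sum_apply, Pi.single_apply]

theorem norm_le_of_coord_le {v : E n} {B : ℝ} (h : ∀ j, |v j| ≤ B) : ‖v‖ ≤ n * B := by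
  rw [eq_sum_single v]
  refine (norm_sum_le _ _).trans ?_
  calc ∑ j, ‖v j • EuclideanSpace.single j (1 : ℝ)‖ ≤ ∑ _j : Fin n, B :=
        Finset.sum_le_sum fun j _ => by simpa [norm_smul] using h j
    _ = n * B := by simp

theorem norm_clm_le_of_single_le {L : E n →L[ℝ] ℝ} {B : ℝ} (hB : 0 ≤ B)
    (h : ∀ j, |L (EuclideanSpace.single j 1)| ≤ B) : ‖L‖ ≤ n * B := by
  refine L.opNorm_le_bound (by positivity) fun v => ?_
  conv_lhs => rw [eq_sum_single v]
  rw [map_sum]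
  refine (norm_sum_le _ _).trans ?_
  calc ∑ j, ‖L (v j • EuclideanSpace.single j (1 : ℝ))‖ ≤ ∑ _j : Fin n, ‖v‖ * B :=
        Finset.sum_le_sum fun j _ => by
          rw [map_smul, smul_eq_mul, norm_mul]
          exact mul_le_mul (by simpa using abs_coord_le v j) (h j) (norm_nonneg _) (norm_nonneg _)
    _ = n * B * ‖v‖ := by simp; ring

theorem abs_partialDeriv_le (j : Fin n) (f : E n → ℝ) (x : E n) :
    |partialDeriv j f x| ≤ ‖fderiv ℝ f x‖ := by
  simpa [partialDeriv] using (fderiv ℝ f x).le_opNorm (EuclideanSpace.single j 1)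

theorem hasDerivAt_coord_iff {f : ℝ → E n} {f' : E n} {t : ℝ} :
    HasDerivAt f f' t ↔ ∀ i, HasDerivAt (fun s => f s i) (f' i) t := by
  constructor
  · intro h i
    exact (EuclideanSpace.proj (𝕜 := ℝ) i).hasFDerivAt.comp_hasDerivAt t h
  · intro h
    exact ((EuclideanSpace.equiv (Fin n) ℝ).symm.toContinuousLinearMap.hasFDerivAt).comp_hasDerivAt
      t (hasDerivAt_pi.2 h : HasDerivAt (fun s => fun i => f s i) (fun i => f' i) t)

theorem partialDeriv_eq_deriv {f : E n → ℝ} {x : E n} (hf : DifferentiableAt ℝ f x) (j : Fin n)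
    {d : ℝ} (h : HasDerivAt (fun t : ℝ => f (x + t • EuclideanSpace.single j 1)) d 0) :
    partialDeriv j f x = d := by
  have h1 : HasDerivAt (fun t : ℝ => x + t • EuclideanSpace.single j (1 : ℝ))
      (EuclideanSpace.single j 1) 0 := by
    simpa using ((hasDerivAt_id (0 : ℝ)).smul_const (EuclideanSpace.single j (1 : ℝ))).const_add x
  have h2 : HasFDerivAt f (fderiv ℝ f x) (x + (0 : ℝ) • EuclideanSpace.single j (1 : ℝ)) := by
    simpa using hf.hasFDerivAt
  exact (h2.comp_hasDerivAt 0 h1).unique h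

variable {a : Fin n → Fin n → E n → ℝ}

theorem hasDerivAt_quadSymbol {a' : Fin n → Fin n → ℝ} {X Ξ : ℝ → E n} {w : E n} {t : ℝ}
    (ha : ∀ l k, HasDerivAt (fun s => a l k (X s)) (a' l k) t) (hΞ : HasDerivAt Ξ w t) :
    HasDerivAt (fun s => quadSymbol a (X s) (Ξ s))
      (∑ l, ∑ k, a' l k * Ξ t l * Ξ t k + ∑ j, velX a (X t) (Ξ t) j * w j) t := by
  have hc := hasDerivAt_coord_iff.1 hΞ
  have h : HasDerivAt (fun s => quadSymbol a (X s) (Ξ s))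
      (∑ l, ∑ k, ((a' l k * Ξ t l + a l k (X t) * w l) * Ξ t k +
        a l k (X t) * Ξ t l * w k)) t := by
    unfold quadSymbol
    refine HasDerivAt.fun_sum fun l _ => HasDerivAt.fun_sum fun k _ => ?_
    exact ((ha l k).mul (hc l)).mul (hc k)
  convert h using 1
  have e : ∑ j, velX a (X t) (Ξ t) j * w j =
      ∑ l, ∑ k, a l k (X t) * w l * Ξ t k + ∑ l, ∑ k, a l k (X t) * Ξ t l * w k := by
    rw [Finset.sum_comm (f := fun l k => a l k (X t) * Ξ t l * w k), ← Finset.sum_add_distrib]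
    refine Finset.sum_congr rfl fun j _ => ?_
    rw [velX_apply, Finset.sum_mul, ← Finset.sum_add_distrib]
    exact Finset.sum_congr rfl fun k _ => by ring
  rw [e, ← Finset.sum_add_distrib, ← Finset.sum_add_distrib]
  refine Finset.sum_congr rfl fun l _ => ?_
  rw [← Finset.sum_add_distrib, ← Finset.sum_add_distrib]
  exact Finset.sum_congr rfl fun k _ => by ring

theorem differentiable_quadSymbol (ha : ∀ l k, Differentiable ℝ (a l k)) :
    Differentiable ℝ fun z : E n × E n => quadSymbol a z.1 z.2 := by
  unfold quadSymbol
  have hp : ∀ l : Fin n, Differentiable ℝ fun z : E n × E n => z.2 l := fun l =>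
    (EuclideanSpace.proj (𝕜 := ℝ) l).differentiable.comp differentiable_snd
  refine Differentiable.fun_sum fun l _ => Differentiable.fun_sum fun k _ => ?_
  exact ((((ha l k).comp differentiable_fst).mul (hp l)).mul (hp k))

theorem partialDeriv_quadSymbol_snd (ha : ∀ l k, Differentiable ℝ (a l k)) (x ξ : E n)
    (j : Fin n) : partialDeriv j (fun η => quadSymbol a x η) ξ = velX a x ξ j := by
  refine partialDeriv_eq_deriv ?_ j ?_
  · exact ((differentiable_quadSymbol ha).comp
      (by fun_prop : Differentiable ℝ fun η : E n => (x, η))) ξ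
  · have h1 : HasDerivAt (fun t : ℝ => ξ + t • EuclideanSpace.single j (1 : ℝ))
        (EuclideanSpace.single j 1) 0 := by
      simpa using ((hasDerivAt_id (0 : ℝ)).smul_const (EuclideanSpace.single j (1 : ℝ))).const_add ξ
    have h := hasDerivAt_quadSymbol (a := a) (a' := fun _ _ => 0) (X := fun _ => x)
      (fun l k => hasDerivAt_const _ _) h1
    convert h using 1
    simp

theorem partialDeriv_quadSymbol_fst (ha : ∀ l k, Differentiable ℝ (a l k)) (x ξ : E n)
    (j : Fin n) : partialDeriv j (fun y => quadSymbol a y ξ) x = -velΞ a x ξ j := by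
  refine partialDeriv_eq_deriv ?_ j ?_
  · exact ((differentiable_quadSymbol ha).comp
      (by fun_prop : Differentiable ℝ fun y : E n => (y, ξ))) x
  · have h1 : HasDerivAt (fun t : ℝ => x + t • EuclideanSpace.single j (1 : ℝ))
        (EuclideanSpace.single j 1) 0 := by
      simpa using ((hasDerivAt_id (0 : ℝ)).smul_const (EuclideanSpace.single j (1 : ℝ))).const_add x
    have h2 : ∀ l k, HasDerivAt (fun t : ℝ => a l k (x + t • EuclideanSpace.single j (1 : ℝ)))
        (partialDeriv j (a l k) x) 0 := by
      intro l k
      have h3 : HasFDerivAt (a l k) (fderiv ℝ (a l k) x)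
          (x + (0 : ℝ) • EuclideanSpace.single j (1 : ℝ)) := by
        simpa using (ha l k x).hasFDerivAt
      exact h3.comp_hasDerivAt 0 h1
    have h := hasDerivAt_quadSymbol (a := a) (Ξ := fun _ => ξ) h2 (hasDerivAt_const _ _)
    convert h using 1
    simp

/-- `H_h p` is the derivative of `p` along the Hamiltonian vector field. -/
theorem hamiltonian_eq_fderiv (ha : ∀ l k, Differentiable ℝ (a l k)) {P : E n × E n → ℝ}
    {x ξ : E n} (hP : DifferentiableAt ℝ P (x, ξ)) :
    hamiltonian (quadSymbol a) (fun x ξ => P (x, ξ)) x ξ =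
      fderiv ℝ P (x, ξ) (hamField a (x, ξ)) := by
  have h1 : ∀ j, partialDeriv j (fun y => P (y, ξ)) x =
      fderiv ℝ P (x, ξ) (EuclideanSpace.single j 1, 0) := by
    intro j
    have := (HasFDerivAt.comp (g := P) (f := fun y => (y, ξ)) x hP.hasFDerivAt
      (hasFDerivAt_prodMk_left x ξ)).fderiv
    simp only [partialDeriv]
    change fderiv ℝ (P ∘ fun y => (y, ξ)) x _ = _
    rw [this]; simp
  have h2 : ∀ j, partialDeriv j (fun η => P (x, η)) ξ =
      fderiv ℝ P (x, ξ) (0, EuclideanSpace.single j 1) := by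
    intro j
    have := (HasFDerivAt.comp (g := P) ξ hP.hasFDerivAt (hasFDerivAt_prodMk_right x ξ)).fderiv
    simp only [partialDeriv]
    change fderiv ℝ (P ∘ fun y => (x, y)) ξ _ = _
    rw [this]; simp
  have h3 : hamField a (x, ξ) = ∑ j, (velX a x ξ j • (EuclideanSpace.single j (1 : ℝ), (0 : E n)) +
      velΞ a x ξ j • ((0 : E n), EuclideanSpace.single j (1 : ℝ))) := by
    refine Prod.ext ?_ ?_
    · rw [Prod.fst_sum]
      simpa [hamField] using eq_sum_single (velX a x ξ)
    · rw [Prod.snd_sum]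
      simpa [hamField] using eq_sum_single (velΞ a x ξ)
  rw [h3, map_sum, hamiltonian]
  refine Finset.sum_congr rfl fun j _ => ?_
  rw [partialDeriv_quadSymbol_snd ha, partialDeriv_quadSymbol_fst ha, h1, h2, map_add, map_smul,
    map_smul, smul_eq_mul, smul_eq_mul]
  ring

/-- The symbol is conserved by its own Hamiltonian field. -/
theorem fderiv_quadSymbol_hamField (ha : ∀ l k, Differentiable ℝ (a l k)) (z : E n × E n) :
    fderiv ℝ (fun z : E n × E n => quadSymbol a z.1 z.2) z (hamField a z) = 0 := by
  have h := hamiltonian_eq_fderiv (x := z.1) (ξ := z.2) ha (differentiable_quadSymbol ha z)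
  rw [← h, hamiltonian]
  exact Finset.sum_eq_zero fun j _ => by ring

theorem isBicharacteristic_iff (ha : ∀ l k, Differentiable ℝ (a l k)) {X Ξ : ℝ → E n} :
    IsBicharacteristic (quadSymbol a) X Ξ ↔
      ∀ s, HasDerivAt (fun t => (X t, Ξ t)) (hamField a (X s, Ξ s)) s := by
  refine forall_congr' fun s => ?_
  simp only [partialDeriv_quadSymbol_snd ha, partialDeriv_quadSymbol_fst ha, neg_neg]
  constructor
  · intro h
    exact (hasDerivAt_coord_iff.2 fun i => (h i).1).prodMk (hasDerivAt_coord_iff.2 fun i => (h i).2)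
  · intro h
    have h1 : HasDerivAt X (velX a (X s) (Ξ s)) s :=
      (ContinuousLinearMap.fst ℝ (E n) (E n)).hasFDerivAt.comp_hasDerivAt s h
    have h2 : HasDerivAt Ξ (velΞ a (X s) (Ξ s)) s :=
      (ContinuousLinearMap.snd ℝ (E n) (E n)).hasFDerivAt.comp_hasDerivAt s h
    exact fun j => ⟨hasDerivAt_coord_iff.1 h1 j, hasDerivAt_coord_iff.1 h2 j⟩

theorem quadSymbol_smul (x ξ : E n) (c : ℝ) :
    quadSymbol a x (c • ξ) = c ^ 2 * quadSymbol a x ξ := by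
  simp only [quadSymbol, Finset.mul_sum, PiLp.smul_apply, smul_eq_mul]
  exact Finset.sum_congr rfl fun l _ => Finset.sum_congr rfl fun k _ => by ring

theorem velX_smul (x ξ : E n) (c : ℝ) : velX a x (c • ξ) = c • velX a x ξ := by
  ext j
  simp only [velX_apply, Finset.mul_sum, PiLp.smul_apply, smul_eq_mul]
  exact Finset.sum_congr rfl fun k _ => by ring

theorem velΞ_smul (x ξ : E n) (c : ℝ) : velΞ a x (c • ξ) = c ^ 2 • velΞ a x ξ := by
  ext j
  simp only [velΞ_apply, Finset.mul_sum, PiLp.smul_apply, smul_eq_mul, mul_neg]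
  congr 1
  exact Finset.sum_congr rfl fun l _ => Finset.sum_congr rfl fun k _ => by ring

/-- Euler's identity for the quadratic form `h (x, ·)`. -/
theorem inner_velX (x ξ : E n) : inner ℝ (velX a x ξ) ξ = 2 * quadSymbol a x ξ := by
  have h : ∑ j, velX a x ξ j * ξ j = 2 * quadSymbol a x ξ := by
    simp only [velX_apply, quadSymbol, Finset.sum_mul]
    have h1 : ∑ j, ∑ k, (a j k x + a k j x) * ξ k * ξ j =
        ∑ j, ∑ k, a j k x * ξ j * ξ k + ∑ j, ∑ k, a k j x * ξ k * ξ j := by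
      rw [← Finset.sum_add_distrib]
      refine Finset.sum_congr rfl fun j _ => ?_
      rw [← Finset.sum_add_distrib]
      exact Finset.sum_congr rfl fun k _ => by ring
    rw [h1, Finset.sum_comm (f := fun j k => a k j x * ξ k * ξ j)]
    ring
  rw [← h, PiLp.inner_apply]
  exact Finset.sum_congr rfl fun j _ => by simp [mul_comm]

end Field

/-! ### Uniform bounds for admissible coefficients -/

section Bounds

variable {n : ℕ} {γ C₁ : ℝ} {a : Fin n → Fin n → E n → ℝ}

/-- A constant dominating the symbol and the components of its Hamiltonian field. -/
noncomputable def fieldBound (n : ℕ) (γ C₁ : ℝ) : ℝ := 2 * ((n : ℝ) + 1) ^ 3 * C₁ + γ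

theorem Admissible.contDiff (h : Admissible γ C₁ a) (l k : Fin n) : ContDiff ℝ 2 (a l k) :=
  (h.regular l k).1

theorem Admissible.differentiable (h : Admissible γ C₁ a) (l k : Fin n) :
    Differentiable ℝ (a l k) := (h.contDiff l k).differentiable (by simp)

theorem Admissible.abs_le (h : Admissible γ C₁ a) (l k : Fin n) (x : E n) : |a l k x| ≤ C₁ := by
  simpa [iterPartial] using (h.regular l k).2 [] (by simp) x

theorem Admissible.norm_fderiv_le (hC : 0 ≤ C₁) (h : Admissible γ C₁ a) (l k : Fin n) (x : E n) :
    ‖fderiv ℝ (a l k) x‖ ≤ C₁ :=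
  (h.flat l k x).trans (div_le_self hC (by nlinarith [sq_nonneg ‖x‖]))

theorem le_fieldBound (hC : 0 ≤ C₁) : γ ≤ fieldBound n γ C₁ := by
  have : 0 ≤ 2 * ((n : ℝ) + 1) ^ 3 * C₁ := by positivity
  simp only [fieldBound]; linarith

theorem fieldBound_pos (hγ : 0 < γ) (hC : 0 ≤ C₁) : 0 < fieldBound n γ C₁ :=
  hγ.trans_le (le_fieldBound hC)

theorem Admissible.norm_velX_le (hγ : 0 < γ) (hC : 0 ≤ C₁) (h : Admissible γ C₁ a) (x ξ : E n) :
    ‖velX a x ξ‖ ≤ fieldBound n γ C₁ * ‖ξ‖ := by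
  have h1 : ∀ j, |velX a x ξ j| ≤ n * (2 * C₁ * ‖ξ‖) := by
    intro j
    rw [velX_apply]
    refine (Finset.abs_sum_le_sum_abs _ _).trans ?_
    calc _ ≤ ∑ _k : Fin n, 2 * C₁ * ‖ξ‖ := Finset.sum_le_sum fun k _ => by
            rw [abs_mul]
            refine mul_le_mul ?_ (abs_coord_le ξ k) (abs_nonneg _) (by positivity)
            linarith [abs_add_le (a j k x) (a k j x), h.abs_le j k x, h.abs_le k j x]
      _ = _ := by simp
  refine (norm_le_of_coord_le h1).trans ?_
  have hn : (0 : ℝ) ≤ n := by positivity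
  have : (n : ℝ) * (n * (2 * C₁ * ‖ξ‖)) = (2 * (n : ℝ) ^ 2 * C₁) * ‖ξ‖ := by ring
  rw [this]
  refine mul_le_mul_of_nonneg_right ?_ (norm_nonneg _)
  have h2 : (n : ℝ) ^ 2 ≤ ((n : ℝ) + 1) ^ 3 := by nlinarith [pow_nonneg hn 3, pow_nonneg hn 2]
  have h3 := mul_le_mul_of_nonneg_right h2 hC
  simp only [fieldBound]; nlinarith

theorem Admissible.norm_velΞ_le (hγ : 0 < γ) (hC : 0 ≤ C₁) (h : Admissible γ C₁ a) (x ξ : E n) :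
    ‖velΞ a x ξ‖ ≤ fieldBound n γ C₁ * ‖ξ‖ ^ 2 / (1 + ‖x‖ ^ 2) := by
  have h1 : ∀ j, |velΞ a x ξ j| ≤ n * (n * (C₁ / (1 + ‖x‖ ^ 2) * ‖ξ‖ * ‖ξ‖)) := by
    intro j
    rw [velΞ_apply, abs_neg]
    refine (Finset.abs_sum_le_sum_abs _ _).trans ?_
    calc _ ≤ ∑ _l : Fin n, n * (C₁ / (1 + ‖x‖ ^ 2) * ‖ξ‖ * ‖ξ‖) := Finset.sum_le_sum fun l _ => by
            refine (Finset.abs_sum_le_sum_abs _ _).trans ?_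
            calc _ ≤ ∑ _k : Fin n, C₁ / (1 + ‖x‖ ^ 2) * ‖ξ‖ * ‖ξ‖ :=
                  Finset.sum_le_sum fun k _ => by
                    rw [abs_mul, abs_mul]
                    gcongr
                    · exact (abs_partialDeriv_le j _ x).trans (h.flat l k x)
                    · exact abs_coord_le ξ l
                    · exact abs_coord_le ξ k
              _ = _ := by simp
      _ = _ := by simp
  refine (norm_le_of_coord_le h1).trans ?_
  have hn : (0 : ℝ) ≤ n := by positivity
  have : (n : ℝ) * (n * (n * (C₁ / (1 + ‖x‖ ^ 2) * ‖ξ‖ * ‖ξ‖))) =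
      ((n : ℝ) ^ 3 * C₁) * ‖ξ‖ ^ 2 / (1 + ‖x‖ ^ 2) := by ring
  rw [this]
  gcongr
  have h2 : (n : ℝ) ^ 3 ≤ 2 * ((n : ℝ) + 1) ^ 3 := by nlinarith [pow_nonneg hn 3, pow_nonneg hn 2]
  have h3 := mul_le_mul_of_nonneg_right h2 hC
  simp only [fieldBound]; linarith

theorem Admissible.quadSymbol_le (hγ : 0 < γ) (hC : 0 ≤ C₁) (h : Admissible γ C₁ a) (x ξ : E n) :
    quadSymbol a x ξ ≤ fieldBound n γ C₁ * ‖ξ‖ ^ 2 := by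
  have h1 := real_inner_le_norm (velX a x ξ) ξ
  rw [inner_velX] at h1
  have h2 := h.norm_velX_le hγ hC x ξ
  have h3 : ‖velX a x ξ‖ * ‖ξ‖ ≤ fieldBound n γ C₁ * ‖ξ‖ * ‖ξ‖ :=
    mul_le_mul_of_nonneg_right h2 (norm_nonneg _)
  have h4 : 0 ≤ quadSymbol a x ξ := le_trans (by positivity) (h.elliptic x ξ)
  nlinarith

theorem Admissible.quadSymbol_nonneg (hγ : 0 < γ) (h : Admissible γ C₁ a) (x ξ : E n) :
    0 ≤ quadSymbol a x ξ := le_trans (by positivity) (h.elliptic x ξ)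

end Bounds

/-! ### A globally Lipschitz field with the same trajectories at bounded energy -/

section Lipschitz

/-- A real function which is bounded and Lipschitz, both with constant `C`. -/
def BddLip {Y : Type*} [PseudoMetricSpace Y] (C : ℝ) (u : Y → ℝ) : Prop :=
  (∀ z, |u z| ≤ C) ∧ ∀ z w, |u z - u w| ≤ C * dist z w

variable {n : ℕ}

/-- A function of the coefficients and of the phase space variables which is bounded and Lipschitz
in the latter, uniformly over admissible coefficients. -/
def UniformBddLip (γ C₁ : ℝ) (u : (Fin n → Fin n → E n → ℝ) → E n × E n → ℝ) : Prop :=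
  ∃ C, ∀ a, Admissible γ C₁ a → BddLip C (u a)

variable {γ C₁ : ℝ} {u v : (Fin n → Fin n → E n → ℝ) → E n × E n → ℝ}

theorem UniformBddLip.const (c : ℝ) : UniformBddLip (n := n) γ C₁ fun _ _ => c :=
  ⟨|c|, fun _ _ => ⟨fun _ => le_rfl, fun z w => by simp; positivity⟩⟩

theorem UniformBddLip.add (hu : UniformBddLip γ C₁ u) (hv : UniformBddLip γ C₁ v) :
    UniformBddLip γ C₁ fun a z => u a z + v a z := by
  obtain ⟨C, hC⟩ := hu
  obtain ⟨D, hD⟩ := hv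
  refine ⟨C + D, fun a ha => ⟨fun z => ?_, fun z w => ?_⟩⟩
  · exact (abs_add_le _ _).trans (add_le_add ((hC a ha).1 z) ((hD a ha).1 z))
  · have e : u a z + v a z - (u a w + v a w) = (u a z - u a w) + (v a z - v a w) := by ring
    rw [e, add_mul]
    exact (abs_add_le _ _).trans (add_le_add ((hC a ha).2 z w) ((hD a ha).2 z w))

theorem UniformBddLip.mul (hu : UniformBddLip γ C₁ u) (hv : UniformBddLip γ C₁ v) :
    UniformBddLip γ C₁ fun a z => u a z * v a z := by
  obtain ⟨C, hC⟩ := hu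
  obtain ⟨D, hD⟩ := hv
  refine ⟨2 * C * D, fun a ha => ?_⟩
  have hC0 : 0 ≤ C := (abs_nonneg _).trans ((hC a ha).1 0)
  have hD0 : 0 ≤ D := (abs_nonneg _).trans ((hD a ha).1 0)
  refine ⟨fun z => ?_, fun z w => ?_⟩
  · rw [abs_mul]
    have := mul_le_mul ((hC a ha).1 z) ((hD a ha).1 z) (abs_nonneg _) hC0
    nlinarith [mul_nonneg hC0 hD0]
  · have e : u a z * v a z - u a w * v a w = (u a z - u a w) * v a z + u a w * (v a z - v a w) := by
      ring
    rw [e]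
    refine (abs_add_le _ _).trans ?_
    rw [abs_mul, abs_mul]
    have h1 := mul_le_mul ((hC a ha).2 z w) ((hD a ha).1 z) (abs_nonneg _)
      (mul_nonneg hC0 dist_nonneg)
    have h2 := mul_le_mul ((hC a ha).1 w) ((hD a ha).2 z w) (abs_nonneg _) hC0
    nlinarith

theorem UniformBddLip.sum {ι : Type*} (s : Finset ι)
    {u : ι → (Fin n → Fin n → E n → ℝ) → E n × E n → ℝ} (hu : ∀ i, UniformBddLip γ C₁ (u i)) :
    UniformBddLip γ C₁ fun a z => ∑ i ∈ s, u i a z := by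
  classical
  induction s using Finset.induction_on with
  | empty => simpa using UniformBddLip.const 0
  | insert i s hi ih =>
    simp only [Finset.sum_insert hi]
    exact (hu i).add ih

theorem abs_clamp_sub_le (b c s t : ℝ) :
    |max b (min c s) - max b (min c t)| ≤ |s - t| := by
  refine (abs_max_sub_max_le_max b (min c s) b (min c t)).trans ?_
  refine max_le (by simp) ((abs_min_sub_min_le_max c s c t).trans (max_le (by simp) le_rfl))

theorem abs_clamp_le {b c : ℝ} (s : ℝ) : |max b (min c s)| ≤ max |b| |c| := by
  rcases le_total b (min c s) with h | h
  · rw [max_eq_right h, abs_le']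
    exact ⟨(min_le_left _ _).trans ((le_abs_self c).trans (le_max_right _ _)),
      (neg_le_neg h).trans ((neg_le_abs b).trans (le_max_left _ _))⟩
  · rw [max_eq_left h]; exact le_max_left _ _

theorem UniformBddLip.clamp (b c : ℝ) (hu : UniformBddLip γ C₁ u) :
    UniformBddLip γ C₁ fun a z => max b (min c (u a z)) := by
  obtain ⟨C, hC⟩ := hu
  refine ⟨max C (max |b| |c|), fun a ha => ⟨fun z => ?_, fun z w => ?_⟩⟩
  · exact (abs_clamp_le _).trans (le_max_right _ _)
  · exact ((abs_clamp_sub_le b c _ _).trans ((hC a ha).2 z w)).trans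
      (mul_le_mul_of_nonneg_right (le_max_left _ _) dist_nonneg)

/-- The coordinatewise truncation of a vector to the cube `[-K, K]ⁿ`. -/
noncomputable def clampVec (K : ℝ) (ξ : E n) : E n :=
  WithLp.toLp 2 fun i => max (-K) (min K (ξ i))

theorem clampVec_eq_self {K : ℝ} {ξ : E n} (h : ∀ i, |ξ i| ≤ K) : clampVec K ξ = ξ := by
  ext i
  have := abs_le.1 (h i)
  simp [clampVec, this.1, this.2]

/-- A truncated vector which differs from the original one is long, so has large energy. -/
theorem le_norm_clampVec {K : ℝ} (hK : 0 ≤ K) {ξ : E n} {i : Fin n} (h : K < |ξ i|) :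
    K ≤ ‖clampVec K ξ‖ := by
  refine le_trans ?_ (abs_coord_le (clampVec K ξ) i)
  simp only [clampVec]
  rcases lt_abs.1 h with h | h
  · rw [min_eq_left h.le, max_eq_right (by linarith)]
    exact le_abs_self K
  · rw [min_eq_right (by linarith), max_eq_left (by linarith), abs_neg]
    exact le_abs_self K

theorem UniformBddLip.clampVec_coord (K : ℝ) (i : Fin n) :
    UniformBddLip γ C₁ fun _ z => clampVec K z.2 i := by
  refine ⟨max 1 |K|, fun a _ => ⟨fun z => ?_, fun z w => ?_⟩⟩
  · refine (abs_clamp_le _).trans ?_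
    rw [abs_neg, max_self]; exact le_max_right _ _
  · refine (abs_clamp_sub_le _ _ _ _).trans ?_
    have h1 : |z.2 i - w.2 i| ≤ ‖z.2 - w.2‖ := by simpa using abs_coord_le (z.2 - w.2) i
    have h2 : ‖z.2 - w.2‖ ≤ dist z w := by
      rw [← dist_eq_norm, Prod.dist_eq]; exact le_max_right _ _
    exact (h1.trans h2).trans (le_mul_of_one_le_left dist_nonneg (le_max_left _ _))

theorem abs_sub_le_of_norm_fderiv_le {f : E n → ℝ} (hf : Differentiable ℝ f) {C : ℝ}
    (h : ∀ x, ‖fderiv ℝ f x‖ ≤ C) (x y : E n) : |f x - f y| ≤ C * ‖x - y‖ := by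
  simpa using convex_univ.norm_image_sub_le_of_norm_fderiv_le (𝕜 := ℝ)
    (fun x _ => hf x) (fun x _ => h x) (mem_univ y) (mem_univ x)

theorem dist_fst_le (z w : E n × E n) : ‖z.1 - w.1‖ ≤ dist z w := by
  rw [← dist_eq_norm, Prod.dist_eq]; exact le_max_left _ _

theorem UniformBddLip.coeff (hC : 0 ≤ C₁) (l k : Fin n) :
    UniformBddLip γ C₁ fun a z => a l k z.1 := by
  refine ⟨C₁, fun a ha => ⟨fun z => ha.abs_le l k _, fun z w => ?_⟩⟩
  exact (abs_sub_le_of_norm_fderiv_le (ha.differentiable l k) (ha.norm_fderiv_le hC l k) _ _).trans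
    (mul_le_mul_of_nonneg_left (dist_fst_le z w) hC)

theorem UniformBddLip.partialDeriv_coeff (hC : 0 ≤ C₁) (j l k : Fin n) :
    UniformBddLip γ C₁ fun a z => partialDeriv j (a l k) z.1 := by
  refine ⟨max C₁ (n * C₁), fun a ha => ⟨fun z => ?_, fun z w => ?_⟩⟩
  · exact ((abs_partialDeriv_le j _ _).trans (ha.norm_fderiv_le hC l k _)).trans (le_max_left _ _)
  · have hd : Differentiable ℝ (partialDeriv j (a l k)) := by
      have h1 : ContDiff ℝ 1 (fderiv ℝ (a l k)) := (ha.contDiff l k).fderiv_right (by norm_num)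
      exact ((h1.clm_apply contDiff_const).differentiable (by simp))
    have hb : ∀ x, ‖fderiv ℝ (partialDeriv j (a l k)) x‖ ≤ n * C₁ := fun x =>
      norm_clm_le_of_single_le hC fun i => by
        simpa [iterPartial, partialDeriv] using (ha.regular l k).2 [i, j] (by simp) x
    refine (abs_sub_le_of_norm_fderiv_le hd hb _ _).trans ?_
    exact mul_le_mul (le_max_right _ _) (dist_fst_le z w) (norm_nonneg _)
      (le_trans hC (le_max_left _ _))

/-- Below a given energy the Hamiltonian field agrees with a bounded and globally Lipschitz field
which is everywhere a multiple of it, and hence conserves the energy as well. -/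
theorem exists_lipschitz_field (hγ : 0 < γ) (hC : 0 ≤ C₁) {E₀ : ℝ} (hE : 0 < E₀) :
    ∃ L : ℝ≥0, ∀ a : Fin n → Fin n → E n → ℝ, Admissible γ C₁ a →
      ∃ V : E n × E n → E n × E n, (∀ z, ‖V z‖ ≤ L) ∧ LipschitzWith L V ∧
        (∀ z, ∃ b : ℝ, V z = b • hamField a z) ∧
        ∀ z, quadSymbol a z.1 z.2 ≤ E₀ → V z = hamField a z := by
  set K : ℝ := 2 * E₀ / γ + 1 with hK
  have hK1 : 1 ≤ K := by
    have : 0 < 2 * E₀ / γ := by positivity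
    linarith
  have hK2 : 2 * E₀ ≤ γ * K ^ 2 := by
    have h1 : 2 * E₀ = γ * (2 * E₀ / γ) := by field_simp
    have h2 : 2 * E₀ / γ ≤ K ^ 2 := by nlinarith
    rw [h1]; exact mul_le_mul_of_nonneg_left h2 hγ.le
  -- the cut-off factor in the energy of the truncated point
  let b : (Fin n → Fin n → E n → ℝ) → E n × E n → ℝ := fun a z =>
    max 0 (min 1 (2 + (-1 / E₀) * quadSymbol a z.1 (clampVec K z.2)))
  have hb : UniformBddLip γ C₁ b := by
    refine UniformBddLip.clamp 0 1 ((UniformBddLip.const 2).add ((UniformBddLip.const _).mul ?_))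
    exact UniformBddLip.sum _ fun l => UniformBddLip.sum _ fun k =>
      ((UniformBddLip.coeff hC l k).mul (UniformBddLip.clampVec_coord K l)).mul
        (UniformBddLip.clampVec_coord K k)
  have hX : ∀ j, UniformBddLip γ C₁ fun a z => b a z * velX a z.1 (clampVec K z.2) j := by
    intro j
    refine hb.mul ?_
    exact UniformBddLip.sum Finset.univ fun k => ((UniformBddLip.coeff hC j k).add
      (UniformBddLip.coeff hC k j)).mul (UniformBddLip.clampVec_coord K k)
  have hΞ : ∀ j, UniformBddLip γ C₁ fun a z => b a z * velΞ a z.1 (clampVec K z.2) j := by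
    intro j
    refine hb.mul ?_
    have h := (UniformBddLip.const (n := n) (γ := γ) (C₁ := C₁) (-1)).mul
      (UniformBddLip.sum Finset.univ fun l => UniformBddLip.sum Finset.univ fun k =>
      ((UniformBddLip.partialDeriv_coeff (γ := γ) hC j l k).mul
        (UniformBddLip.clampVec_coord K l)).mul (UniformBddLip.clampVec_coord K k))
    simpa [velΞ_apply] using h
  choose cX hcX using hX
  choose cΞ hcΞ using hΞ
  set M : ℝ := ∑ j, |cX j| + ∑ j, |cΞ j| with hM
  have hsX : 0 ≤ ∑ j, |cX j| := Finset.sum_nonneg fun _ _ => abs_nonneg _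
  have hsΞ : 0 ≤ ∑ j, |cΞ j| := Finset.sum_nonneg fun _ _ => abs_nonneg _
  have hMX : ∀ j, cX j ≤ M := fun j => by
    have := Finset.single_le_sum (f := fun j => |cX j|) (fun i _ => abs_nonneg _)
      (Finset.mem_univ j)
    have h2 := le_abs_self (cX j)
    linarith
  have hMΞ : ∀ j, cΞ j ≤ M := fun j => by
    have := Finset.single_le_sum (f := fun j => |cΞ j|) (fun i _ => abs_nonneg _)
      (Finset.mem_univ j)
    have h2 := le_abs_self (cΞ j)
    linarith
  have hM0 : 0 ≤ n * M := by positivity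
  refine ⟨⟨n * M, hM0⟩, fun a ha => ?_⟩
  refine ⟨fun z => b a z • hamField a (z.1, clampVec K z.2), fun z => ?_, ?_, fun z => ?_,
    fun z hz => ?_⟩
  · refine norm_prod_le_iff.2 ⟨?_, ?_⟩
    · exact norm_le_of_coord_le fun j => ((hcX j a ha).1 z).trans (hMX j)
    · exact norm_le_of_coord_le fun j => ((hcΞ j a ha).1 z).trans (hMΞ j)
  · refine LipschitzWith.of_dist_le_mul fun z w => ?_
    rw [dist_eq_norm]
    change _ ≤ n * M * dist z w
    rw [mul_assoc]
    refine norm_prod_le_iff.2 ⟨?_, ?_⟩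
    · exact norm_le_of_coord_le fun j => ((hcX j a ha).2 z w).trans
        (mul_le_mul_of_nonneg_right (hMX j) dist_nonneg)
    · exact norm_le_of_coord_le fun j => ((hcΞ j a ha).2 z w).trans
        (mul_le_mul_of_nonneg_right (hMΞ j) dist_nonneg)
  · by_cases h : ∀ i, |z.2 i| ≤ K
    · exact ⟨b a z, by beta_reduce; rw [clampVec_eq_self h]⟩
    · push Not at h
      obtain ⟨i, hi⟩ := h
      refine ⟨0, ?_⟩
      have h1 := le_norm_clampVec (by linarith) hi
      have h2 := ha.elliptic z.1 (clampVec K z.2)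
      have h3 : γ * K ^ 2 ≤ γ * ‖clampVec K z.2‖ ^ 2 := by gcongr
      have h4 : b a z = 0 := by
        refine max_eq_left ((min_le_right _ _).trans ?_)
        have : 2 ≤ 1 / E₀ * quadSymbol a z.1 (clampVec K z.2) := by
          rw [one_div_mul_eq_div, le_div_iff₀ hE]; linarith
        have e : -1 / E₀ = -(1 / E₀) := by ring
        rw [e]; linarith
      beta_reduce
      rw [h4, zero_smul, zero_smul]
  · have h1 : ∀ i, |z.2 i| ≤ K := by
      intro i
      have h2 := ha.elliptic z.1 z.2
      have h3 := abs_coord_le z.2 i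
      by_contra hcon
      have h4 : K < ‖z.2‖ := lt_of_lt_of_le (not_le.1 hcon) h3
      have h5 : γ * K ^ 2 ≤ γ * ‖z.2‖ ^ 2 := by gcongr
      linarith
    have h4 : b a z = 1 := by
      have : 1 / E₀ * quadSymbol a z.1 z.2 ≤ 1 := by
        rw [one_div_mul_eq_div, div_le_one hE]; exact hz
      have e : -1 / E₀ = -(1 / E₀) := by ring
      simp only [b]
      rw [clampVec_eq_self h1, min_eq_left (by rw [e]; linarith), max_eq_right zero_le_one]
    beta_reduce
    rw [h4, one_smul, clampVec_eq_self h1]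

end Lipschitz

/-! ### Global flow -/

section Flow

theorem exists_global_solution {Y : Type*} [NormedAddCommGroup Y] [NormedSpace ℝ Y]
    [CompleteSpace Y] {V : Y → Y} {L K : ℝ≥0} (hb : ∀ y, ‖V y‖ ≤ L) (hV : LipschitzWith K V)
    (y₀ : Y) : ∃ Z : ℝ → Y, Z 0 = y₀ ∧ ∀ t, HasDerivAt Z (V (Z t)) t := by
  have hloc : ∀ m : ℕ, ∃ α : ℝ → Y, α 0 = y₀ ∧
      ∀ t ∈ Ioo (-((m : ℝ) + 1)) (m + 1), HasDerivAt α (V (α t)) t := by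
    intro m
    have hm : (0 : ℝ) ∈ Icc (-((m : ℝ) + 1)) (m + 1) := by
      constructor <;> linarith [m.cast_nonneg (α := ℝ)]
    have hP : IsPicardLindelof (fun _ => V) (⟨0, hm⟩ : Icc (-((m : ℝ) + 1)) (m + 1)) y₀
        (L * (m + 1)) 0 L K :=
      IsPicardLindelof.of_time_independent (fun y _ => hb y) hV.lipschitzOnWith (by simp)
    obtain ⟨α, h0, hα⟩ := hP.exists_eq_forall_mem_Icc_hasDerivWithinAt₀
    exact ⟨α, h0, fun t ht => (hα t (Ioo_subset_Icc_self ht)).hasDerivAt (Icc_mem_nhds ht.1 ht.2)⟩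
  choose α h0 hα using hloc
  have hle : ∀ m m' : ℕ, m ≤ m' → ∀ t : ℝ, |t| < m + 1 → α m t = α m' t := by
    intro m m' hmm t ht
    have hmm' : (m : ℝ) ≤ m' := by exact_mod_cast hmm
    refine ODE_solution_unique_of_mem_Ioo (v := fun _ => V) (s := fun _ => univ) (K := K)
      (t₀ := 0) (a := -((m : ℝ) + 1)) (b := m + 1) (fun _ _ => hV.lipschitzOnWith)
      (by constructor <;> linarith [m.cast_nonneg (α := ℝ)]) (fun s hs => ⟨hα m s hs, mem_univ _⟩)
      (fun s hs => ⟨hα m' s ⟨by linarith [hs.1], by linarith [hs.2]⟩, mem_univ _⟩)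
      (by rw [h0, h0]) (abs_lt.1 ht)
  have heq : ∀ m m' : ℕ, ∀ t : ℝ, |t| < m + 1 → |t| < m' + 1 → α m t = α m' t := by
    intro m m' t h1 h2
    rcases le_total m m' with h | h
    · exact hle m m' h t h1
    · exact (hle m' m h t h2).symm
  have hceil : ∀ t : ℝ, |t| < (⌈|t|⌉₊ : ℝ) + 1 := fun t => by linarith [Nat.le_ceil |t|]
  refine ⟨fun t => α ⌈|t|⌉₊ t, by simp [h0], fun t => ?_⟩
  have hd := hα ⌈|t|⌉₊ t (abs_lt.1 (hceil t))
  refine hd.congr_of_eventuallyEq ?_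
  have : ∀ᶠ s in 𝓝 t, |s| < (⌈|t|⌉₊ : ℝ) + 1 :=
    continuous_abs.continuousAt.eventually_lt continuousAt_const (hceil t)
  filter_upwards [this] with s hs
  exact heq _ _ s (hceil s) hs

theorem dist_le_of_forward_solutions {Y : Type*} [NormedAddCommGroup Y] [NormedSpace ℝ Y]
    {V : Y → Y} {K : ℝ≥0} (hV : LipschitzWith K V) {Z W : ℝ → Y}
    (hZ : ∀ t, HasDerivAt Z (V (Z t)) t) (hW : ∀ t, HasDerivAt W (V (W t)) t) {t : ℝ}
    (ht : 0 ≤ t) : dist (Z t) (W t) ≤ dist (Z 0) (W 0) * Real.exp (K * t) := by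
  have h := dist_le_of_trajectories_ODE (v := fun _ => V) (a := 0) (b := t) (fun _ => hV)
    (fun s _ => (hZ s).continuousAt.continuousWithinAt) (fun s _ => (hZ s).hasDerivWithinAt)
    (fun s _ => (hW s).continuousAt.continuousWithinAt) (fun s _ => (hW s).hasDerivWithinAt)
    le_rfl t ⟨ht, le_rfl⟩
  simpa using h

theorem dist_le_of_solutions {Y : Type*} [NormedAddCommGroup Y] [NormedSpace ℝ Y]
    {V : Y → Y} {K : ℝ≥0} (hV : LipschitzWith K V) {Z W : ℝ → Y}
    (hZ : ∀ t, HasDerivAt Z (V (Z t)) t) (hW : ∀ t, HasDerivAt W (V (W t)) t) (t : ℝ) :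
    dist (Z t) (W t) ≤ dist (Z 0) (W 0) * Real.exp (K * |t|) := by
  rcases le_total 0 t with ht | ht
  · rw [abs_of_nonneg ht]; exact dist_le_of_forward_solutions hV hZ hW ht
  · have hrev : ∀ {Z : ℝ → Y}, (∀ t, HasDerivAt Z (V (Z t)) t) →
        ∀ t, HasDerivAt (fun s => Z (-s)) ((fun y => -V y) (Z (-t))) t := by
      intro Z hZ t
      have h := (hZ (-t)).scomp t (hasDerivAt_neg t)
      rw [neg_one_smul] at h
      exact h
    have hV' : LipschitzWith K fun y => -V y := hV.neg
    have h := dist_le_of_forward_solutions hV' (hrev hZ) (hrev hW) (neg_nonneg.2 ht)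
    simpa [abs_of_nonpos ht] using h

variable {n : ℕ} {γ C₁ : ℝ} {a : Fin n → Fin n → E n → ℝ}

/-- A bicharacteristic of `quadSymbol a`, as a curve in phase space. -/
def IsOrbit (a : Fin n → Fin n → E n → ℝ) (Z : ℝ → E n × E n) : Prop :=
  ∀ t, HasDerivAt Z (hamField a (Z t)) t

theorem energy_const (ha : ∀ l k, Differentiable ℝ (a l k)) {Z : ℝ → E n × E n}
    (hZ : ∀ t, ∃ b : ℝ, HasDerivAt Z (b • hamField a (Z t)) t) (t : ℝ) :
    quadSymbol a (Z t).1 (Z t).2 = quadSymbol a (Z 0).1 (Z 0).2 := by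
  have h : ∀ t, HasDerivAt (fun s => quadSymbol a (Z s).1 (Z s).2) 0 t := by
    intro t
    obtain ⟨b, hb⟩ := hZ t
    have h1 := ((differentiable_quadSymbol ha) (Z t)).hasFDerivAt.comp_hasDerivAt t hb
    rw [map_smul, fderiv_quadSymbol_hamField ha, smul_zero] at h1
    exact h1
  exact is_const_of_deriv_eq_zero (fun t => (h t).differentiableAt) (fun t => (h t).deriv) t 0

theorem IsOrbit.energy (ha : ∀ l k, Differentiable ℝ (a l k)) {Z : ℝ → E n × E n}
    (hZ : IsOrbit a Z) (t : ℝ) :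
    quadSymbol a (Z t).1 (Z t).2 = quadSymbol a (Z 0).1 (Z 0).2 :=
  energy_const ha (fun t => ⟨1, by simpa using hZ t⟩) t

theorem IsOrbit.shift {Z : ℝ → E n × E n} (hZ : IsOrbit a Z) (t₀ : ℝ) :
    IsOrbit a fun t => Z (t₀ + t) := fun t => by
  have h := (hZ (t₀ + t)).scomp t ((hasDerivAt_id t).const_add t₀)
  rw [one_smul] at h
  exact h

/-- Orbits are invariant under `(x, ξ, t) ↦ (x, c ξ, t / c)`; the case `c = -1` is time reversal. -/
theorem IsOrbit.scale {Z : ℝ → E n × E n} (hZ : IsOrbit a Z) (c : ℝ) :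
    IsOrbit a fun t => ((Z (c * t)).1, c • (Z (c * t)).2) := fun t => by
  have h1 : HasDerivAt (fun s : ℝ => c * s) c t := by simpa using (hasDerivAt_id t).const_mul c
  have h := (hZ (c * t)).scomp t h1
  have hX : HasDerivAt (fun s => (Z (c * s)).1) (c • velX a (Z (c * t)).1 (Z (c * t)).2) t :=
    (ContinuousLinearMap.fst ℝ (E n) (E n)).hasFDerivAt.comp_hasDerivAt t h
  have hΞ : HasDerivAt (fun s => (Z (c * s)).2) (c • velΞ a (Z (c * t)).1 (Z (c * t)).2) t :=
    (ContinuousLinearMap.snd ℝ (E n) (E n)).hasFDerivAt.comp_hasDerivAt t h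
  have h2 := hX.prodMk (hΞ.const_smul c)
  have e : hamField a ((Z (c * t)).1, c • (Z (c * t)).2) =
      (c • velX a (Z (c * t)).1 (Z (c * t)).2, c • c • velΞ a (Z (c * t)).1 (Z (c * t)).2) := by
    change (velX a (Z (c * t)).1 (c • (Z (c * t)).2), velΞ a (Z (c * t)).1 (c • (Z (c * t)).2)) = _
    rw [velX_smul, velΞ_smul, smul_smul c c, ← pow_two]
  change HasDerivAt _ (hamField a ((Z (c * t)).1, c • (Z (c * t)).2)) t
  rw [e]
  exact h2

/-- Uniform estimates for orbits below a given energy: speed, Lipschitz dependence of the field,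
exponential bound for the divergence of orbits, and the error of the tangent line. -/
theorem exists_flow_bound (hγ : 0 < γ) (hC : 0 ≤ C₁) {E₀ : ℝ} (hE : 0 < E₀) :
    ∃ L : ℝ, 0 ≤ L ∧ ∀ a : Fin n → Fin n → E n → ℝ, Admissible γ C₁ a →
      (∀ z w, quadSymbol a z.1 z.2 ≤ E₀ → quadSymbol a w.1 w.2 ≤ E₀ →
        ‖hamField a z - hamField a w‖ ≤ L * ‖z - w‖) ∧
      (∀ Z W, IsOrbit a Z → IsOrbit a W → quadSymbol a (Z 0).1 (Z 0).2 ≤ E₀ →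
        quadSymbol a (W 0).1 (W 0).2 ≤ E₀ → ∀ t,
          ‖Z t - W t‖ ≤ ‖Z 0 - W 0‖ * Real.exp (L * |t|)) ∧
      (∀ Z, IsOrbit a Z → quadSymbol a (Z 0).1 (Z 0).2 ≤ E₀ → ∀ t, 0 ≤ t →
        ‖Z t - Z 0‖ ≤ L * t ∧ ‖Z t - Z 0 - t • hamField a (Z 0)‖ ≤ L * L * t ^ 2) := by
  obtain ⟨L, hL⟩ := exists_lipschitz_field (n := n) hγ hC hE
  refine ⟨L, L.2, fun a ha => ?_⟩
  obtain ⟨V, hb, hlip, -, hV⟩ := hL a ha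
  have horb : ∀ Z, IsOrbit a Z → quadSymbol a (Z 0).1 (Z 0).2 ≤ E₀ →
      ∀ t, HasDerivAt Z (V (Z t)) t := by
    intro Z hZ h0 t
    rw [hV _ (by rw [hZ.energy ha.differentiable]; exact h0)]
    exact hZ t
  refine ⟨fun z w hz hw => ?_, fun Z W hZ hW h1 h2 t => ?_, fun Z hZ h0 t ht => ?_⟩
  · rw [← hV z hz, ← hV w hw]; exact hlip.norm_sub_le z w
  · rw [← dist_eq_norm, ← dist_eq_norm]
    exact dist_le_of_solutions hlip (horb Z hZ h1) (horb W hW h2) t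
  · have hd := horb Z hZ h0
    have hspeed : ∀ s, 0 ≤ s → ‖Z s - Z 0‖ ≤ L * s := by
      intro s hs
      have := convex_univ.norm_image_sub_le_of_norm_hasDerivWithin_le
        (fun r _ => (hd r).hasDerivWithinAt) (fun r _ => hb (Z r)) (mem_univ 0) (mem_univ s)
      simpa [abs_of_nonneg hs] using this
    refine ⟨hspeed t ht, ?_⟩
    have hd2 : ∀ r, HasDerivAt (fun s => Z s - s • V (Z 0)) (V (Z r) - V (Z 0)) r := by
      intro r
      have h := (hd r).sub ((hasDerivAt_id r).smul_const (V (Z 0)))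
      rw [one_smul] at h
      exact h
    have h := (convex_Icc 0 t).norm_image_sub_le_of_norm_hasDerivWithin_le (C := L * (L * t))
      (fun r _ => (hd2 r).hasDerivWithinAt) (fun r hr => ?_) (left_mem_Icc.2 ht)
      (right_mem_Icc.2 ht)
    · rw [← hV _ h0]
      have e : Z t - Z 0 - t • V (Z 0) = Z t - t • V (Z 0) - (Z 0 - (0 : ℝ) • V (Z 0)) := by
        rw [zero_smul, sub_zero]; abel
      rw [e]
      refine h.trans_eq ?_
      rw [sub_zero, Real.norm_of_nonneg ht]; ring
    · refine (hlip.norm_sub_le _ _).trans ?_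
      refine mul_le_mul_of_nonneg_left ((hspeed r hr.1).trans ?_) L.2
      exact mul_le_mul_of_nonneg_left hr.2 L.2

theorem exists_orbit (hγ : 0 < γ) (hC : 0 ≤ C₁) (ha : Admissible γ C₁ a) (z : E n × E n) :
    ∃ Z, IsOrbit a Z ∧ Z 0 = z := by
  have hE : 0 < quadSymbol a z.1 z.2 + 1 := by linarith [ha.quadSymbol_nonneg hγ z.1 z.2]
  obtain ⟨L, hL⟩ := exists_lipschitz_field (n := n) hγ hC hE
  obtain ⟨V, hb, hlip, hmul, hV⟩ := hL a ha
  obtain ⟨Z, hZ0, hZ⟩ := exists_global_solution hb hlip z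
  refine ⟨Z, fun t => ?_, hZ0⟩
  have hen := energy_const ha.differentiable (Z := Z) (fun t => by
    obtain ⟨b, hb⟩ := hmul (Z t)
    exact ⟨b, hb ▸ hZ t⟩) t
  rw [← hV (Z t) (by rw [hen, hZ0]; linarith)]
  exact hZ t

theorem IsOrbit.eq_of_zero (hγ : 0 < γ) (hC : 0 ≤ C₁) (ha : Admissible γ C₁ a)
    {Z W : ℝ → E n × E n} (hZ : IsOrbit a Z) (hW : IsOrbit a W) (h : Z 0 = W 0) : Z = W := by
  have hE : 0 < quadSymbol a (Z 0).1 (Z 0).2 + 1 := by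
    linarith [ha.quadSymbol_nonneg hγ (Z 0).1 (Z 0).2]
  obtain ⟨L, -, hL⟩ := exists_flow_bound (n := n) hγ hC hE
  funext t
  have := (hL a ha).2.1 Z W hZ hW (by linarith) (by rw [← h]; linarith) t
  rw [h, sub_self, norm_zero, zero_mul] at this
  exact sub_eq_zero.1 (norm_le_zero_iff.1 this)

end Flow

/-! ### Monotone quantities near infinity: the one-dimensional calculus -/

section OuterProfile

/-- A smooth step, increasing from `0` on `(-∞, -c/2]` to `1` on `[-c/4, ∞)`. -/
noncomputable def outerStep (c u : ℝ) : ℝ := Real.smoothTransition ((u + c / 2) / (c / 4))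

variable {c : ℝ}

theorem contDiff_outerStep (c : ℝ) : ContDiff ℝ ∞ (outerStep c) :=
  Real.smoothTransition.contDiff.comp (by fun_prop)

theorem hasDerivAt_outerStep (c u : ℝ) : HasDerivAt (outerStep c) (deriv (outerStep c) u) u :=
  ((contDiff_outerStep c).differentiable (by simp) u).hasDerivAt

theorem monotone_outerStep (hc : 0 < c) : Monotone (outerStep c) := fun u v h =>
  Real.smoothTransition.monotone (by gcongr)

theorem deriv_outerStep_nonneg (hc : 0 < c) (u : ℝ) : 0 ≤ deriv (outerStep c) u :=
  (monotone_outerStep hc).deriv_nonneg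

theorem outerStep_eq_zero (hc : 0 < c) {u : ℝ} (h : u ≤ -(c / 2)) : outerStep c u = 0 :=
  Real.smoothTransition.zero_of_nonpos (div_nonpos_of_nonpos_of_nonneg (by linarith) (by linarith))

theorem outerStep_eq_one (hc : 0 < c) {u : ℝ} (h : -(c / 4) ≤ u) : outerStep c u = 1 :=
  Real.smoothTransition.one_of_one_le ((one_le_div (by linarith)).2 (by linarith))

theorem outerStep_nonneg (c u : ℝ) : 0 ≤ outerStep c u := Real.smoothTransition.nonneg _

theorem deriv_outerStep_of_le (hc : 0 < c) {u : ℝ} (h : u ≤ -(c / 2)) :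
    deriv (outerStep c) u = 0 := by
  have : IsLocalMin (outerStep c) u := by
    refine Eventually.of_forall fun v => ?_
    rw [outerStep_eq_zero hc h]; exact outerStep_nonneg c v
  exact this.deriv_eq_zero

theorem deriv_outerStep_of_ge (hc : 0 < c) {u : ℝ} (h : -(c / 4) ≤ u) :
    deriv (outerStep c) u = 0 := by
  have : IsLocalMax (outerStep c) u := by
    refine Eventually.of_forall fun v => ?_
    rw [outerStep_eq_one hc h]; exact Real.smoothTransition.le_one _
  exact this.deriv_eq_zero

/-- A bounded function of `q` and `r`, which vanishes for `r ≤ 1 / (2c)` and `|q| ≤ r`. It increases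
along curves on which `q` grows fast compared to the speed of `r`: in the step the variable is
`(q - 1/c) / r`, and where the step is complete the last factor supplies growth of
order `r⁻²`. -/
noncomputable def outerProfile (c q r : ℝ) : ℝ :=
  outerStep c ((q - 1 / c) / r) * (2 / c - (√((q + c * r) ^ 2 + (c * r / 2) ^ 2))⁻¹)

/-- The step cannot be positive near the origin. -/
theorem le_of_lt_outer_arg (hc : 0 < c) (hc2 : c ≤ 1 / 2) {q r : ℝ} (hr : 1 ≤ r) (hq : q ≤ r)
    (hu : -(c / 2) < (q - 1 / c) / r) : 1 / (2 * c) ≤ r := by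
  have hr0 : 0 < r := by linarith
  rw [lt_div_iff₀ hr0] at hu
  rw [div_le_iff₀ (by linarith)]
  have h1 : 1 / c * c = 1 := by field_simp
  nlinarith

/-- Where the step varies, its argument `(q - 1/c) / r` is nondecreasing. -/
theorem outer_arg_mono (hc : 0 < c) {q r q' r' σ : ℝ} (hσ : 0 ≤ σ) (hr' : |r'| ≤ σ)
    (hq' : 2 * c * σ ≤ q') (hr : 0 < r) (h1 : -(c / 2) ≤ (q - 1 / c) / r)
    (h2 : (q - 1 / c) / r ≤ c / 2) : 0 ≤ (q' * r - (q - 1 / c) * r') / r ^ 2 := by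
  refine div_nonneg ?_ (by positivity)
  rw [le_div_iff₀ hr] at h1
  rw [div_le_iff₀ hr] at h2
  obtain ⟨h3, h4⟩ := abs_le.1 hr'
  have h5 : |(q - 1 / c) * r'| ≤ (c / 2 * r) * σ := by
    rw [abs_mul]
    exact mul_le_mul (abs_le.2 ⟨by linarith, h2⟩) hr' (abs_nonneg _) (by positivity)
  have h6 := le_abs_self ((q - 1 / c) * r')
  have h7 : 2 * c * σ * r ≤ q' * r := mul_le_mul_of_nonneg_right hq' hr.le
  have h8 : 0 ≤ c * r * σ := by positivity
  nlinarith

/-- The derivative of `(q + c r)² + (c r / 2)²` is bounded below where `q + c r ≥ c r / 2`. -/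
theorem outerProfile_radicand_growth {q r q' r' σ : ℝ} (hc : 0 < c) (hσ : 0 ≤ σ) (hr : 0 < r)
    (hr' : |r'| ≤ σ) (hq' : 2 * c * σ ≤ q') (hq : c * r / 2 ≤ q + c * r) :
    c ^ 2 * r * σ / 2 ≤ 2 * (q + c * r) * (q' + c * r') + c ^ 2 / 2 * r * r' := by
  obtain ⟨h3, h4⟩ := abs_le.1 hr'
  have h5 : c * σ ≤ q' + c * r' := by nlinarith
  have h6 : c * r / 2 * (c * σ) ≤ (q + c * r) * (q' + c * r') :=
    mul_le_mul hq h5 (by positivity) (le_trans (by positivity) hq)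
  have h7 : c ^ 2 / 2 * r * (-σ) ≤ c ^ 2 / 2 * r * r' :=
    mul_le_mul_of_nonneg_left h3 (by positivity)
  nlinarith

theorem outerProfile_radicand_le {q r : ℝ} (hc : 0 < c) (hc2 : c ≤ 1 / 2) (hr : 0 < r)
    (hqr : q ≤ r) (hq : 0 ≤ q + c * r) :
    √((q + c * r) ^ 2 + (c * r / 2) ^ 2) ≤ 2 * r := by
  rw [Real.sqrt_le_left (by linarith)]
  have h8 : (q + c * r) ^ 2 ≤ (3 / 2 * r) ^ 2 :=
    pow_le_pow_left₀ hq (by nlinarith) 2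
  have h9 : (c * r / 2) ^ 2 ≤ (r / 4) ^ 2 :=
    pow_le_pow_left₀ (by positivity) (by nlinarith) 2
  nlinarith

theorem outerProfile_factor_nonneg {q r : ℝ} (hc : 0 < c) (hr : 1 ≤ r) :
    0 ≤ 2 / c - (√((q + c * r) ^ 2 + (c * r / 2) ^ 2))⁻¹ := by
  have h1 : c / 2 ≤ √((q + c * r) ^ 2 + (c * r / 2) ^ 2) := by
    refine Real.le_sqrt_of_sq_le ?_
    have : (c / 2) ^ 2 ≤ (c * r / 2) ^ 2 := pow_le_pow_left₀ (by positivity) (by nlinarith) 2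
    nlinarith [sq_nonneg (q + c * r)]
  have h2 := inv_anti₀ (by positivity) h1
  rw [inv_div] at h2
  linarith

theorem hasDerivAt_outerProfile (hc : 0 < c) {q r : ℝ → ℝ} {q' r' t : ℝ}
    (hq : HasDerivAt q q' t) (hr : HasDerivAt r r' t) (hr0 : 0 < r t) :
    HasDerivAt (fun s => outerProfile c (q s) (r s))
      (deriv (outerStep c) ((q t - 1 / c) / r t) * ((q' * r t - (q t - 1 / c) * r') / r t ^ 2) *
          (2 / c - (√((q t + c * r t) ^ 2 + (c * r t / 2) ^ 2))⁻¹) +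
        outerStep c ((q t - 1 / c) / r t) *
          ((2 * (q t + c * r t) * (q' + c * r') + c ^ 2 / 2 * r t * r') /
            (2 * √((q t + c * r t) ^ 2 + (c * r t / 2) ^ 2) ^ 3))) t := by
  have hQ0 : 0 < (q t + c * r t) ^ 2 + (c * r t / 2) ^ 2 := by positivity
  have hsQ := Real.sqrt_pos.2 hQ0
  have hdu : HasDerivAt (fun s => (q s - 1 / c) / r s)
      ((q' * r t - (q t - 1 / c) * r') / r t ^ 2) t := (hq.sub_const (1 / c)).div hr hr0.ne'
  have hdQ : HasDerivAt (fun s => (q s + c * r s) ^ 2 + (c * r s / 2) ^ 2)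
      (2 * (q t + c * r t) * (q' + c * r') + c ^ 2 / 2 * r t * r') t := by
    refine (((hq.fun_add (hr.const_mul c)).fun_pow 2).fun_add
      (((hr.const_mul c).div_const 2).fun_pow 2)).congr_deriv ?_
    push_cast
    ring
  have hdS : HasDerivAt (fun s => 2 / c - (√((q s + c * r s) ^ 2 + (c * r s / 2) ^ 2))⁻¹)
      ((2 * (q t + c * r t) * (q' + c * r') + c ^ 2 / 2 * r t * r') /
        (2 * √((q t + c * r t) ^ 2 + (c * r t / 2) ^ 2) ^ 3)) t := by
    refine (((hdQ.sqrt hQ0.ne').fun_inv hsQ.ne').const_sub (2 / c)).congr_deriv ?_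
    generalize √((q t + c * r t) ^ 2 + (c * r t / 2) ^ 2) = S at hsQ
    field_simp
  exact ((hasDerivAt_outerStep c _).comp t hdu).mul hdS

/-- The monotonicity of `outerProfile`, in terms of the derivatives `q'`, `r'` along a curve. -/
theorem exists_hasDerivAt_outerProfile (hc : 0 < c) (hc2 : c ≤ 1 / 2) {q r : ℝ → ℝ}
    {q' r' σ t : ℝ} (hσ : 0 ≤ σ) (hq : HasDerivAt q q' t) (hr : HasDerivAt r r' t)
    (hr1 : 1 ≤ r t) (hqr : |q t| ≤ r t) (hr' : |r'| ≤ σ)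
    (hq' : 1 / (2 * c) ≤ r t → 2 * c * σ ≤ q') :
    ∃ D, HasDerivAt (fun s => outerProfile c (q s) (r s)) D t ∧ 0 ≤ D ∧
      (-(c / 4) ≤ (q t - 1 / c) / r t → c ^ 2 * σ / (32 * r t ^ 2) ≤ D) := by
  have hr0 : 0 < r t := by linarith
  refine ⟨_, hasDerivAt_outerProfile hc hq hr hr0, ?_⟩
  have hA := outerProfile_factor_nonneg (q := q t) hc hr1
  have hsQ : 0 < √((q t + c * r t) ^ 2 + (c * r t / 2) ^ 2) := Real.sqrt_pos.2 (by positivity)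
  generalize q t = y at *
  generalize r t = x at *
  clear hq hr q r
  rcases le_or_gt ((y - 1 / c) / x) (-(c / 2)) with h | h
  · rw [deriv_outerStep_of_le hc h, outerStep_eq_zero hc h]
    exact ⟨by simp, fun h2 => by linarith⟩
  · have hq'' := hq' (le_of_lt_outer_arg hc hc2 hr1 (le_of_abs_le hqr) h)
    have hq1 : c * x / 2 ≤ y + c * x := by
      have h' := h
      rw [lt_div_iff₀ hr0] at h'
      have : 0 < 1 / c := by positivity
      linarith
    have hQ' := outerProfile_radicand_growth hc hσ hr0 hr' hq'' hq1
    have hS := outerProfile_radicand_le hc hc2 hr0 (le_of_abs_le hqr) (le_trans (by positivity) hq1)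
    generalize √((y + c * x) ^ 2 + (c * x / 2) ^ 2) = S at *
    generalize 2 * (y + c * x) * (q' + c * r') + c ^ 2 / 2 * x * r' = Q' at *
    have hQ0 : 0 ≤ c ^ 2 * x * σ / 2 := by positivity
    have hB : 0 ≤ Q' / (2 * S ^ 3) := div_nonneg (hQ0.trans hQ') (by positivity)
    rcases le_or_gt (-(c / 4)) ((y - 1 / c) / x) with h2 | h2
    · rw [deriv_outerStep_of_ge hc h2, outerStep_eq_one hc h2, zero_mul, zero_mul, zero_add,
        one_mul]
      refine ⟨hB, fun _ => ?_⟩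
      have hS3 : S ^ 3 ≤ (2 * x) ^ 3 := pow_le_pow_left₀ hsQ.le hS 3
      calc c ^ 2 * σ / (32 * x ^ 2) = (c ^ 2 * x * σ / 2) / (2 * (2 * x) ^ 3) := by
            field_simp; norm_num
        _ ≤ Q' / (2 * S ^ 3) := by gcongr; exact hQ0.trans hQ'
    · refine ⟨?_, fun h5 => absurd h5 (not_le.2 h2)⟩
      have h9 := outer_arg_mono hc hσ hr' hq'' hr0 h.le (by linarith)
      exact add_nonneg (mul_nonneg (mul_nonneg (deriv_outerStep_nonneg hc _) h9) hA)
        (mul_nonneg (outerStep_nonneg c _) hB)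

end OuterProfile

/-! ### Growth of the radial momentum along bicharacteristics -/

section Radial

variable {n : ℕ} {γ C₁ : ℝ} {a : Fin n → Fin n → E n → ℝ}

/-- The Japanese bracket `⟨x⟩ = (1 + |x|²)^(1/2)`. -/
noncomputable def bracket (x : E n) : ℝ := √(1 + ‖x‖ ^ 2)

theorem bracket_sq (x : E n) : bracket x ^ 2 = 1 + ‖x‖ ^ 2 := Real.sq_sqrt (by positivity)

theorem one_le_bracket (x : E n) : 1 ≤ bracket x :=
  Real.one_le_sqrt.2 (by nlinarith [sq_nonneg ‖x‖])

theorem bracket_pos (x : E n) : 0 < bracket x := one_pos.trans_le (one_le_bracket x)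

theorem norm_le_bracket (x : E n) : ‖x‖ ≤ bracket x :=
  Real.le_sqrt_of_sq_le (by linarith)

theorem bracket_le (x : E n) : bracket x ≤ 1 + ‖x‖ :=
  (Real.sqrt_le_left (by positivity)).2 (by nlinarith [norm_nonneg x])

/-- The component of the position in the direction of the momentum. -/
noncomputable def radial (x ξ : E n) : ℝ := inner ℝ x ξ / ‖ξ‖

theorem abs_radial_le (x ξ : E n) : |radial x ξ| ≤ bracket x := by
  rw [radial, abs_div, abs_norm]
  refine (div_le_of_le_mul₀ (norm_nonneg _) (norm_nonneg x) (abs_real_inner_le_norm x ξ)).trans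
    (norm_le_bracket x)

/-- The parameter of the monotone quantities near infinity: the ratio of the growth rate of the
radial momentum to the maximal speed, up to a factor. -/
noncomputable def escapeParam (n : ℕ) (γ C₁ : ℝ) : ℝ := γ / (4 * fieldBound n γ C₁)

theorem escapeParam_pos (hγ : 0 < γ) (hC : 0 ≤ C₁) : 0 < escapeParam n γ C₁ :=
  div_pos hγ (mul_pos (by norm_num) (fieldBound_pos hγ hC))

theorem escapeParam_le (hγ : 0 < γ) (hC : 0 ≤ C₁) : escapeParam n γ C₁ ≤ 1 / 2 := by
  have h := le_fieldBound (n := n) (γ := γ) hC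
  have h2 := fieldBound_pos (n := n) hγ hC
  rw [escapeParam, div_le_iff₀ (by positivity)]
  linarith

/-- Along bicharacteristics the radial momentum `q = x · ξ / |ξ|` grows, far away, faster than
`r = ⟨x⟩` moves: ellipticity gives `∂_ξ h · ξ = 2 h ≥ 2 γ |ξ|²`, while by asymptotic flatness the
contribution of `∂_x h` is `O(|ξ| / ⟨x⟩)`. -/
theorem exists_hasDerivAt_radial (hγ : 0 < γ) (hC : 0 ≤ C₁) (ha : Admissible γ C₁ a)
    {X Ξ : ℝ → E n} {t : ℝ} (hX : HasDerivAt X (velX a (X t) (Ξ t)) t)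
    (hΞ : HasDerivAt Ξ (velΞ a (X t) (Ξ t)) t) (h0 : Ξ t ≠ 0) :
    ∃ q' r', HasDerivAt (fun s => radial (X s) (Ξ s)) q' t ∧
      HasDerivAt (fun s => bracket (X s)) r' t ∧ |r'| ≤ fieldBound n γ C₁ * ‖Ξ t‖ ∧
      (1 / (2 * escapeParam n γ C₁) ≤ bracket (X t) →
        2 * escapeParam n γ C₁ * (fieldBound n γ C₁ * ‖Ξ t‖) ≤ q') := by
  set F := fieldBound n γ C₁ with hF
  have hF0 : 0 < F := fieldBound_pos hγ hC
  set x := X t with hx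
  set ξ := Ξ t with hξ
  set v := velX a x ξ with hv
  set w := velΞ a x ξ with hw
  have hξ0 : 0 < ‖ξ‖ := norm_pos_iff.2 h0
  have hb0 : 0 < bracket x := bracket_pos x
  have hnorm : HasDerivAt (fun s => ‖Ξ s‖) (inner ℝ ξ w / ‖ξ‖) t := by
    have h1 := hΞ.norm_sq.sqrt (pow_ne_zero 2 hξ0.ne')
    have h2 : (fun s => √(‖Ξ s‖ ^ 2)) = fun s => ‖Ξ s‖ :=
      funext fun s => Real.sqrt_sq (norm_nonneg _)
    rw [h2, ← hξ, Real.sqrt_sq hξ0.le] at h1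
    convert h1 using 1
    field_simp
  have hbr : HasDerivAt (fun s => bracket (X s)) (inner ℝ x v / bracket x) t := by
    have h1 := (hX.norm_sq.const_add 1).sqrt (by positivity)
    change HasDerivAt (fun s => bracket (X s)) (2 * inner ℝ x v / (2 * bracket x)) t at h1
    convert h1 using 1
    field_simp
  have hq := (hX.inner ℝ hΞ).div hnorm hξ0.ne'
  rw [← hx, ← hξ] at hq
  refine ⟨_, _, hq, hbr, ?_, fun hR => ?_⟩
  · rw [abs_div, abs_of_pos hb0, div_le_iff₀ hb0]
    refine (abs_real_inner_le_norm x v).trans ?_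
    rw [mul_comm]
    exact mul_le_mul (ha.norm_velX_le hγ hC x ξ) (norm_le_bracket x) (norm_nonneg _)
      (by positivity)
  · have e1 : 2 * escapeParam n γ C₁ * (F * ‖ξ‖) = γ * ‖ξ‖ / 2 := by
      rw [escapeParam, ← hF]; field_simp; ring
    have e2 : 1 / (2 * escapeParam n γ C₁) = 2 * F / γ := by
      rw [escapeParam, ← hF]; field_simp; ring
    rw [e1]
    rw [e2, div_le_iff₀ hγ] at hR
    have h1 : inner ℝ v ξ = 2 * quadSymbol a x ξ := inner_velX x ξ
    have h2 := ha.elliptic x ξ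
    have h3 := abs_le.1 (abs_real_inner_le_norm x w)
    have h4 : inner ℝ x ξ * (inner ℝ ξ w / ‖ξ‖) ≤ ‖x‖ * ‖w‖ * ‖ξ‖ := by
      rw [← mul_div_assoc, div_le_iff₀ hξ0]
      have := mul_le_mul (abs_real_inner_le_norm x ξ) (abs_real_inner_le_norm ξ w) (abs_nonneg _)
        (by positivity)
      rw [← abs_mul] at this
      linarith [le_abs_self (inner ℝ x ξ * inner ℝ ξ w)]
    have h5 : ‖x‖ * ‖w‖ * bracket x ≤ F * ‖ξ‖ ^ 2 := by
      have h6 := ha.norm_velΞ_le hγ hC x ξ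
      rw [← bracket_sq, le_div_iff₀ (by positivity)] at h6
      have h7 := norm_le_bracket x
      calc ‖x‖ * ‖w‖ * bracket x ≤ bracket x * ‖w‖ * bracket x := by gcongr
        _ = ‖w‖ * bracket x ^ 2 := by ring
        _ ≤ _ := h6
    have h8 : ‖x‖ * ‖w‖ ≤ γ / 2 * ‖ξ‖ ^ 2 := by
      have h9 : F * ‖ξ‖ ^ 2 ≤ γ / 2 * ‖ξ‖ ^ 2 * bracket x := by
        nlinarith [mul_le_mul_of_nonneg_right hR (sq_nonneg ‖ξ‖)]
      exact le_of_mul_le_mul_right (h5.trans h9) hb0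
    rw [le_div_iff₀ (by positivity)]
    nlinarith [mul_le_mul_of_nonneg_right h2 hξ0.le, mul_le_mul_of_nonneg_right h3.1 hξ0.le,
      mul_le_mul_of_nonneg_right h8 hξ0.le, pow_pos hξ0 3]

end Radial

/-! ### The symbol near infinity -/

section OuterSymbol

variable {n : ℕ}

/-- A smooth map `E n → E n` which equals `ξ / |ξ|` for `|ξ| ≥ 1/2`. -/
noncomputable def unitMap (ξ : E n) : E n :=
  (Real.smoothTransition (8 * ‖ξ‖ ^ 2 - 1) * ‖ξ‖⁻¹) • ξ

theorem unitMap_eq {ξ : E n} (h : 1 / 2 ≤ ‖ξ‖) : unitMap ξ = ‖ξ‖⁻¹ • ξ := by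
  rw [unitMap, Real.smoothTransition.one_of_one_le (by nlinarith), one_mul]

theorem norm_unitMap_le (ξ : E n) : ‖unitMap ξ‖ ≤ 1 := by
  rw [unitMap, norm_smul, norm_mul, norm_inv, norm_norm, mul_assoc,
    Real.norm_of_nonneg (Real.smoothTransition.nonneg _)]
  refine mul_le_one₀ (Real.smoothTransition.le_one _) (by positivity) ?_
  rcases eq_or_ne ‖ξ‖ 0 with h | h
  · simp [h]
  · rw [inv_mul_cancel₀ h]

theorem contDiff_unitMap : ContDiff ℝ ∞ (unitMap (n := n)) := by
  rw [contDiff_iff_contDiffAt]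
  intro ξ
  rcases eq_or_ne ξ 0 with h | h
  · have : unitMap (n := n) =ᶠ[𝓝 ξ] fun _ => 0 := by
      have h1 : ∀ᶠ η in 𝓝 ξ, 8 * ‖η‖ ^ 2 - 1 < 0 :=
        ContinuousAt.eventually_lt (by fun_prop) continuousAt_const (by simp [h])
      filter_upwards [h1] with η hη
      rw [unitMap, Real.smoothTransition.zero_of_nonpos hη.le, zero_mul, zero_smul]
    exact contDiffAt_const.congr_of_eventuallyEq this
  · have h1 : ContDiffAt ℝ ∞ (fun η : E n => 8 * ‖η‖ ^ 2 - 1) ξ :=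
      (contDiffAt_const.mul (contDiff_norm_sq ℝ).contDiffAt).sub contDiffAt_const
    have h2 : ContDiffAt ℝ ∞ (fun η : E n => ‖η‖⁻¹) ξ :=
      (contDiffAt_norm ℝ h).inv (norm_ne_zero_iff.2 h)
    exact ((Real.smoothTransition.contDiffAt.comp ξ h1).mul h2).smul contDiffAt_id

/-- The map `(x, ξ) ↦ (1 / ⟨x⟩, x / ⟨x⟩, ξ)`. -/
noncomputable def compactMap (z : E n × E n) : (ℝ × E n) × E n :=
  (((bracket z.1)⁻¹, (bracket z.1)⁻¹ • z.1), z.2)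

theorem contDiff_inv_bracket : ContDiff ℝ ∞ fun x : E n => (bracket x)⁻¹ := by
  refine ContDiff.inv ?_ fun x => (bracket_pos x).ne'
  exact (contDiff_const.add (contDiff_norm_sq ℝ)).sqrt fun x => by positivity

theorem contDiff_compactMap : ContDiff ℝ ∞ (compactMap (n := n)) := by
  have h := (contDiff_inv_bracket (n := n)).comp (contDiff_fst (𝕜 := ℝ) (E := E n) (F := E n))
  exact (h.prodMk (h.smul contDiff_fst)).prodMk contDiff_snd

/-- The right-hand side of the differential equation satisfied by `compactMap`. -/
noncomputable def compactRhs (w : (ℝ × E n) × E n) : E n × E n →L[ℝ] (ℝ × E n) × E n :=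
  ((((innerSL ℝ w.1.2).comp (ContinuousLinearMap.fst ℝ (E n) (E n))).smulRight (-w.1.1 ^ 2)).prod
    (w.1.1 • ContinuousLinearMap.fst ℝ (E n) (E n) -
      ((innerSL ℝ w.1.2).comp (ContinuousLinearMap.fst ℝ (E n) (E n))).smulRight
        (w.1.1 • w.1.2))).prod (ContinuousLinearMap.snd ℝ (E n) (E n))

theorem contDiff_compactRhs : ContDiff ℝ ∞ (compactRhs (n := n)) := by
  have hℓ : ContDiff ℝ ∞ fun w : (ℝ × E n) × E n =>
      (innerSL ℝ w.1.2).comp (ContinuousLinearMap.fst ℝ (E n) (E n)) :=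
    ((innerSL ℝ).contDiff.comp (contDiff_snd.comp contDiff_fst)).clm_comp contDiff_const
  have ht : ContDiff ℝ ∞ fun w : (ℝ × E n) × E n => w.1.1 := contDiff_fst.comp contDiff_fst
  have hy : ContDiff ℝ ∞ fun w : (ℝ × E n) × E n => w.1.2 := contDiff_snd.comp contDiff_fst
  have h1 := hℓ.smulRight (ht.pow 2).neg
  have h2 := (ht.smul (contDiff_const (c := ContinuousLinearMap.fst ℝ (E n) (E n)))).sub
    (hℓ.smulRight (ht.smul hy))
  have hprod : ∀ {Y₁ Y₂ : Type} [NormedAddCommGroup Y₁] [NormedSpace ℝ Y₁] [NormedAddCommGroup Y₂]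
      [NormedSpace ℝ Y₂] {f : (ℝ × E n) × E n → E n × E n →L[ℝ] Y₁}
      {g : (ℝ × E n) × E n → E n × E n →L[ℝ] Y₂}, ContDiff ℝ ∞ f → ContDiff ℝ ∞ g →
      ContDiff ℝ ∞ fun w => (f w).prod (g w) := by
    intro Y₁ Y₂ _ _ _ _ f g hf hg
    have h := ((contDiff_const (c := ContinuousLinearMap.inl ℝ Y₁ Y₂)).clm_comp hf).add
      ((contDiff_const (c := ContinuousLinearMap.inr ℝ Y₁ Y₂)).clm_comp hg)
    convert h using 2 with w
    ext v <;> simp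
  exact hprod (hprod h1 h2) contDiff_const

theorem hasFDerivAt_inv_bracket (x : E n) : HasFDerivAt (fun x : E n => (bracket x)⁻¹)
    ((-(bracket x)⁻¹ ^ 3) • innerSL ℝ x) x := by
  have h1 : HasFDerivAt (fun x : E n => 1 + ‖x‖ ^ 2) (2 • innerSL ℝ x) x :=
    (hasStrictFDerivAt_norm_sq x).hasFDerivAt.const_add 1
  have h2 := ((hasDerivAt_inv (bracket_pos x).ne').comp_hasFDerivAt x (h1.sqrt (by positivity)))
  refine h2.congr_fderiv ?_
  ext v
  have h3 := bracket_pos x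
  change -(bracket x ^ 2)⁻¹ * (1 / (2 * bracket x) * (2 • innerSL ℝ x v)) =
    -(bracket x)⁻¹ ^ 3 * innerSL ℝ x v
  simp only [nsmul_eq_mul, Nat.cast_ofNat]
  field_simp

theorem fderiv_compactMap : fderiv ℝ (compactMap (n := n)) = compactRhs ∘ compactMap := by
  funext z
  have h1 := (hasFDerivAt_inv_bracket z.1).comp z
    (hasFDerivAt_fst (𝕜 := ℝ) (E := E n) (F := E n) (p := z))
  have h2 := (h1.prodMk (h1.smul (hasFDerivAt_fst (𝕜 := ℝ) (E := E n) (F := E n) (p := z)))).prodMk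
    (hasFDerivAt_snd (𝕜 := ℝ) (E := E n) (F := E n) (p := z))
  refine h2.fderiv.trans ?_
  have h3 := bracket_pos z.1
  refine ContinuousLinearMap.ext fun v => ?_
  refine Prod.ext (Prod.ext ?_ ?_) rfl
  · simp [compactRhs, compactMap]
    ring
  · simp [compactRhs, compactMap, smul_smul, sub_eq_add_neg]
    ring_nf

/-- All derivatives of `compactMap` are bounded for bounded `ξ`, since it solves an autonomous
system in a compact set; hence so are those of smooth functions of it. -/
theorem exists_bound_iteratedFDeriv_comp_compactMap {M : (ℝ × E n) × E n → ℝ}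
    (hM : ContDiff ℝ ∞ M) (k : ℕ) :
    ∃ A, ∀ x ξ : E n, ‖ξ‖ ≤ 2 → ‖iteratedFDeriv ℝ k (M ∘ compactMap) (x, ξ)‖ ≤ A := by
  set K : Set ((ℝ × E n) × E n) :=
    (Icc 0 1 ×ˢ Metric.closedBall 0 1) ×ˢ Metric.closedBall 0 2 with hK
  have hKc : IsCompact K :=
    (isCompact_Icc.prod (isCompact_closedBall 0 1)).prod (isCompact_closedBall 0 2)
  set S : Set (E n × E n) := {z | ‖z.2‖ ≤ 2} with hS
  have hmaps : MapsTo compactMap S K := by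
    intro z hz
    have h1 := bracket_pos z.1
    refine ⟨⟨⟨(inv_pos.2 h1).le, inv_le_one_of_one_le₀ (one_le_bracket _)⟩, ?_⟩, ?_⟩
    · rw [mem_closedBall_zero_iff]
      change ‖(bracket z.1)⁻¹ • z.1‖ ≤ 1
      rw [norm_smul, Real.norm_of_nonneg (inv_pos.2 h1).le, inv_mul_le_one₀ h1]
      exact norm_le_bracket _
    · rw [mem_closedBall_zero_iff]; exact hz
  obtain ⟨A, hA⟩ := exists_bound_iteratedFDeriv_of_isCompact hKc hM k
  obtain ⟨C, hC⟩ := exists_bound_iteratedFDeriv_comp (W := ℝ) (S := S) contDiff_compactMap (k := k)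
    (fun i _ _ => exists_bound_iteratedFDeriv_of_fderiv_eq_comp hKc contDiff_compactMap hmaps
      contDiff_compactRhs fderiv_compactMap i) A
  exact ⟨C, fun x ξ hξ => hC M hM (fun i hi z hz => hA i hi _ (hmaps hz)) (x, ξ) hξ⟩

/-- `outerProfile` in the variables `θ = q / r` and `t = 1 / r`. -/
noncomputable def outerCompact (c θ t : ℝ) : ℝ :=
  outerStep c (θ - t / c) * (2 / c - t * (√((θ + c) ^ 2 + (c / 2) ^ 2))⁻¹)

theorem outerProfile_eq {c q r : ℝ} (hr : 0 < r) :
    outerProfile c q r = outerCompact c (r⁻¹ * q) r⁻¹ := by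
  have h1 : (q - 1 / c) / r = r⁻¹ * q - r⁻¹ / c := by field_simp
  have h2 : (√((q + c * r) ^ 2 + (c * r / 2) ^ 2))⁻¹ =
      r⁻¹ * (√((r⁻¹ * q + c) ^ 2 + (c / 2) ^ 2))⁻¹ := by
    rw [← mul_inv]
    congr 1
    have e : (q + c * r) ^ 2 + (c * r / 2) ^ 2 = r ^ 2 * ((r⁻¹ * q + c) ^ 2 + (c / 2) ^ 2) := by
      field_simp
    rw [e, Real.sqrt_mul (by positivity), Real.sqrt_sq hr.le]
  rw [outerProfile, outerCompact, h1, h2]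

/-- The symbol near infinity, as a function on the target of `compactMap`. -/
noncomputable def outerFun (n : ℕ) (c : ℝ) (w : (ℝ × E n) × E n) : ℝ :=
  outerCompact c (inner ℝ w.1.2 (unitMap w.2)) w.1.1 -
    outerCompact c (-inner ℝ w.1.2 (unitMap w.2)) w.1.1

theorem contDiff_outerFun {c : ℝ} (hc : 0 < c) : ContDiff ℝ ∞ (outerFun n c) := by
  have h1 : ContDiff ℝ ∞ fun p : ℝ × ℝ => outerCompact c p.1 p.2 := by
    refine ((contDiff_outerStep c).comp (by fun_prop)).mul (contDiff_const.sub
      (contDiff_snd.mul (ContDiff.inv (ContDiff.sqrt (by fun_prop) fun p => ?_) fun p => ?_)))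
    · positivity
    · exact (Real.sqrt_pos.2 (by positivity)).ne'
  have ht : ContDiff ℝ ∞ fun w : (ℝ × E n) × E n => w.1.1 := contDiff_fst.comp contDiff_fst
  have hθ : ContDiff ℝ ∞ fun w : (ℝ × E n) × E n => inner ℝ w.1.2 (unitMap w.2) :=
    (contDiff_snd.comp contDiff_fst).inner ℝ (contDiff_unitMap.comp contDiff_snd)
  exact (h1.comp (hθ.prodMk ht)).sub (h1.comp (hθ.neg.prodMk ht))

/-- The symbol near infinity: odd in the radial momentum, nondecreasing along the Hamiltonian
flow everywhere, and strictly increasing outside a compact set in `x`. -/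
noncomputable def outerSymbol (n : ℕ) (c : ℝ) : E n × E n → ℝ := outerFun n c ∘ compactMap

theorem contDiff_outerSymbol {c : ℝ} (hc : 0 < c) : ContDiff ℝ ∞ (outerSymbol n c) :=
  (contDiff_outerFun hc).comp contDiff_compactMap

theorem outerSymbol_eq {c : ℝ} {x ξ : E n} (hξ : 1 / 2 ≤ ‖ξ‖) :
    outerSymbol n c (x, ξ) =
      outerProfile c (radial x ξ) (bracket x) - outerProfile c (-radial x ξ) (bracket x) := by
  have h : inner ℝ ((bracket x)⁻¹ • x) (unitMap ξ) = (bracket x)⁻¹ * radial x ξ := by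
    rw [unitMap_eq hξ, inner_smul_left, inner_smul_right, radial]
    simp only [conj_trivial]
    ring
  simp only [outerSymbol, Function.comp_apply, outerFun, compactMap,
    outerProfile_eq (bracket_pos x), h, mul_neg]

variable {γ C₁ : ℝ} {a : Fin n → Fin n → E n → ℝ}

theorem hasDerivAt_line {Y : Type*} [NormedAddCommGroup Y] [NormedSpace ℝ Y] (z v : Y) :
    HasDerivAt (fun s : ℝ => z + s • v) v 0 := by
  have h := ((hasDerivAt_id (0 : ℝ)).smul_const v).const_add z
  rwa [one_smul] at h

theorem hasDerivAt_comp_line {f : E n × E n → ℝ} {z : E n × E n} (hf : DifferentiableAt ℝ f z)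
    (v : E n × E n) : HasDerivAt (fun s : ℝ => f (z + s • v)) (fderiv ℝ f z v) 0 := by
  have h1 : HasFDerivAt f (fderiv ℝ f z) (z + (0 : ℝ) • v) := by simpa using hf.hasFDerivAt
  exact h1.comp_hasDerivAt 0 (hasDerivAt_line z v)

theorem outerSymbol_growth (hγ : 0 < γ) (hC : 0 ≤ C₁) (ha : Admissible γ C₁ a) {x ξ : E n}
    (hξ : 1 ≤ ‖ξ‖) :
    0 ≤ fderiv ℝ (outerSymbol n (escapeParam n γ C₁)) (x, ξ) (hamField a (x, ξ)) ∧
      (4 / escapeParam n γ C₁ ^ 2 ≤ bracket x →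
        escapeParam n γ C₁ ^ 2 * (fieldBound n γ C₁ * ‖ξ‖) / (32 * bracket x ^ 2) ≤
          fderiv ℝ (outerSymbol n (escapeParam n γ C₁)) (x, ξ) (hamField a (x, ξ))) := by
  set c := escapeParam n γ C₁ with hc
  have hc0 : 0 < c := escapeParam_pos hγ hC
  have hc2 : c ≤ 1 / 2 := escapeParam_le hγ hC
  have hF := fieldBound_pos (n := n) hγ hC
  set X : ℝ → E n := fun s => x + s • velX a x ξ with hX
  set Ξ : ℝ → E n := fun s => ξ + s • velΞ a x ξ with hΞ
  have hX0 : X 0 = x := by simp [hX]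
  have hΞ0 : Ξ 0 = ξ := by simp [hΞ]
  have hdX : HasDerivAt X (velX a (X 0) (Ξ 0)) 0 := by
    rw [hX0, hΞ0]
    exact hasDerivAt_line x _
  have hdΞ : HasDerivAt Ξ (velΞ a (X 0) (Ξ 0)) 0 := by
    rw [hX0, hΞ0]
    exact hasDerivAt_line ξ _
  obtain ⟨q', r', hq, hr, hr', hq'⟩ := exists_hasDerivAt_radial hγ hC ha hdX hdΞ
    (by rw [hΞ0]; exact norm_pos_iff.1 (by linarith))
  rw [hX0, hΞ0] at hq'
  rw [hΞ0] at hr'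
  set σ := fieldBound n γ C₁ * ‖ξ‖ with hσ
  have hσ0 : 0 ≤ σ := by positivity
  obtain ⟨D, hD, hD0, hD1⟩ := exists_hasDerivAt_outerProfile hc0 hc2 hσ0 hq hr (one_le_bracket _)
    (abs_radial_le _ _) hr' (by rw [hX0]; exact hq')
  -- the incoming part is the outgoing part of the time-reversed curve
  have hneg : HasDerivAt (fun s : ℝ => -s) (-1) 0 := hasDerivAt_neg 0
  have hq2 : HasDerivAt (fun s => -radial (X (-s)) (Ξ (-s))) q' 0 := by
    have h1 : HasDerivAt (fun s => radial (X s) (Ξ s)) q' (-0) := by rwa [neg_zero]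
    refine (h1.comp 0 hneg).fun_neg.congr_deriv (by ring)
  have hr2 : HasDerivAt (fun s => bracket (X (-s))) (-r') 0 := by
    have h1 : HasDerivAt (fun s => bracket (X s)) r' (-0) := by rwa [neg_zero]
    refine (h1.comp 0 hneg).congr_deriv (by ring)
  obtain ⟨D', hD', hD'0, hD'1⟩ := exists_hasDerivAt_outerProfile hc0 hc2 hσ0 hq2 hr2
    (one_le_bracket _) (by rw [abs_neg]; exact abs_radial_le _ _) (by rwa [abs_neg])
    (by rw [neg_zero, hX0]; exact hq')
  have hD2 : HasDerivAt (fun s => outerProfile c (-radial (X s) (Ξ s)) (bracket (X s)))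
      (-D') 0 := by
    have h1 : HasDerivAt (fun s => outerProfile c (-radial (X (-s)) (Ξ (-s))) (bracket (X (-s))))
      D' (-0) := by rwa [neg_zero]
    have h2 := h1.comp 0 hneg
    simp only [Function.comp_def, neg_neg] at h2
    exact h2.congr_deriv (by ring)
  have hev : (fun s : ℝ => outerSymbol n c ((x, ξ) + s • hamField a (x, ξ))) =ᶠ[𝓝 0]
      fun s => outerProfile c (radial (X s) (Ξ s)) (bracket (X s)) -
        outerProfile c (-radial (X s) (Ξ s)) (bracket (X s)) := by
    have h1 : ∀ᶠ s in 𝓝 (0 : ℝ), 1 / 2 < ‖Ξ s‖ :=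
      ContinuousAt.eventually_lt continuousAt_const hdΞ.continuousAt.norm
        (by rw [hΞ0]; linarith)
    filter_upwards [h1] with s hs
    exact outerSymbol_eq hs.le
  have hfd : fderiv ℝ (outerSymbol n c) (x, ξ) (hamField a (x, ξ)) = D + D' := by
    have h1 := hasDerivAt_comp_line (((contDiff_outerSymbol hc0).differentiable (by simp)) (x, ξ))
      (hamField a (x, ξ))
    have h2 := (hD.sub hD2).congr_of_eventuallyEq hev
    rw [h1.unique h2]; ring
  rw [hfd]
  refine ⟨by positivity, fun hR => ?_⟩
  have hb := bracket_pos x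
  have hu : ∀ q : ℝ, 0 ≤ q → -(c / 4) ≤ (q - 1 / c) / bracket x := by
    intro q hq0
    rw [le_div_iff₀ hb]
    have h1 : 1 / c = 4 / c ^ 2 * (c / 4) := by field_simp
    have h2 : 4 / c ^ 2 * (c / 4) ≤ bracket x * (c / 4) :=
      mul_le_mul_of_nonneg_right hR (by positivity)
    linarith
  rw [neg_zero, hX0, hΞ0] at hD'1
  rw [hX0, hΞ0] at hD1
  rcases le_total 0 (radial x ξ) with h | h
  · linarith [hD1 (hu _ h)]
  · linarith [hD'1 (hu _ (by linarith))]

end OuterSymbol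

/-! ### Finiteness of the escape time -/

section Escape

variable {n : ℕ} {γ C₁ : ℝ} {a : Fin n → Fin n → E n → ℝ}

theorem quadSymbol_zero (x : E n) : quadSymbol a x 0 = 0 := by simp [quadSymbol]

theorem IsOrbit.snd_ne_zero (hγ : 0 < γ) (ha : Admissible γ C₁ a) {Z : ℝ → E n × E n}
    (hZ : IsOrbit a Z) (h0 : (Z 0).2 ≠ 0) (t : ℝ) : (Z t).2 ≠ 0 := by
  intro h
  have h1 := hZ.energy ha.differentiable t
  rw [h, quadSymbol_zero] at h1
  have h2 := ha.elliptic (Z 0).1 (Z 0).2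
  have h3 : 0 < γ * ‖(Z 0).2‖ ^ 2 := by have := norm_pos_iff.2 h0; positivity
  linarith

theorem isOrbit_iff (ha : Admissible γ C₁ a) {X Ξ : ℝ → E n} :
    IsBicharacteristic (quadSymbol a) X Ξ ↔ IsOrbit a fun t => (X t, Ξ t) :=
  isBicharacteristic_iff ha.differentiable

theorem IsOrbit.hasDerivAt_fst {Z : ℝ → E n × E n} (hZ : IsOrbit a Z) (t : ℝ) :
    HasDerivAt (fun s => (Z s).1) (velX a (Z t).1 (Z t).2) t :=
  (ContinuousLinearMap.fst ℝ (E n) (E n)).hasFDerivAt.comp_hasDerivAt t (hZ t)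

theorem IsOrbit.hasDerivAt_snd {Z : ℝ → E n × E n} (hZ : IsOrbit a Z) (t : ℝ) :
    HasDerivAt (fun s => (Z s).2) (velΞ a (Z t).1 (Z t).2) t :=
  (ContinuousLinearMap.snd ℝ (E n) (E n)).hasFDerivAt.comp_hasDerivAt t (hZ t)

/-- A curve which is outgoing and far away never comes back: the step in `(q - 1/c) / r` stays
complete, and then `q + c r` is nondecreasing. -/
theorem lt_of_outgoing {c : ℝ} (hc : 0 < c) (hc2 : c ≤ 1 / 2) {q r q' r' σ : ℝ → ℝ}
    (hσ : ∀ s, 0 ≤ σ s) (hq : ∀ s, HasDerivAt q (q' s) s) (hr : ∀ s, HasDerivAt r (r' s) s)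
    (hr1 : ∀ s, 1 ≤ r s) (hqr : ∀ s, q s ≤ r s) (hr' : ∀ s, |r' s| ≤ σ s)
    (hq' : ∀ s, 1 / (2 * c) ≤ r s → 2 * c * σ s ≤ q' s) {μ : ℝ} (h1 : 4 / c ^ 2 ≤ r 0)
    (h2 : (1 + c) * (|μ| + 1) / c ≤ r 0) (h3 : 0 ≤ q 0) {t : ℝ} (ht : 0 ≤ t) : μ < r t := by
  have hr0 : ∀ s, 0 < r s := fun s => by linarith [hr1 s]
  have hG : ∀ s, HasDerivAt (fun s => outerStep c ((q s - 1 / c) / r s))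
      (deriv (outerStep c) ((q s - 1 / c) / r s) *
        ((q' s * r s - (q s - 1 / c) * r' s) / r s ^ 2)) s := fun s =>
    (hasDerivAt_outerStep c _).comp s (((hq s).sub_const (1 / c)).fun_div (hr s) (hr0 s).ne')
  have hmono : Monotone fun s => outerStep c ((q s - 1 / c) / r s) := by
    refine monotone_of_deriv_nonneg (fun s => (hG s).differentiableAt) fun s => ?_
    rw [(hG s).deriv]
    rcases le_or_gt ((q s - 1 / c) / r s) (-(c / 2)) with h | h
    · rw [deriv_outerStep_of_le hc h, zero_mul]
    rcases le_or_gt (-(c / 4)) ((q s - 1 / c) / r s) with h2 | h2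
    · rw [deriv_outerStep_of_ge hc h2, zero_mul]
    refine mul_nonneg (deriv_outerStep_nonneg hc _) ?_
    exact outer_arg_mono hc (hσ s) (hr' s)
      (hq' s (le_of_lt_outer_arg hc hc2 (hr1 s) (hqr s) h)) (hr0 s) h.le (by linarith)
  have hstart : outerStep c ((q 0 - 1 / c) / r 0) = 1 := by
    refine outerStep_eq_one hc ?_
    rw [le_div_iff₀ (hr0 0)]
    have h4 : 1 / c = 4 / c ^ 2 * (c / 4) := by field_simp
    have h5 : 4 / c ^ 2 * (c / 4) ≤ r 0 * (c / 4) :=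
      mul_le_mul_of_nonneg_right h1 (by positivity)
    linarith
  have hgrow : ∀ s, 0 ≤ s → 2 * c * σ s ≤ q' s := by
    intro s hs
    refine hq' s (le_of_lt_outer_arg hc hc2 (hr1 s) (hqr s) ?_)
    by_contra hcon
    have h4 : outerStep c ((q 0 - 1 / c) / r 0) ≤ outerStep c ((q s - 1 / c) / r s) := hmono hs
    rw [hstart, outerStep_eq_zero hc (not_lt.1 hcon)] at h4
    linarith
  have hw : ∀ s, HasDerivAt (fun s => q s + c * r s) (q' s + c * r' s) s := fun s =>
    (hq s).fun_add ((hr s).const_mul c)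
  have hwmono : MonotoneOn (fun s => q s + c * r s) (Ici 0) := by
    refine monotoneOn_of_deriv_nonneg (convex_Ici 0)
      (fun s _ => (hw s).continuousAt.continuousWithinAt)
      (fun s _ => (hw s).differentiableAt.differentiableWithinAt) fun s hs => ?_
    rw [interior_Ici] at hs
    rw [(hw s).deriv]
    have h4 := hgrow s (le_of_lt hs)
    have h5 := mul_le_mul_of_nonneg_left (abs_le.1 (hr' s)).1 hc.le
    have h6 := mul_nonneg hc.le (hσ s)
    linarith
  have h4 : q 0 + c * r 0 ≤ q t + c * r t := hwmono self_mem_Ici ht ht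
  rw [div_le_iff₀ hc] at h2
  have h5 : (1 + c) * (|μ| + 1) ≤ (1 + c) * r t := by linarith [hqr t]
  have h6 := le_of_mul_le_mul_left h5 (by linarith)
  exact (lt_of_le_of_lt (le_abs_self μ) (by linarith)).trans_le h6

/-- An orbit which is far away and does not move inwards never returns to a given ball. -/
theorem IsOrbit.lt_bracket_of_outgoing (hγ : 0 < γ) (hC : 0 ≤ C₁) (ha : Admissible γ C₁ a)
    (μ : ℝ) : ∃ ρ, ∀ Z, IsOrbit a Z → (Z 0).2 ≠ 0 → ρ ≤ bracket (Z 0).1 →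
      0 ≤ radial (Z 0).1 (Z 0).2 → ∀ t, 0 ≤ t → μ < bracket (Z t).1 := by
  have hF := fieldBound_pos (n := n) hγ hC
  refine ⟨max (4 / escapeParam n γ C₁ ^ 2)
    ((1 + escapeParam n γ C₁) * (|μ| + 1) / escapeParam n γ C₁), fun Z hZ h0 hρ hq0 t ht => ?_⟩
  have hne := hZ.snd_ne_zero hγ ha h0
  have hex : ∀ s, ∃ q' r', HasDerivAt (fun s => radial (Z s).1 (Z s).2) q' s ∧
      HasDerivAt (fun s => bracket (Z s).1) r' s ∧ |r'| ≤ fieldBound n γ C₁ * ‖(Z s).2‖ ∧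
      (1 / (2 * escapeParam n γ C₁) ≤ bracket (Z s).1 →
        2 * escapeParam n γ C₁ * (fieldBound n γ C₁ * ‖(Z s).2‖) ≤ q') := fun s =>
    exists_hasDerivAt_radial hγ hC ha (hZ.hasDerivAt_fst s) (hZ.hasDerivAt_snd s) (hne s)
  choose q' r' hq hr hr' hq' using hex
  exact lt_of_outgoing (escapeParam_pos hγ hC) (escapeParam_le hγ hC)
    (fun s => mul_nonneg hF.le (norm_nonneg (Z s).2)) hq hr (fun s => one_le_bracket _)
    (fun s => le_of_abs_le (abs_radial_le _ _)) hr' hq' ((le_max_left _ _).trans hρ)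
    ((le_max_right _ _).trans hρ) hq0 ht

/-- Between two times at which an orbit is in a given ball it stays in a larger one. -/
theorem IsOrbit.bracket_lt_of_endpoints (hγ : 0 < γ) (hC : 0 ≤ C₁) (ha : Admissible γ C₁ a)
    (μ : ℝ) : ∃ ρ, ∀ Z, IsOrbit a Z → (Z 0).2 ≠ 0 → ∀ t₀ t₁, bracket (Z t₀).1 ≤ μ →
      bracket (Z t₁).1 ≤ μ → ∀ t ∈ Icc t₀ t₁, bracket (Z t).1 < ρ := by
  obtain ⟨ρ, hρ⟩ := IsOrbit.lt_bracket_of_outgoing hγ hC ha μ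
  refine ⟨ρ, fun Z hZ h0 t₀ t₁ h1 h2 t ht => ?_⟩
  by_contra hcon
  have hne := hZ.snd_ne_zero hγ ha h0
  rcases le_total 0 (radial (Z t).1 (Z t).2) with h | h
  · have h3 := hρ _ (hZ.shift t) (by simpa using hne t) (by simpa using hcon) (by simpa using h)
      (t₁ - t) (by linarith [ht.2])
    simp only [add_sub_cancel] at h3
    linarith
  · -- an incoming orbit is outgoing for the reversed time
    have h3 := hρ _ ((hZ.shift t).scale (-1)) (by simpa using hne t) (by simpa using hcon)
      (by simpa [radial, neg_div] using h) (t - t₀) (by linarith [ht.1])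
    have e : t + -1 * (t - t₀) = t₀ := by ring
    simp only [e] at h3
    linarith

/-- If the escape time is infinite, there are orbits of bounded energy which stay in a fixed ball
for arbitrarily long times around `0`. -/
theorem exists_long_bounded_orbit (hγ : 0 < γ) (hC : 0 ≤ C₁) (ha : Admissible γ C₁ a) {μ : ℝ}
    (hμ : escapeTime (quadSymbol a) μ = ⊤) :
    ∃ ρ, ∀ k : ℕ, ∃ Z, IsOrbit a Z ∧ γ ≤ quadSymbol a (Z 0).1 (Z 0).2 ∧
      quadSymbol a (Z 0).1 (Z 0).2 ≤ fieldBound n γ C₁ ∧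
      ∀ t : ℝ, |t| ≤ k → ‖(Z t).1‖ ≤ ρ := by
  obtain ⟨ρ, hρ⟩ := IsOrbit.bracket_lt_of_endpoints hγ hC ha (1 + μ)
  refine ⟨ρ, fun k => ?_⟩
  have h1 : ((2 * k : ℕ) : ℝ≥0∞) < escapeTime (quadSymbol a) μ := by
    rw [hμ]; exact ENNReal.natCast_lt_top _
  simp only [escapeTime, lt_iSup_iff] at h1
  obtain ⟨X, Ξ, s, hbi, hX0, hΞ0, hXs, hs⟩ := h1
  have hk : 2 * (k : ℝ) < |s| := by
    have := (ENNReal.lt_ofReal_iff_toReal_lt (ENNReal.natCast_ne_top _)).1 hs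
    simpa using this
  have hZ := (isOrbit_iff ha).1 hbi
  have hne : Ξ 0 ≠ 0 := by intro h; simp [h] at hΞ0
  have hen : ∀ t, quadSymbol a (X t) (Ξ t) = quadSymbol a (X 0) (Ξ 0) := fun t =>
    hZ.energy ha.differentiable t
  have hb0 : bracket (X 0) ≤ 1 + μ := (bracket_le _).trans (by linarith)
  have hbs : bracket (X s) ≤ 1 + μ := (bracket_le _).trans (by linarith)
  refine ⟨_, hZ.shift (s / 2), ?_, ?_, fun t ht => ?_⟩
  · change γ ≤ quadSymbol a (X (s / 2 + 0)) (Ξ (s / 2 + 0))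
    rw [hen]; simpa [hΞ0] using ha.elliptic (X 0) (Ξ 0)
  · change quadSymbol a (X (s / 2 + 0)) (Ξ (s / 2 + 0)) ≤ _
    rw [hen]; simpa [hΞ0] using ha.quadSymbol_le hγ hC (X 0) (Ξ 0)
  · refine (norm_le_bracket _).trans ?_
    obtain ⟨ht1, ht2⟩ := abs_le.1 ht
    rcases le_total 0 s with h | h
    · rw [abs_of_nonneg h] at hk
      exact (hρ _ hZ hne 0 s hb0 hbs _ ⟨by linarith, by linarith⟩).le
    · rw [abs_of_nonpos h] at hk
      exact (hρ _ hZ hne s 0 hbs hb0 _ ⟨by linarith, by linarith⟩).le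

/-- For a non-trapping symbol the escape times are finite: otherwise the orbits with long stays
would accumulate, around the middle of their stay, at a bounded orbit. -/
theorem escapeTime_ne_top (hγ : 0 < γ) (hC : 0 ≤ C₁) (ha : Admissible γ C₁ a)
    (hnt : NonTrapping (quadSymbol a)) (μ : ℝ) : escapeTime (quadSymbol a) μ ≠ ⊤ := by
  intro hμ
  obtain ⟨ρ, hρ⟩ := exists_long_bounded_orbit hγ hC ha hμ
  choose Z hZ hlow hup hbd using hρ
  set F := fieldBound n γ C₁ with hF
  have hF0 : 0 < F := fieldBound_pos hγ hC
  have hcont : Continuous fun z : E n × E n => quadSymbol a z.1 z.2 :=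
    (differentiable_quadSymbol ha.differentiable).continuous
  have hmem : ∀ k, Z k 0 ∈ Metric.closedBall (0 : E n) ρ ×ˢ
      Metric.closedBall (0 : E n) (√(F / γ)) := by
    intro k
    refine ⟨mem_closedBall_zero_iff.2 (hbd k 0 (by simp)), mem_closedBall_zero_iff.2 ?_⟩
    refine Real.le_sqrt_of_sq_le ?_
    rw [le_div_iff₀ hγ]
    linarith [ha.elliptic (Z k 0).1 (Z k 0).2, hup k]
  obtain ⟨z, -, φ, hφ, hlim⟩ :=
    ((isCompact_closedBall (0 : E n) ρ).prod (isCompact_closedBall (0 : E n) _)).tendsto_subseq hmem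
  have hlimE := (hcont.tendsto z).comp hlim
  have hzlow : γ ≤ quadSymbol a z.1 z.2 := ge_of_tendsto' hlimE fun k => hlow _
  have hzup : quadSymbol a z.1 z.2 ≤ F := le_of_tendsto' hlimE fun k => hup _
  obtain ⟨W, hW, hW0⟩ := exists_orbit hγ hC ha z
  obtain ⟨L, -, hL⟩ := exists_flow_bound (n := n) hγ hC hF0
  have hbdd : ∀ t, ‖(W t).1‖ ≤ ρ := by
    intro t
    have h1 : Tendsto (fun k => Z (φ k) t) atTop (𝓝 (W t)) := by
      rw [tendsto_iff_norm_sub_tendsto_zero]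
      have h2 : Tendsto (fun k => ‖Z (φ k) 0 - W 0‖ * Real.exp (L * |t|)) atTop (𝓝 0) := by
        rw [hW0]
        simpa using (tendsto_iff_norm_sub_tendsto_zero.1 hlim).mul_const (Real.exp (L * |t|))
      exact squeeze_zero (fun _ => norm_nonneg _) (fun k =>
        (hL a ha).2.1 _ _ (hZ _) hW (hup _) (by rw [hW0]; exact hzup) t) h2
    refine le_of_tendsto ((continuous_fst.norm.tendsto (W t)).comp h1) ?_
    filter_upwards [eventually_ge_atTop ⌈|t|⌉₊] with k hk
    refine hbd (φ k) t ((Nat.le_ceil _).trans ?_)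
    exact_mod_cast hk.trans (hφ.id_le k)
  refine hnt (fun t => (W t).1) (fun t => (W t).2) ((isOrbit_iff ha).2 hW) ?_ ?_
  · intro h
    rw [hW0] at h
    rw [h, quadSymbol_zero] at hzlow
    linarith
  · exact isBounded_iff_forall_norm_le.2 ⟨ρ, by rintro _ ⟨t, rfl⟩; exact hbdd t⟩

/-- Quantitative form of the escape condition, for initial momenta of any size. -/
theorem IsOrbit.le_norm_of_controlsEscape (ha : Admissible γ C₁ a) {τ : ℝ → ℝ≥0}
    (hτ : ControlsEscape (quadSymbol a) τ) {Z : ℝ → E n × E n} (hZ : IsOrbit a Z)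
    (h0 : (Z 0).2 ≠ 0) {μ s : ℝ} (hμ : ‖(Z 0).1‖ ≤ μ) (hs : τ μ < ‖(Z 0).2‖ * |s|) :
    μ ≤ ‖(Z s).1‖ := by
  by_contra hcon
  have hpos : 0 < ‖(Z 0).2‖ := norm_pos_iff.2 h0
  have hO := hZ.scale ‖(Z 0).2‖⁻¹
  have h1 := (isOrbit_iff ha).2 hO
  have hle : ENNReal.ofReal |‖(Z 0).2‖ * s| ≤ escapeTime (quadSymbol a) μ := by
    refine le_iSup_of_le _ (le_iSup_of_le _ (le_iSup_of_le (‖(Z 0).2‖ * s) (le_iSup_of_le h1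
      (le_iSup_of_le (by simpa using hμ) (le_iSup_of_le ?_ (le_iSup_of_le ?_ le_rfl))))))
    · simp [norm_smul, hpos.ne']
    · rw [← mul_assoc, inv_mul_cancel₀ hpos.ne', one_mul]
      exact not_le.1 hcon
  have h2 := hle.trans (hτ μ)
  rw [ENNReal.ofReal_le_coe, abs_mul, abs_norm] at h2
  linarith

end Escape

/-! ### The time spent in a ball -/

section Stay

variable {n : ℕ} {γ C₁ : ℝ} {a : Fin n → Fin n → E n → ℝ}

open Classical in
/-- The orbit through a point; it exists for admissible coefficients by `exists_orbit`. -/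
noncomputable def flow (a : Fin n → Fin n → E n → ℝ) (z : E n × E n) : ℝ → E n × E n :=
  if h : ∃ Z, IsOrbit a Z ∧ Z 0 = z then h.choose else fun _ => z

theorem isOrbit_flow (hγ : 0 < γ) (hC : 0 ≤ C₁) (ha : Admissible γ C₁ a) (z : E n × E n) :
    IsOrbit a (flow a z) := by
  have h := exists_orbit hγ hC ha z
  rw [flow, dif_pos h]; exact h.choose_spec.1

theorem flow_zero (hγ : 0 < γ) (hC : 0 ≤ C₁) (ha : Admissible γ C₁ a) (z : E n × E n) :
    flow a z 0 = z := by
  have h := exists_orbit hγ hC ha z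
  rw [flow, dif_pos h]; exact h.choose_spec.2

theorem flow_eq (hγ : 0 < γ) (hC : 0 ≤ C₁) (ha : Admissible γ C₁ a) {Z : ℝ → E n × E n}
    (hZ : IsOrbit a Z) {z : E n × E n} (h : Z 0 = z) : flow a z = Z :=
  (isOrbit_flow hγ hC ha z).eq_of_zero hγ hC ha hZ (by rw [flow_zero hγ hC ha, h])

/-- A Lipschitz cut-off: `1` for `|x| ≤ μ - 1` and `0` for `|x| ≥ μ`. -/
noncomputable def ballCutoff (μ : ℝ) (x : E n) : ℝ := max 0 (min 1 (μ - ‖x‖))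

theorem ballCutoff_nonneg (μ : ℝ) (x : E n) : 0 ≤ ballCutoff μ x := le_max_left _ _

theorem ballCutoff_le_one (μ : ℝ) (x : E n) : ballCutoff μ x ≤ 1 :=
  max_le zero_le_one (min_le_left _ _)

theorem ballCutoff_eq_one {μ : ℝ} {x : E n} (h : ‖x‖ ≤ μ - 1) : ballCutoff μ x = 1 := by
  rw [ballCutoff, min_eq_left (by linarith), max_eq_right zero_le_one]

theorem ballCutoff_eq_zero {μ : ℝ} {x : E n} (h : μ ≤ ‖x‖) : ballCutoff μ x = 0 :=
  max_eq_left ((min_le_right _ _).trans (by linarith))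

theorem abs_ballCutoff_sub_le (μ : ℝ) (x y : E n) :
    |ballCutoff μ x - ballCutoff μ y| ≤ ‖x - y‖ := by
  refine (abs_clamp_sub_le _ _ _ _).trans ?_
  rw [show μ - ‖x‖ - (μ - ‖y‖) = ‖y‖ - ‖x‖ by ring, norm_sub_rev]
  exact abs_norm_sub_norm_le y x

theorem continuous_ballCutoff (μ : ℝ) : Continuous (ballCutoff (n := n) μ) := by
  unfold ballCutoff; fun_prop

/-- The time, smoothed at the boundary, which the orbit of `z` spends in the ball of radius `μ`
during `[0, T]`. -/
noncomputable def stayTime (a : Fin n → Fin n → E n → ℝ) (μ T : ℝ) (z : E n × E n) : ℝ :=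
  ∫ s in (0 : ℝ)..T, ballCutoff μ (flow a z s).1

theorem continuous_ballCutoff_orbit {Z : ℝ → E n × E n} (hZ : IsOrbit a Z) (μ : ℝ) :
    Continuous fun s => ballCutoff μ (Z s).1 :=
  (continuous_ballCutoff μ).comp
    (continuous_fst.comp (continuous_iff_continuousAt.2 fun t => (hZ t).continuousAt))

theorem abs_stayTime_le (μ : ℝ) {T : ℝ} (hT : 0 ≤ T) (z : E n × E n) :
    |stayTime a μ T z| ≤ T := by
  have h := intervalIntegral.norm_integral_le_of_norm_le_const (a := 0) (b := T) (C := 1)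
    (f := fun s => ballCutoff μ (flow a z s).1) fun s _ => by
      rw [Real.norm_of_nonneg (ballCutoff_nonneg _ _)]; exact ballCutoff_le_one _ _
  simpa [abs_of_nonneg hT, stayTime] using h

/-- Below a given energy `stayTime` is Lipschitz, by the exponential bound for the divergence of
orbits. -/
theorem abs_stayTime_sub_le (hγ : 0 < γ) (hC : 0 ≤ C₁) {L E₀ : ℝ} (hL0 : 0 ≤ L)
    (ha : Admissible γ C₁ a)
    (hL : ∀ Z W, IsOrbit a Z → IsOrbit a W → quadSymbol a (Z 0).1 (Z 0).2 ≤ E₀ →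
        quadSymbol a (W 0).1 (W 0).2 ≤ E₀ → ∀ t,
          ‖Z t - W t‖ ≤ ‖Z 0 - W 0‖ * Real.exp (L * |t|))
    (μ : ℝ) {T : ℝ} (hT : 0 ≤ T) {z w : E n × E n} (hz : quadSymbol a z.1 z.2 ≤ E₀)
    (hw : quadSymbol a w.1 w.2 ≤ E₀) :
    |stayTime a μ T z - stayTime a μ T w| ≤ T * Real.exp (L * T) * ‖z - w‖ := by
  have hOz := isOrbit_flow hγ hC ha z
  have hOw := isOrbit_flow hγ hC ha w
  have hz0 := flow_zero hγ hC ha z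
  have hw0 := flow_zero hγ hC ha w
  rw [stayTime, stayTime, ← intervalIntegral.integral_sub
    ((continuous_ballCutoff_orbit hOz μ).intervalIntegrable _ _)
    ((continuous_ballCutoff_orbit hOw μ).intervalIntegrable _ _)]
  have h := intervalIntegral.norm_integral_le_of_norm_le_const (a := 0) (b := T)
    (C := ‖z - w‖ * Real.exp (L * T))
    (f := fun s => ballCutoff μ (flow a z s).1 - ballCutoff μ (flow a w s).1) fun s hs => by
      rw [uIoc_of_le hT] at hs
      refine (abs_ballCutoff_sub_le μ _ _).trans ?_
      have h1 : ‖(flow a z s).1 - (flow a w s).1‖ ≤ ‖flow a z s - flow a w s‖ :=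
        norm_fst_le (flow a z s - flow a w s)
      have h2 := hL _ _ hOz hOw (by rw [hz0]; exact hz) (by rw [hw0]; exact hw) s
      rw [hz0, hw0] at h2
      refine (h1.trans h2).trans ?_
      rw [abs_of_pos hs.1]
      gcongr
      exact hs.2
  refine h.trans_eq ?_
  rw [sub_zero, abs_of_nonneg hT]; ring

theorem continuous_stayTime (hγ : 0 < γ) (hC : 0 ≤ C₁) (ha : Admissible γ C₁ a) (μ : ℝ) {T : ℝ}
    (hT : 0 ≤ T) : Continuous (stayTime a μ T) := by
  have hcont : Continuous fun z : E n × E n => quadSymbol a z.1 z.2 :=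
    (differentiable_quadSymbol ha.differentiable).continuous
  rw [continuous_iff_continuousAt]
  intro z
  have hE : 0 < quadSymbol a z.1 z.2 + 1 := by linarith [ha.quadSymbol_nonneg hγ z.1 z.2]
  obtain ⟨L, hL0, hL⟩ := exists_flow_bound (n := n) hγ hC hE
  have hev : ∀ᶠ w in 𝓝 z, quadSymbol a w.1 w.2 < quadSymbol a z.1 z.2 + 1 :=
    hcont.continuousAt.eventually_lt continuousAt_const (by linarith)
  refine tendsto_iff_norm_sub_tendsto_zero.2 ?_
  have h1 : Tendsto (fun w => T * Real.exp (L * T) * ‖w - z‖) (𝓝 z) (𝓝 0) := by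
    have : Continuous fun w : E n × E n => T * Real.exp (L * T) * ‖w - z‖ := by fun_prop
    simpa using this.tendsto z
  refine squeeze_zero' (Eventually.of_forall fun _ => norm_nonneg _) ?_ h1
  filter_upwards [hev] with w hw
  exact abs_stayTime_sub_le hγ hC hL0 ha (hL a ha).2.1 μ hT hw.le (by linarith)

/-- Moving along the orbit of `z` for a time `t`, and rescaling the momentum by `l`, shortens the
remaining time in the ball by `t`, up to the factor `l⁻¹` caused by the change of speed. -/
theorem stayTime_advance (hγ : 0 < γ) (hC : 0 ≤ C₁) (ha : Admissible γ C₁ a) {μ T T₀ t l : ℝ}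
    (z : E n × E n) (hl : l ≠ 0) (ht0 : 0 ≤ t) (hT : T₀ ≤ T) (hlT : T₀ ≤ t + l * T)
    (hesc : ∀ s, T₀ ≤ s → μ ≤ ‖(flow a z s).1‖)
    (hnear : ∀ s ∈ Icc 0 t, ‖(flow a z s).1‖ ≤ μ - 1) :
    stayTime a μ T ((flow a z t).1, l • (flow a z t).2) = l⁻¹ * (stayTime a μ T z - t) := by
  have hO := isOrbit_flow hγ hC ha z
  have hcont := continuous_ballCutoff_orbit hO μ
  have hint : ∀ p q, IntervalIntegrable (fun s => ballCutoff μ (flow a z s).1) volume p q :=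
    fun p q => hcont.intervalIntegrable p q
  have hfl := flow_eq hγ hC ha ((hO.shift t).scale l)
    (z := ((flow a z t).1, l • (flow a z t).2)) (by simp)
  have htail : ∀ q, T₀ ≤ q → ∫ s in T₀..q, ballCutoff μ (flow a z s).1 = 0 := by
    intro q hq
    refine (intervalIntegral.integral_congr (g := fun _ => (0 : ℝ)) fun s hs => ?_).trans (by simp)
    rw [uIcc_of_le hq] at hs
    exact ballCutoff_eq_zero (hesc s hs.1)
  have hhead : ∫ s in (0 : ℝ)..t, ballCutoff μ (flow a z s).1 = t := by
    refine (intervalIntegral.integral_congr (g := fun _ => (1 : ℝ)) fun s hs => ?_).trans (by simp)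
    rw [uIcc_of_le ht0] at hs
    exact ballCutoff_eq_one (hnear s hs)
  rw [stayTime, hfl, stayTime]
  have h1 := intervalIntegral.integral_comp_add_mul (a := 0) (b := T)
    (fun s => ballCutoff μ (flow a z s).1) hl t
  simp only at h1 ⊢
  rw [h1, mul_zero, add_zero, smul_eq_mul]
  congr 1
  have h2 := intervalIntegral.integral_add_adjacent_intervals (hint t T₀) (hint T₀ (t + l * T))
  have h3 := intervalIntegral.integral_add_adjacent_intervals (hint 0 t) (hint t T₀)
  have h4 := intervalIntegral.integral_add_adjacent_intervals (hint 0 T₀) (hint T₀ T)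
  rw [htail _ hlT] at h2
  rw [htail _ hT] at h4
  rw [hhead] at h3
  linarith

end Stay

/-! ### Mollification -/

section Mollify

variable {Y : Type*} [NormedAddCommGroup Y] [NormedSpace ℝ Y] [FiniteDimensional ℝ Y]
  [MeasurableSpace Y] [BorelSpace Y]

theorem le_of_hasDerivAt_of_quadratic_lower {f : ℝ → ℝ} {d A B t₀ : ℝ} (hf : HasDerivAt f d 0)
    (ht₀ : 0 < t₀) (h : ∀ t, 0 < t → t < t₀ → t * A - B * t ^ 2 ≤ f t - f 0) : A ≤ d := by
  have h1 := hf.tendsto_slope_zero_right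
  have h2 : Tendsto (fun t : ℝ => A - B * t) (𝓝[>] 0) (𝓝 A) := by
    have : Continuous fun t : ℝ => A - B * t := by fun_prop
    simpa using (this.tendsto 0).mono_left nhdsWithin_le_nhds
  refine le_of_tendsto_of_tendsto h2 h1 ?_
  filter_upwards [Ioo_mem_nhdsGT ht₀] with t ht
  rw [zero_add, smul_eq_mul, inv_mul_eq_div, le_div_iff₀ ht.1]
  have := h t ht.1 ht.2
  nlinarith

/-- If the increments of `f` in the direction `W` from all points close to `z` are bounded below to
first order, then so is the derivative at `z`, in the direction `W`, of a mollification. -/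
theorem le_fderiv_convolution (μ : Measure Y) [μ.IsAddHaarMeasure] (ρ : ContDiffBump (0 : Y))
    {f : Y → ℝ} (hf : Continuous f) {z W : Y} {A B t₀ : ℝ} (ht₀ : 0 < t₀)
    (h : ∀ y, ‖y‖ < ρ.rOut → ∀ t, 0 < t → t < t₀ →
      t * A - B * t ^ 2 ≤ f (z - y + t • W) - f (z - y)) :
    A ≤ fderiv ℝ (convolution (ρ.normed μ) f (ContinuousLinearMap.lsmul ℝ ℝ) μ) z W := by
  set g := convolution (ρ.normed μ) f (ContinuousLinearMap.lsmul ℝ ℝ) μ with hg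
  have hsm : ContDiff ℝ 1 g := ρ.hasCompactSupport_normed.contDiff_convolution_left _
    (n := 1) ρ.contDiff_normed hf.locallyIntegrable
  have hd : HasDerivAt (fun s : ℝ => g (z + s • W)) (fderiv ℝ g z W) 0 := by
    have h1 : HasFDerivAt g (fderiv ℝ g z) (z + (0 : ℝ) • W) := by
      simpa using ((hsm.differentiable (by simp)) z).hasFDerivAt
    exact h1.comp_hasDerivAt 0 (hasDerivAt_line z W)
  refine le_of_hasDerivAt_of_quadratic_lower (B := B) hd ht₀ fun t ht ht1 => ?_
  have hint : ∀ p, Integrable (fun y => ρ.normed μ y * f (p - y)) μ := fun p =>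
    (ρ.continuous_normed.mul
      (hf.comp (continuous_const.sub continuous_id))).integrable_of_hasCompactSupport
        ρ.hasCompactSupport_normed.mul_right
  have hval : ∀ p, g p = ∫ y, ρ.normed μ y * f (p - y) ∂μ := fun p => by
    rw [hg, convolution_def]; rfl
  rw [hval, hval, zero_smul, add_zero, ← integral_sub (hint _) (hint _)]
  have h1 : t * A - B * t ^ 2 = ∫ y, ρ.normed μ y * (t * A - B * t ^ 2) ∂μ := by
    rw [integral_mul_const, ρ.integral_normed, one_mul]
  rw [h1]
  refine integral_mono (ρ.integrable_normed.mul_const _) ((hint _).sub (hint _)) fun y => ?_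
  change ρ.normed μ y * (t * A - B * t ^ 2) ≤
    ρ.normed μ y * f (z + t • W - y) - ρ.normed μ y * f (z - y)
  rw [← mul_sub]
  by_cases hy : ‖y‖ < ρ.rOut
  · refine mul_le_mul_of_nonneg_left ?_ (ρ.nonneg_normed y)
    have := h y hy t ht ht1
    rwa [show z + t • W - y = z - y + t • W by abel]
  · have h0 : ρ.normed μ y = 0 := by
      have : y ∉ Function.support (ρ.normed μ) := by
        rw [ρ.support_normed_eq, mem_ball_zero_iff]; exact hy
      simpa using this
    rw [h0, zero_mul, zero_mul]

end Mollify

/-! ### The symbol on compact sets -/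

section Inner

variable {n : ℕ} {γ C₁ : ℝ} {a : Fin n → Fin n → E n → ℝ}

theorem Admissible.le_sqrt_quadSymbol (ha : Admissible γ C₁ a) {x ξ : E n} (hγ : 0 < γ)
    (hξ : 1 / 2 ≤ ‖ξ‖) : √γ / 2 ≤ √(quadSymbol a x ξ) := by
  have h1 : √γ / 2 = √(γ * (1 / 2) ^ 2) := by
    rw [Real.sqrt_mul hγ.le, Real.sqrt_sq (by norm_num)]; ring
  rw [h1]
  refine Real.sqrt_le_sqrt (le_trans ?_ (ha.elliptic x ξ))
  gcongr

theorem exists_lipschitz_sqrt_quadSymbol (hγ : 0 < γ) (hC : 0 ≤ C₁) :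
    ∃ S : ℝ, 0 ≤ S ∧ ∀ a : Fin n → Fin n → E n → ℝ, Admissible γ C₁ a → ∀ z w : E n × E n,
      1 / 2 ≤ ‖z.2‖ → ‖z.2‖ ≤ 3 → 1 / 2 ≤ ‖w.2‖ → ‖w.2‖ ≤ 3 →
        |√(quadSymbol a z.1 z.2) - √(quadSymbol a w.1 w.2)| ≤ S * ‖z - w‖ := by
  have hu : UniformBddLip γ C₁ fun (a : Fin n → Fin n → E n → ℝ) z =>
      quadSymbol a z.1 (clampVec 3 z.2) :=
    UniformBddLip.sum _ fun l => UniformBddLip.sum _ fun k =>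
      ((UniformBddLip.coeff hC l k).mul (UniformBddLip.clampVec_coord 3 l)).mul
        (UniformBddLip.clampVec_coord 3 k)
  obtain ⟨D, hD⟩ := hu
  have hs : 0 < √γ := Real.sqrt_pos.2 hγ
  refine ⟨|D| / √γ, by positivity, fun a ha z w hz hz3 hw hw3 => ?_⟩
  have h1 := (hD a ha).2 z w
  have hcl : ∀ {ξ : E n}, ‖ξ‖ ≤ 3 → clampVec 3 ξ = ξ := fun h =>
    clampVec_eq_self fun i => (abs_coord_le _ i).trans h
  beta_reduce at h1
  rw [hcl hz3, hcl hw3, dist_eq_norm] at h1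
  have hp := ha.le_sqrt_quadSymbol (x := z.1) hγ hz
  have hq := ha.le_sqrt_quadSymbol (x := w.1) hγ hw
  set p := √(quadSymbol a z.1 z.2) with hp'
  set q := √(quadSymbol a w.1 w.2) with hq'
  have e : quadSymbol a z.1 z.2 - quadSymbol a w.1 w.2 = (p + q) * (p - q) := by
    have h2 := Real.sq_sqrt (ha.quadSymbol_nonneg hγ z.1 z.2)
    have h3 := Real.sq_sqrt (ha.quadSymbol_nonneg hγ w.1 w.2)
    rw [← h2, ← h3]; ring
  rw [e, abs_mul, abs_of_nonneg (by linarith)] at h1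
  rw [div_mul_eq_mul_div, le_div_iff₀ hs]
  have h4 : √γ * |p - q| ≤ (p + q) * |p - q| :=
    mul_le_mul_of_nonneg_right (by linarith) (abs_nonneg _)
  have h5 : D * ‖z - w‖ ≤ |D| * ‖z - w‖ :=
    mul_le_mul_of_nonneg_right (le_abs_self D) (norm_nonneg _)
  linarith

/-- Minus the length, measured by `√h`, of the part of the orbit of `z` which lies in the ball of
radius `μ`; the factor `√h` makes the function homogeneous of degree `0` in `ξ`, as long as the
truncation of `√h` at the level `K` is inactive. -/
noncomputable def innerFun (a : Fin n → Fin n → E n → ℝ) (μ T K : ℝ) (z : E n × E n) : ℝ :=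
  -(min (√(quadSymbol a z.1 z.2)) K * stayTime a μ T z)

theorem abs_innerFun_le {μ T K : ℝ} (hT : 0 ≤ T) (hK : 0 ≤ K) (z : E n × E n) :
    |innerFun a μ T K z| ≤ K * T := by
  rw [innerFun, abs_neg, abs_mul, abs_of_nonneg (le_min (Real.sqrt_nonneg _) hK)]
  exact mul_le_mul (min_le_right _ _) (abs_stayTime_le μ hT z) (abs_nonneg _) hK

theorem continuous_innerFun (hγ : 0 < γ) (hC : 0 ≤ C₁) (ha : Admissible γ C₁ a) {μ T K : ℝ}
    (hT : 0 ≤ T) : Continuous (innerFun a μ T K) :=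
  (((differentiable_quadSymbol ha.differentiable).continuous.sqrt.min continuous_const).mul
    (continuous_stayTime hγ hC ha μ hT)).neg

/-- Lipschitz bound near the unit sphere bundle, uniform over admissible coefficients. -/
theorem exists_lipschitz_innerFun (hγ : 0 < γ) (hC : 0 ≤ C₁) (μ : ℝ) {T K : ℝ} (hT : 0 ≤ T)
    (hK : 0 ≤ K) :
    ∃ S : ℝ, 0 ≤ S ∧ ∀ a : Fin n → Fin n → E n → ℝ, Admissible γ C₁ a → ∀ z w : E n × E n,
      1 / 2 ≤ ‖z.2‖ → ‖z.2‖ ≤ 3 → 1 / 2 ≤ ‖w.2‖ → ‖w.2‖ ≤ 3 →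
        |innerFun a μ T K z - innerFun a μ T K w| ≤ S * ‖z - w‖ := by
  have hF := fieldBound_pos (n := n) hγ hC
  obtain ⟨S, hS0, hS⟩ := exists_lipschitz_sqrt_quadSymbol (n := n) hγ hC
  obtain ⟨L, hL0, hL⟩ := exists_flow_bound (n := n) hγ hC
    (E₀ := fieldBound n γ C₁ * 3 ^ 2) (by positivity)
  refine ⟨S * T + K * (T * Real.exp (L * T)), by positivity, fun a ha z w hz hz3 hw hw3 => ?_⟩
  have hen : ∀ {v : E n × E n}, ‖v.2‖ ≤ 3 →
      quadSymbol a v.1 v.2 ≤ fieldBound n γ C₁ * 3 ^ 2 := fun {v} hv =>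
    (ha.quadSymbol_le hγ hC v.1 v.2).trans (by gcongr)
  have h1 := abs_stayTime_sub_le hγ hC hL0 ha (hL a ha).2.1 μ hT (hen hz3) (hen hw3)
  have h2 : |min (√(quadSymbol a z.1 z.2)) K - min (√(quadSymbol a w.1 w.2)) K| ≤ S * ‖z - w‖ :=
    (abs_min_sub_min_le_max _ _ _ _).trans
      (max_le (hS a ha z w hz hz3 hw hw3) (by simp; positivity))
  have h3 := abs_stayTime_le (a := a) μ hT z
  have h4 : |min (√(quadSymbol a w.1 w.2)) K| ≤ K := by
    rw [abs_of_nonneg (le_min (Real.sqrt_nonneg _) hK)]; exact min_le_right _ _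
  have e : innerFun a μ T K z - innerFun a μ T K w =
      -((min (√(quadSymbol a z.1 z.2)) K - min (√(quadSymbol a w.1 w.2)) K) * stayTime a μ T z +
        min (√(quadSymbol a w.1 w.2)) K * (stayTime a μ T z - stayTime a μ T w)) := by
    simp only [innerFun]; ring
  rw [e, abs_neg, add_mul]
  refine (abs_add_le _ _).trans (add_le_add ?_ ?_)
  · rw [abs_mul]
    refine (mul_le_mul h2 h3 (abs_nonneg _) (by positivity)).trans_eq (by ring)
  · rw [abs_mul]
    refine (mul_le_mul h4 h1 (abs_nonneg _) hK).trans_eq (by ring)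

/-- The function increases at the rate `√h` along orbits, even after a rescaling of the momentum. -/
theorem innerFun_advance (hγ : 0 < γ) (hC : 0 ≤ C₁) (ha : Admissible γ C₁ a) {τ : ℝ → ℝ≥0}
    (hτ : ControlsEscape (quadSymbol a) τ) {L μ t l : ℝ} {z : E n × E n}
    (hL : ∀ Z, IsOrbit a Z → quadSymbol a (Z 0).1 (Z 0).2 ≤ fieldBound n γ C₁ * 3 ^ 2 →
      ∀ t, 0 ≤ t → ‖Z t - Z 0‖ ≤ L * t) (hL0 : 0 ≤ L)
    (hx : ‖z.1‖ ≤ μ - 2) (hξ : 3 / 4 ≤ ‖z.2‖) (hξ' : ‖z.2‖ ≤ 5 / 4) (hl : 7 / 8 ≤ l)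
    (hl' : l ≤ 9 / 8) (ht : 0 ≤ t) (hLt : L * t ≤ 1) :
    innerFun a μ (2 * (2 * τ μ + 1)) (√(fieldBound n γ C₁ * 3 ^ 2)) z + t * (√γ / 2) ≤
      innerFun a μ (2 * (2 * τ μ + 1)) (√(fieldBound n γ C₁ * 3 ^ 2))
        ((flow a z t).1, l • (flow a z t).2) := by
  have hF := fieldBound_pos (n := n) hγ hC
  have hO := isOrbit_flow hγ hC ha z
  have h0 := flow_zero hγ hC ha z
  have hτ0 : (0 : ℝ) ≤ τ μ := (τ μ).2
  have hq := ha.quadSymbol_le hγ hC z.1 z.2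
  have hz9 : quadSymbol a z.1 z.2 ≤ fieldBound n γ C₁ * (5 / 4) ^ 2 := hq.trans (by gcongr)
  have hz0 := ha.quadSymbol_nonneg hγ z.1 z.2
  have hE : quadSymbol a z.1 z.2 ≤ fieldBound n γ C₁ * 3 ^ 2 := hz9.trans (by gcongr; norm_num)
  have hst := stayTime_advance hγ hC ha (μ := μ) (T := 2 * (2 * τ μ + 1)) (T₀ := 2 * τ μ + 1)
    (t := t) (l := l) z (by linarith) ht (by linarith) (by nlinarith)
    (fun s hs => hO.le_norm_of_controlsEscape ha hτ
      (by rw [h0]; exact norm_pos_iff.1 (by linarith)) (by rw [h0]; linarith)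
      (by rw [h0, abs_of_nonneg (by linarith)]; nlinarith))
    (fun s hs => by
      have h1 := hL _ hO (by rw [h0]; exact hE) s hs.1
      rw [h0] at h1
      have h2 : ‖(flow a z s).1 - z.1‖ ≤ ‖flow a z s - z‖ := norm_fst_le (flow a z s - z)
      have h3 := norm_le_norm_add_norm_sub' (flow a z s).1 z.1
      have h4 : L * s ≤ L * t := mul_le_mul_of_nonneg_left hs.2 hL0
      linarith)
  have hen : quadSymbol a (flow a z t).1 (flow a z t).2 = quadSymbol a z.1 z.2 := by
    rw [hO.energy ha.differentiable t, h0]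
  have hs1 : min (√(quadSymbol a z.1 z.2)) (√(fieldBound n γ C₁ * 3 ^ 2)) =
      √(quadSymbol a z.1 z.2) := min_eq_left (Real.sqrt_le_sqrt hE)
  have hs2 : min (√(l ^ 2 * quadSymbol a z.1 z.2)) (√(fieldBound n γ C₁ * 3 ^ 2)) =
      l * √(quadSymbol a z.1 z.2) := by
    rw [min_eq_left, Real.sqrt_mul (sq_nonneg l), Real.sqrt_sq (by linarith)]
    refine Real.sqrt_le_sqrt ?_
    have : l ^ 2 ≤ (9 / 8) ^ 2 := by gcongr
    calc l ^ 2 * quadSymbol a z.1 z.2 ≤ (9 / 8) ^ 2 * (fieldBound n γ C₁ * (5 / 4) ^ 2) := by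
          gcongr
      _ ≤ _ := by nlinarith
  have hrate := ha.le_sqrt_quadSymbol (x := z.1) (ξ := z.2) hγ (by linarith)
  have hl0 : l ≠ 0 := by linarith
  simp only [innerFun, quadSymbol_smul, hen, hst, hs1, hs2]
  have e : l * √(quadSymbol a z.1 z.2) * (l⁻¹ * (stayTime a μ (2 * (2 * τ μ + 1)) z - t)) =
      √(quadSymbol a z.1 z.2) * stayTime a μ (2 * (2 * τ μ + 1)) z -
        t * √(quadSymbol a z.1 z.2) := by
    field_simp
  rw [e]
  have := mul_le_mul_of_nonneg_left hrate ht
  linarith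

/-- The derivative of the projection `(x, ξ) ↦ (x, ξ / |ξ|)` along the Hamiltonian field, at a point
of the unit sphere bundle. -/
noncomputable def sphereField (a : Fin n → Fin n → E n → ℝ) (x θ : E n) : E n × E n :=
  (velX a x θ, velΞ a x θ - inner ℝ (velΞ a x θ) θ • θ)

theorem Admissible.norm_velΞ_le_of_norm_eq_one (hγ : 0 < γ) (hC : 0 ≤ C₁) (ha : Admissible γ C₁ a)
    (x : E n) {θ : E n} (hθ : ‖θ‖ = 1) : ‖velΞ a x θ‖ ≤ fieldBound n γ C₁ := by
  refine (ha.norm_velΞ_le hγ hC x θ).trans ?_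
  rw [hθ, one_pow, mul_one]
  exact div_le_self (fieldBound_pos hγ hC).le (by nlinarith [sq_nonneg ‖x‖])

/-- Moving from a point near `(x, θ)` in the direction of `sphereField` agrees, up to a small error,
with following the flow and rescaling the momentum. -/
theorem norm_add_smul_sphereField_sub_le (hγ : 0 < γ) (hC : 0 ≤ C₁) (ha : Admissible γ C₁ a)
    {L E₀ ε t : ℝ}
    (hlip : ∀ z w : E n × E n, quadSymbol a z.1 z.2 ≤ E₀ → quadSymbol a w.1 w.2 ≤ E₀ →
        ‖hamField a z - hamField a w‖ ≤ L * ‖z - w‖) (hL0 : 0 ≤ L)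
    (htan : ∀ Z, IsOrbit a Z → quadSymbol a (Z 0).1 (Z 0).2 ≤ E₀ → ∀ t, 0 ≤ t →
        ‖Z t - Z 0‖ ≤ L * t ∧ ‖Z t - Z 0 - t • hamField a (Z 0)‖ ≤ L * L * t ^ 2)
    {x θ : E n} (hθ : ‖θ‖ = 1) {z : E n × E n} (hz : ‖z - (x, θ)‖ ≤ ε) (ht : 0 ≤ t)
    (hE : quadSymbol a x θ ≤ E₀) (hE' : quadSymbol a z.1 z.2 ≤ E₀) :
    ‖z + t • sphereField a x θ -
        ((flow a z t).1, (1 - t * inner ℝ (velΞ a x θ) θ) • (flow a z t).2)‖ ≤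
      t * (ε * (L + fieldBound n γ C₁)) + (L * L + fieldBound n γ C₁ * L) * t ^ 2 := by
  have hF := fieldBound_pos (n := n) hγ hC
  set F := fieldBound n γ C₁
  have hO := isOrbit_flow hγ hC ha z
  have h0 := flow_zero hγ hC ha z
  obtain ⟨h1, h2⟩ := htan _ hO (by rw [h0]; exact hE') t ht
  rw [h0] at h1 h2
  set β : ℝ := inner ℝ (velΞ a x θ) θ
  have hβ : |β| ≤ F := by
    have := abs_real_inner_le_norm (velΞ a x θ) θ
    rw [hθ, mul_one] at this
    exact this.trans (ha.norm_velΞ_le_of_norm_eq_one hγ hC x hθ)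
  have h3 := hlip (x, θ) z hE hE'
  rw [norm_sub_rev (x, θ) z] at h3
  have h3' : ‖hamField a (x, θ) - hamField a z‖ ≤ L * ε :=
    h3.trans (mul_le_mul_of_nonneg_left hz hL0)
  have e : z + t • sphereField a x θ - ((flow a z t).1, (1 - t * β) • (flow a z t).2) =
      -(flow a z t - z - t • hamField a z) + t • (hamField a (x, θ) - hamField a z) +
        (t * β) • (0, ((flow a z t) - z).2 + (z - (x, θ)).2) := by
    refine Prod.ext ?_ ?_
    · simp only [sphereField, hamField, Prod.fst_add, Prod.fst_sub, Prod.smul_fst, Prod.fst_neg]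
      module
    · simp only [sphereField, hamField, Prod.snd_add, Prod.snd_sub, Prod.smul_snd, Prod.snd_neg]
      module
  rw [e]
  have h5 : ‖((0 : E n), ((flow a z t) - z).2 + (z - (x, θ)).2)‖ ≤ L * t + ε := by
    refine norm_prod_le_iff.2 ⟨?_, ?_⟩
    · simp only [norm_zero]
      have := (norm_nonneg _).trans hz
      positivity
    · refine (norm_add_le _ _).trans (add_le_add ?_ ?_)
      · exact (norm_snd_le _).trans h1
      · exact (norm_snd_le _).trans hz
  refine (norm_add_le _ _).trans ?_
  have h6 := norm_add_le (-(flow a z t - z - t • hamField a z))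
    (t • (hamField a (x, θ) - hamField a z))
  rw [norm_neg, norm_smul, Real.norm_of_nonneg ht] at h6
  have h7 : ‖(t * β) • ((0 : E n), ((flow a z t) - z).2 + (z - (x, θ)).2)‖ ≤
      t * F * (L * t + ε) := by
    rw [norm_smul, norm_mul, Real.norm_of_nonneg ht]
    gcongr
    exact hβ
  have h8 := mul_le_mul_of_nonneg_left h3' ht
  nlinarith

/-- Over a ball in `x`, escape control yields a smooth function with bounds depending only on the
control which increases along the flow on the unit sphere bundle. -/
theorem exists_innerSymbol (hγ : 0 < γ) (hC : 0 ≤ C₁) (R : ℝ) (τ : ℝ → ℝ≥0) :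
    ∃ b : ℕ → ℝ, ∀ a : Fin n → Fin n → E n → ℝ, Admissible γ C₁ a →
      ControlsEscape (quadSymbol a) τ → ∃ G : E n × E n → ℝ, ContDiff ℝ ∞ G ∧
        (∀ k z, ‖iteratedFDeriv ℝ k G z‖ ≤ b k) ∧
        ∀ x θ, ‖x‖ ≤ R → ‖θ‖ = 1 → √γ / 4 ≤ fderiv ℝ G (x, θ) (sphereField a x θ) := by
  have hF := fieldBound_pos (n := n) hγ hC
  have hsγ : 0 < √γ := Real.sqrt_pos.2 hγ
  set F := fieldBound n γ C₁ with hFdef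
  -- orbits starting in the ball of radius `R + 1` stay for a short time where the cut-off is `1`
  set μ : ℝ := R + 4 with hμ
  set T : ℝ := 2 * (2 * τ μ + 1) with hTdef
  have hT : 0 ≤ T := by positivity
  -- `h ≤ K²` for `|ξ| ≤ 3`, so that the truncation is inactive there
  set K : ℝ := √(F * 3 ^ 2) with hKdef
  have hK : 0 ≤ K := Real.sqrt_nonneg _
  obtain ⟨S, hS0, hS⟩ := exists_lipschitz_innerFun (n := n) hγ hC μ hT hK
  obtain ⟨L, hL0, hL⟩ := exists_flow_bound (n := n) hγ hC (E₀ := F * 3 ^ 2) (by positivity)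
  -- the radius of mollification, small enough for the error to stay below half of the rate
  set ε : ℝ := min (1 / 4) (√γ / (4 * (S * (L + F) + 1))) with hε
  have hSLF : 0 ≤ S * (L + F) := by positivity
  have hε0 : 0 < ε := lt_min (by norm_num) (by positivity)
  have hε1 : ε ≤ 1 / 4 := min_le_left _ _
  have hε2 : S * (ε * (L + F)) ≤ √γ / 4 := by
    have h1 : ε * (4 * (S * (L + F) + 1)) ≤ √γ := by
      rw [← le_div_iff₀ (by positivity)]; exact min_le_right _ _
    nlinarith
  set ν : Measure (E n × E n) := Measure.addHaar
  set ρ : ContDiffBump (0 : E n × E n) := ⟨ε / 2, ε, by positivity, by linarith⟩ with hρ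
  have hρs : ContDiff ℝ ∞ (ρ.normed ν) := ρ.contDiff_normed
  have hρc : HasCompactSupport (ρ.normed ν) :=
    ρ.hasCompactSupport_normed
  have hb := fun k => exists_bound_iteratedFDeriv_convolution ν
    (K * T) k (ContinuousLinearMap.lsmul ℝ ℝ) _ hρs hρc
  choose b hb using hb
  refine ⟨b, fun a ha hτ => ?_⟩
  have hcont : Continuous (innerFun a μ T K) := continuous_innerFun hγ hC ha hT
  refine ⟨convolution (ρ.normed ν) (innerFun a μ T K) (ContinuousLinearMap.lsmul ℝ ℝ) ν,
    hρc.contDiff_convolution_left _ hρs hcont.locallyIntegrable,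
    fun k => hb k _ hcont fun z => abs_innerFun_le hT hK z, fun x θ hx hθ => ?_⟩
  obtain ⟨hlip, -, htan⟩ := hL a ha
  have ht₀ : 0 < 1 / (8 * (F + L + 1)) := by positivity
  refine le_fderiv_convolution ν ρ hcont (B := S * (L * L + F * L)) ht₀ fun y hy t ht ht1 => ?_
  have hy' : ‖y‖ < ε := hy
  rw [lt_div_iff₀ (by positivity)] at ht1
  have hFt : F * t ≤ 1 / 8 := by nlinarith
  have hLt : L * t ≤ 1 / 8 := by nlinarith
  set z : E n × E n := (x, θ) - y with hz
  have hzx : ‖z - (x, θ)‖ ≤ ε := by rw [hz, sub_sub_cancel_left, norm_neg]; exact hy'.le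
  have hz1 : ‖z.1‖ ≤ R + 1 / 4 := by
    have h1 : ‖z.1 - x‖ ≤ ε := (norm_fst_le (z - (x, θ))).trans hzx
    have h2 := norm_le_norm_add_norm_sub' z.1 x
    linarith
  have hz2 : ‖z.2 - θ‖ ≤ ε := (norm_snd_le (z - (x, θ))).trans hzx
  have hz2' := abs_le.1 ((abs_norm_sub_norm_le z.2 θ).trans hz2)
  rw [hθ] at hz2'
  have hEz : quadSymbol a z.1 z.2 ≤ F * 3 ^ 2 :=
    (ha.quadSymbol_le hγ hC _ _).trans (by rw [← hFdef]; gcongr; linarith)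
  have hEx : quadSymbol a x θ ≤ F * 3 ^ 2 :=
    (ha.quadSymbol_le hγ hC _ _).trans (by rw [← hFdef]; gcongr; linarith)
  have hV := ha.norm_velΞ_le_of_norm_eq_one hγ hC x hθ
  rw [← hFdef] at hV
  set β : ℝ := inner ℝ (velΞ a x θ) θ with hβdef
  have hβ : |β| ≤ F := by
    have := abs_real_inner_le_norm (velΞ a x θ) θ
    rw [hθ, mul_one] at this
    exact this.trans hV
  have htβ : |t * β| ≤ 1 / 8 := by
    rw [abs_mul, abs_of_pos ht]
    have := mul_le_mul_of_nonneg_left hβ ht.le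
    linarith
  have htβ' := abs_le.1 htβ
  have hadv := innerFun_advance hγ hC ha hτ (μ := μ) (z := z) (t := t) (l := 1 - t * β)
    (fun Z hZ h t ht => (htan Z hZ h t ht).1) hL0 (by linarith) (by linarith) (by linarith)
    (by linarith) (by linarith) ht.le (by linarith)
  have herr := norm_add_smul_sphereField_sub_le hγ hC ha hlip hL0 htan hθ hzx ht.le hEx hEz
  rw [← hFdef] at herr
  rw [← hβdef] at herr
  set q : E n × E n := z + t • sphereField a x θ with hq
  set p : E n × E n := ((flow a z t).1, (1 - t * β) • (flow a z t).2) with hp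
  have hO := isOrbit_flow hγ hC ha z
  have h0 := flow_zero hγ hC ha z
  have hmove := (htan _ hO (by rw [h0]; exact hEz) t ht.le).1
  rw [h0] at hmove
  have hfl := abs_le.1 ((abs_norm_sub_norm_le (flow a z t).2 z.2).trans
    ((norm_snd_le (flow a z t - z)).trans hmove))
  have hpn : ‖p.2‖ = (1 - t * β) * ‖(flow a z t).2‖ := by
    rw [hp, norm_smul, Real.norm_of_nonneg (by linarith)]
  have hqz : ‖q.2 - z.2‖ ≤ t * (F + F) := by
    have e : q.2 - z.2 = t • (velΞ a x θ - β • θ) := by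
      simp [hq, sphereField, hβdef]
    rw [e, norm_smul, Real.norm_of_nonneg ht.le]
    refine mul_le_mul_of_nonneg_left ((norm_sub_le _ _).trans (add_le_add hV ?_)) ht.le
    rw [norm_smul, hθ, mul_one]; exact hβ
  have hqn := abs_le.1 ((abs_norm_sub_norm_le q.2 z.2).trans hqz)
  have hlow : 1 / 2 ≤ (1 - t * β) * ‖(flow a z t).2‖ :=
    le_trans (by norm_num) (mul_le_mul (by linarith : (7 / 8 : ℝ) ≤ 1 - t * β)
      (by linarith : (5 / 8 : ℝ) ≤ ‖(flow a z t).2‖) (by norm_num) (by linarith))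
  have hup : (1 - t * β) * ‖(flow a z t).2‖ ≤ 3 :=
    (mul_le_mul (by linarith : 1 - t * β ≤ 9 / 8)
      (by linarith : ‖(flow a z t).2‖ ≤ 11 / 8) (norm_nonneg _) (by norm_num)).trans (by norm_num)
  rw [← hFdef, ← hKdef, ← hTdef] at hadv
  have hfin := (abs_le.1 (hS a ha q p (by linarith) (by linarith) (by rw [hpn]; exact hlow)
    (by rw [hpn]; exact hup))).1
  have h9 := mul_le_mul_of_nonneg_left herr hS0
  have h10 := mul_le_mul_of_nonneg_left hε2 ht.le
  have e : S * (t * (ε * (L + F)) + (L * L + F * L) * t ^ 2) =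
      t * (S * (ε * (L + F))) + S * (L * L + F * L) * t ^ 2 := by ring
  linarith
end Inner

/-! ### Homogeneous extension and gluing -/

section Glue

variable {n : ℕ} {γ C₁ : ℝ} {a : Fin n → Fin n → E n → ℝ}

/-- The projection `(x, ξ) ↦ (x, ξ / |ξ|)` to the unit sphere bundle, smoothed near `ξ = 0`. -/
noncomputable def sphereMap (z : E n × E n) : E n × E n := (z.1, unitMap z.2)

theorem contDiff_sphereMap : ContDiff ℝ ∞ (sphereMap (n := n)) :=
  contDiff_fst.prodMk (contDiff_unitMap.comp contDiff_snd)

theorem unitMap_smul {ξ : E n} (hξ : 1 ≤ ‖ξ‖) {c : ℝ} (hc : 1 ≤ c) :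
    unitMap (c • ξ) = unitMap ξ := by
  have h : 1 ≤ ‖c • ξ‖ := by
    rw [norm_smul, Real.norm_of_nonneg (by linarith)]; nlinarith
  rw [unitMap_eq (by linarith), unitMap_eq (by linarith), norm_smul,
    Real.norm_of_nonneg (by linarith), smul_smul]
  congr 1
  have : c ≠ 0 := by linarith
  field_simp

theorem hasDerivAt_norm_line {ξ v : E n} (hξ : ξ ≠ 0) :
    HasDerivAt (fun s : ℝ => ‖ξ + s • v‖) (inner ℝ ξ v / ‖ξ‖) 0 := by
  have h0 : 0 < ‖ξ‖ := norm_pos_iff.2 hξ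
  have hz : ξ + (0 : ℝ) • v = ξ := by simp
  have h1 := (hasDerivAt_line ξ v).norm_sq.sqrt (by rw [hz]; exact pow_ne_zero 2 h0.ne')
  simp only [Real.sqrt_sq (norm_nonneg _), hz] at h1
  convert h1 using 1
  field_simp

/-- The derivative of `sphereMap` maps the Hamiltonian field to `|ξ|` times `sphereField`. -/
theorem fderiv_comp_sphereMap {G : E n × E n → ℝ} (hG : ContDiff ℝ ∞ G) {x ξ : E n}
    (hξ : 1 ≤ ‖ξ‖) :
    fderiv ℝ (G ∘ sphereMap) (x, ξ) (hamField a (x, ξ)) =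
      ‖ξ‖ * fderiv ℝ G (x, ‖ξ‖⁻¹ • ξ) (sphereField a x (‖ξ‖⁻¹ • ξ)) := by
  have h0 : 0 < ‖ξ‖ := by linarith
  set θ : E n := ‖ξ‖⁻¹ • ξ with hθ
  have hξθ : ξ = ‖ξ‖ • θ := by rw [hθ, smul_inv_smul₀ h0.ne']
  have hd := hasDerivAt_comp_line
    (((hG.comp contDiff_sphereMap).differentiable (by simp)) (x, ξ)) (hamField a (x, ξ))
  set v := velΞ a x ξ with hv
  have hve : v = ‖ξ‖ ^ 2 • velΞ a x θ := by
    rw [← velΞ_smul, ← hξθ]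
  have hXe : velX a x ξ = ‖ξ‖ • velX a x θ := by
    rw [← velX_smul, ← hξθ]
  have hz : ξ + (0 : ℝ) • v = ξ := by simp
  have h1 : HasDerivAt (fun s : ℝ => ‖ξ + s • v‖⁻¹ • (ξ + s • v))
      (‖ξ‖ • (velΞ a x θ - inner ℝ (velΞ a x θ) θ • θ)) 0 := by
    have h2 := ((hasDerivAt_norm_line (v := v) (norm_pos_iff.1 h0)).inv
      (by rw [hz]; exact h0.ne')).smul (hasDerivAt_line ξ v)
    rw [hz] at h2
    refine h2.congr_deriv ?_
    have e : inner ℝ ξ v = ‖ξ‖ ^ 3 * inner ℝ (velΞ a x θ) θ := by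
      calc inner ℝ ξ v = inner ℝ (‖ξ‖ • θ) (‖ξ‖ ^ 2 • velΞ a x θ) := by rw [← hξθ, ← hve]
        _ = _ := by
          rw [inner_smul_left, inner_smul_right, real_inner_comm, conj_trivial]
          ring
    rw [e]
    generalize inner ℝ (velΞ a x θ) θ = β
    have e1 : ‖ξ‖⁻¹ • v = ‖ξ‖ • velΞ a x θ := by
      rw [hve, smul_smul]
      congr 1
      field_simp
    have e2 : (-(‖ξ‖ ^ 3 * β / ‖ξ‖) / ‖ξ‖ ^ 2) • ξ = -(‖ξ‖ • β • θ) := by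
      rw [hθ, smul_smul, smul_smul, ← neg_smul]
      congr 1
      field_simp
    rw [Pi.inv_apply, hz, e1, e2, smul_sub, sub_eq_add_neg]
  have h3 : HasDerivAt (fun s : ℝ => sphereMap ((x, ξ) + s • hamField a (x, ξ)))
      (‖ξ‖ • sphereField a x θ) 0 := by
    have h4 := (hasDerivAt_line x (velX a x ξ)).prodMk h1
    rw [hXe] at h4
    refine h4.congr_of_eventuallyEq ?_
    have hc : ∀ᶠ s : ℝ in 𝓝 0, 1 / 2 < ‖ξ + s • v‖ :=
      continuousAt_const.eventually_lt (by fun_prop) (by rw [hz]; linarith)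
    filter_upwards [hc] with s hs
    refine Prod.ext ?_ ?_
    · simp [sphereMap, hamField, hXe]
    · exact unitMap_eq hs.le
  have hs0 : sphereMap ((x, ξ) + (0 : ℝ) • hamField a (x, ξ)) = (x, θ) := by
    rw [zero_smul, add_zero, sphereMap, unitMap_eq (by linarith)]
  have h5 : HasFDerivAt G (fderiv ℝ G (x, θ))
      (sphereMap ((x, ξ) + (0 : ℝ) • hamField a (x, ξ))) := by
    rw [hs0]; exact ((hG.differentiable (by simp)) (x, θ)).hasFDerivAt
  have h6 := h5.comp_hasDerivAt 0 h3
  rw [map_smul, smul_eq_mul] at h6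
  exact hd.unique h6

/-- The function `χ (x) G (x, ξ / |ξ|)`, smoothed near `ξ = 0`. -/
noncomputable def localized (χ : E n → ℝ) (G : E n × E n → ℝ) (z : E n × E n) : ℝ :=
  χ z.1 * G (sphereMap z)

theorem contDiff_localized {χ : E n → ℝ} (hχ : ContDiff ℝ ∞ χ) {G : E n × E n → ℝ}
    (hG : ContDiff ℝ ∞ G) : ContDiff ℝ ∞ (localized χ G) :=
  (hχ.comp contDiff_fst).mul (hG.comp contDiff_sphereMap)

/-- Derivative bounds for `localized χ G`, on `|ξ| ≤ 2`, uniform over all `G` with given bounds. -/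
theorem exists_bound_iteratedFDeriv_localized {χ : E n → ℝ} (hχ : ContDiff ℝ ∞ χ) {R : ℝ}
    (hR : ∀ x, R ≤ ‖x‖ → χ x = 0) (b : ℕ → ℝ) (k : ℕ) :
    ∃ A, ∀ G : E n × E n → ℝ, ContDiff ℝ ∞ G → (∀ k z, ‖iteratedFDeriv ℝ k G z‖ ≤ b k) →
      ∀ x ξ : E n, ‖ξ‖ ≤ 2 → ‖iteratedFDeriv ℝ k (localized χ G) (x, ξ)‖ ≤ A := by
  set S : Set (E n × E n) := Metric.closedBall 0 R ×ˢ Metric.closedBall 0 2 with hS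
  have hSc : IsCompact S := (isCompact_closedBall 0 R).prod (isCompact_closedBall 0 2)
  have hχ1 : ContDiff ℝ ∞ fun z : E n × E n => χ z.1 := hχ.comp contDiff_fst
  obtain ⟨D, hD⟩ := exists_bound_iteratedFDeriv_of_isCompact hSc hχ1 k
  set B : ℝ := ∑ i ∈ Finset.range (k + 1), |b i| with hB
  have hbB : ∀ i ≤ k, b i ≤ B := fun i hi => (le_abs_self _).trans
    (Finset.single_le_sum (f := fun i => |b i|) (fun i _ => abs_nonneg _)
      (Finset.mem_range.2 (Nat.lt_succ_of_le hi)))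
  obtain ⟨Nb, hNb⟩ := exists_bound_iteratedFDeriv_of_isCompact hSc
    (contDiff_sphereMap (n := n)) k
  obtain ⟨A, hA⟩ := exists_bound_iteratedFDeriv_comp (W := ℝ) (S := S)
    (contDiff_sphereMap (n := n)) (k := k) (fun i _ hi => ⟨Nb, hNb i hi⟩) (2 ^ k * (|D| * B))
  refine ⟨max A 0, fun G hG hGb x ξ hξ => ?_⟩
  rcases le_or_gt ‖x‖ R with hx | hx
  · refine le_trans ?_ (le_max_left _ _)
    have hmem : (x, ξ) ∈ S := ⟨mem_closedBall_zero_iff.2 hx, mem_closedBall_zero_iff.2 hξ⟩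
    refine hA (fun z => χ z.1 * G z) (hχ1.mul hG) (fun i hi z hz => ?_) _ hmem
    have hz' : sphereMap z ∈ S := ⟨hz.1, mem_closedBall_zero_iff.2
      ((norm_unitMap_le _).trans one_le_two)⟩
    refine (norm_iteratedFDeriv_mul_le hχ1 hG _ (n := i) (by exact_mod_cast le_top)).trans ?_
    have hB0 : 0 ≤ B := Finset.sum_nonneg fun _ _ => abs_nonneg _
    calc _ ≤ ∑ j ∈ Finset.range (i + 1), (i.choose j : ℝ) * (|D| * B) := by
          refine Finset.sum_le_sum fun j hj => ?_
          have hj' : j ≤ i := Nat.lt_succ_iff.1 (Finset.mem_range.1 hj)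
          rw [mul_assoc]
          have h1 := (hD j (hj'.trans hi) _ hz').trans (le_abs_self D)
          have h2 := (hGb (i - j) (sphereMap z)).trans (hbB _ (by omega))
          gcongr
      _ = 2 ^ i * (|D| * B) := by
          rw [← Finset.sum_mul]
          congr 1
          exact_mod_cast Nat.sum_range_choose i
      _ ≤ _ := by
          gcongr
          exact one_le_two
  · refine le_trans (le_of_eq ?_) (le_max_right _ _)
    have h0 : localized χ G =ᶠ[𝓝 (x, ξ)] 0 := by
      have : ∀ᶠ z : E n × E n in 𝓝 (x, ξ), R < ‖z.1‖ :=
        continuousAt_const.eventually_lt (by fun_prop) hx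
      filter_upwards [this] with z hz
      simp [localized, hR z.1 hz.le]
    have h1 := fun h => notMem_tsupport_iff_eventuallyEq.2 h0
      (support_iteratedFDeriv_subset (𝕜 := ℝ) k h)
    rw [norm_eq_zero]
    by_contra hne
    exact h1 hne

theorem fderiv_localized {χ : E n → ℝ} (hχ : ContDiff ℝ ∞ χ) {G : E n × E n → ℝ}
    (hG : ContDiff ℝ ∞ G) {x ξ : E n} (hξ : 1 ≤ ‖ξ‖) :
    fderiv ℝ (localized χ G) (x, ξ) (hamField a (x, ξ)) =
      χ x * (‖ξ‖ * fderiv ℝ G (x, ‖ξ‖⁻¹ • ξ) (sphereField a x (‖ξ‖⁻¹ • ξ))) +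
        G (sphereMap (x, ξ)) * fderiv ℝ χ x (velX a x ξ) := by
  have h1 : HasFDerivAt (fun z : E n × E n => χ z.1)
      ((fderiv ℝ χ x).comp (ContinuousLinearMap.fst ℝ (E n) (E n))) (x, ξ) :=
    (((hχ.differentiable (by simp)) x).hasFDerivAt).comp (x, ξ) hasFDerivAt_fst
  have h2 := (((hG.comp contDiff_sphereMap).differentiable (by simp)) (x, ξ)).hasFDerivAt
  rw [← fderiv_comp_sphereMap hG hξ]
  have h3 := (h1.mul h2).fderiv
  change fderiv ℝ (localized χ G) (x, ξ) = _ at h3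
  rw [h3]
  simp [hamField]

theorem Admissible.norm_hamField_le (hγ : 0 < γ) (hC : 0 ≤ C₁) (ha : Admissible γ C₁ a)
    {x ξ : E n} (hξ : ‖ξ‖ ≤ 1) : ‖hamField a (x, ξ)‖ ≤ fieldBound n γ C₁ := by
  have hF := fieldBound_pos (n := n) hγ hC
  refine norm_prod_le_iff.2 ⟨?_, ?_⟩
  · exact (ha.norm_velX_le hγ hC x ξ).trans (mul_le_of_le_one_right hF.le hξ)
  · refine (ha.norm_velΞ_le hγ hC x ξ).trans ((div_le_self (by positivity)
      (by nlinarith [sq_nonneg ‖x‖])).trans (mul_le_of_le_one_right hF.le ?_))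
    exact pow_le_one₀ (norm_nonneg _) hξ

/-- A smooth cut-off, equal to `1` on the ball of radius `R` and to `0` off that of radius
`R + 1`. -/
theorem exists_cutoff (R : ℝ) (hR : 0 < R) :
    ∃ (χ : E n → ℝ) (D : ℝ), ContDiff ℝ ∞ χ ∧ 0 ≤ D ∧ (∀ x, ‖fderiv ℝ χ x‖ ≤ D) ∧
      (∀ x, 0 ≤ χ x) ∧ (∀ x, ‖x‖ < R → χ x = 1 ∧ fderiv ℝ χ x = 0) ∧
      (∀ x, R + 1 ≤ ‖x‖ → χ x = 0) := by
  set ψ : ContDiffBump (0 : E n) := ⟨R, R + 1, hR, by linarith⟩ with hψ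
  have hsm : ContDiff ℝ ∞ ψ := ψ.contDiff
  obtain ⟨D, hD⟩ := (ψ.hasCompactSupport.fderiv (𝕜 := ℝ)).exists_bound_of_continuous
    (hsm.continuous_fderiv (by simp))
  refine ⟨ψ, D, hsm, (norm_nonneg _).trans (hD 0), hD, fun x => ψ.nonneg, fun x hx => ?_,
    fun x hx => ?_⟩
  · have h1 : ψ =ᶠ[𝓝 x] fun _ => (1 : ℝ) :=
      ψ.eventuallyEq_one_of_mem_ball (mem_ball_zero_iff.2 hx)
    exact ⟨h1.eq_of_nhds, by rw [h1.fderiv_eq]; simp⟩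
  · exact ψ.zero_of_le_dist (by rw [dist_zero_right]; exact hx)

/-- The growth estimate for large `ξ`: where the cut-off varies, a large multiple of the symbol at
infinity dominates. -/
theorem growth_of_glue (hγ : 0 < γ) (hC : 0 ≤ C₁) (ha : Admissible γ C₁ a) {χ : E n → ℝ}
    {G : E n × E n → ℝ} (hχ : ContDiff ℝ ∞ χ) (hG : ContDiff ℝ ∞ G) {A D R K : ℝ} (hD0 : 0 ≤ D)
    (hR0 : 0 < R) (hR : 4 / escapeParam n γ C₁ ^ 2 ≤ R) (hD : ∀ x, ‖fderiv ℝ χ x‖ ≤ D)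
    (hχ0 : ∀ x, 0 ≤ χ x) (hχ1 : ∀ x, ‖x‖ < R → χ x = 1 ∧ fderiv ℝ χ x = 0)
    (hχR : ∀ x, R + 1 ≤ ‖x‖ → χ x = 0) (hGA : ∀ z, |G z| ≤ A)
    (hGR : ∀ x θ, ‖x‖ ≤ R + 1 → ‖θ‖ = 1 → √γ / 4 ≤ fderiv ℝ G (x, θ) (sphereField a x θ))
    (hK : (A * D * fieldBound n γ C₁ + 1) * (R + 2) ^ 2 ≤
      K * (escapeParam n γ C₁ ^ 2 * fieldBound n γ C₁ / 32)) (hK0 : 0 ≤ K)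
    {x ξ : E n} (hξ : 1 ≤ ‖ξ‖) :
    min 1 (√γ / 4) * ‖ξ‖ / (1 + ‖x‖ ^ 2) ≤
      K * fderiv ℝ (outerSymbol n (escapeParam n γ C₁)) (x, ξ) (hamField a (x, ξ)) +
        fderiv ℝ (localized χ G) (x, ξ) (hamField a (x, ξ)) := by
  have hF := fieldBound_pos (n := n) hγ hC
  have hsγ : 0 < √γ := Real.sqrt_pos.2 hγ
  obtain ⟨ho0, ho⟩ := outerSymbol_growth hγ hC ha (x := x) hξ
  rw [fderiv_localized hχ hG hξ]
  set F := fieldBound n γ C₁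
  set c := escapeParam n γ C₁
  set O := fderiv ℝ (outerSymbol n c) (x, ξ) (hamField a (x, ξ))
  set θ : E n := ‖ξ‖⁻¹ • ξ with hθ
  have hξ0 : 0 < ‖ξ‖ := by linarith
  have hθ1 : ‖θ‖ = 1 := by
    rw [hθ, norm_smul, norm_inv, norm_norm, inv_mul_cancel₀ hξ0.ne']
  have hm0 : 0 ≤ min 1 (√γ / 4) := le_min zero_le_one (by positivity)
  have hA0 : 0 ≤ A := (abs_nonneg _).trans (hGA 0)
  have hx1 : 1 ≤ 1 + ‖x‖ ^ 2 := by nlinarith [sq_nonneg ‖x‖]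
  rcases lt_or_ge ‖x‖ R with hx | hx
  · obtain ⟨e1, e2⟩ := hχ1 x hx
    rw [e1, e2, zero_apply, mul_zero, add_zero, one_mul]
    have h1 := mul_le_mul_of_nonneg_left (hGR x θ (by linarith) hθ1) hξ0.le
    have h2 : min 1 (√γ / 4) * ‖ξ‖ / (1 + ‖x‖ ^ 2) ≤ √γ / 4 * ‖ξ‖ :=
      (div_le_self (by positivity) hx1).trans
        (mul_le_mul_of_nonneg_right (min_le_right _ _) hξ0.le)
    have h3 := mul_nonneg hK0 ho0
    linarith
  · have hbr : R ≤ bracket x := hx.trans (norm_le_bracket x)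
    have h1 := mul_le_mul_of_nonneg_left (ho (hR.trans hbr)) hK0
    have e1 : K * (c ^ 2 * (F * ‖ξ‖) / (32 * bracket x ^ 2)) =
        K * (c ^ 2 * F / 32) * (‖ξ‖ / (1 + ‖x‖ ^ 2)) := by
      rw [bracket_sq]; field_simp
    rw [e1] at h1
    have h2 := (mul_le_mul_of_nonneg_right hK
      (by positivity : 0 ≤ ‖ξ‖ / (1 + ‖x‖ ^ 2))).trans h1
    have h3 : min 1 (√γ / 4) * ‖ξ‖ / (1 + ‖x‖ ^ 2) ≤ ‖ξ‖ / (1 + ‖x‖ ^ 2) := by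
      rw [mul_div_assoc]
      exact mul_le_of_le_one_left (by positivity) (min_le_left _ _)
    have hq0 : 0 ≤ ‖ξ‖ / (1 + ‖x‖ ^ 2) := by positivity
    have hADF : 0 ≤ A * D * F := by positivity
    rcases lt_or_ge (R + 1) ‖x‖ with hx' | hx'
    · have e2 : χ =ᶠ[𝓝 x] fun _ => (0 : ℝ) := by
        have : ∀ᶠ y : E n in 𝓝 x, R + 1 < ‖y‖ :=
          continuousAt_const.eventually_lt (by fun_prop) hx'
        filter_upwards [this] with y hy using hχR y hy.le
      have e3 : fderiv ℝ χ x = 0 := by rw [e2.fderiv_eq]; simp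
      rw [e2.eq_of_nhds, e3, zero_apply, mul_zero, add_zero, zero_mul,
        add_zero]
      have h4 : 1 ≤ (A * D * F + 1) * (R + 2) ^ 2 := by nlinarith
      have h5 := mul_le_mul_of_nonneg_right h4 hq0
      linarith
    · have h4 : ‖ξ‖ ≤ (R + 2) ^ 2 * (‖ξ‖ / (1 + ‖x‖ ^ 2)) := by
        rw [mul_div_assoc', le_div_iff₀ (by linarith), mul_comm]
        refine mul_le_mul_of_nonneg_right ?_ hξ0.le
        nlinarith [norm_nonneg x, mul_nonneg hR0.le (norm_nonneg x)]
      have h5 : (A * D * F + 1) * ‖ξ‖ ≤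
          (A * D * F + 1) * (R + 2) ^ 2 * (‖ξ‖ / (1 + ‖x‖ ^ 2)) := by
        rw [mul_assoc (A * D * F + 1)]
        exact mul_le_mul_of_nonneg_left h4 (add_nonneg hADF zero_le_one)
      have h6 : 0 ≤ χ x * (‖ξ‖ * fderiv ℝ G (x, θ) (sphereField a x θ)) :=
        mul_nonneg (hχ0 x) (mul_nonneg hξ0.le
          (le_trans (by positivity) (hGR x θ hx' hθ1)))
      have h7 : |G (sphereMap (x, ξ)) * fderiv ℝ χ x (velX a x ξ)| ≤ A * (D * (F * ‖ξ‖)) := by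
        rw [abs_mul]
        refine mul_le_mul (hGA _) ?_ (abs_nonneg _) hA0
        refine ((fderiv ℝ χ x).le_opNorm _).trans ?_
        exact mul_le_mul (hD x) (ha.norm_velX_le hγ hC x ξ) (norm_nonneg _) hD0
      have h8 := (abs_le.1 h7).1
      have h9 : ‖ξ‖ / (1 + ‖x‖ ^ 2) ≤ ‖ξ‖ := div_le_self hξ0.le hx1
      nlinarith

/-- An escape function, together with constants which depend on the coefficients only through the
bounds they satisfy and the control of their escape times. -/
theorem exists_escapeFunction (hγ : 0 < γ) (hC : 0 ≤ C₁) (τ : ℝ → ℝ≥0) :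
    ∃ (b : ℕ → ℝ) (B : ℝ), 0 < B ∧ B < 1 ∧ ∀ a : Fin n → Fin n → E n → ℝ, Admissible γ C₁ a →
      ControlsEscape (quadSymbol a) τ → ∃ P : E n × E n → ℝ, ContDiff ℝ ∞ P ∧
        (∀ x ξ, 1 ≤ ‖ξ‖ → ∀ c : ℝ, 1 ≤ c → P (x, c • ξ) = P (x, ξ)) ∧
        (∀ k x ξ, ‖ξ‖ ≤ 2 → ‖iteratedFDeriv ℝ k P (x, ξ)‖ ≤ b k) ∧
        ∀ x ξ, B * ‖ξ‖ / (1 + ‖x‖ ^ 2) - 1 / B ≤ fderiv ℝ P (x, ξ) (hamField a (x, ξ)) := by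
  have hF := fieldBound_pos (n := n) hγ hC
  have hc := escapeParam_pos (n := n) hγ hC
  have hsγ : 0 < √γ := Real.sqrt_pos.2 hγ
  set F := fieldBound n γ C₁ with hFdef
  set c := escapeParam n γ C₁ with hcdef
  set R : ℝ := 4 / c ^ 2 with hR
  have hR0 : 0 < R := by positivity
  obtain ⟨χ, D, hχ, hD0, hD, hχ0, hχ1, hχR⟩ := exists_cutoff (n := n) R hR0
  obtain ⟨bG, hbG⟩ := exists_innerSymbol (n := n) hγ hC (R + 1) τ
  set A : ℝ := max (bG 0) 0 with hA
  -- large enough to absorb the derivative of the cut-off, which lives in `R ≤ |x| ≤ R + 1`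
  set K : ℝ := (A * D * F + 1) * (R + 2) ^ 2 / (c ^ 2 * F / 32) with hK
  have hA0 : 0 ≤ A := le_max_right _ _
  have hK0 : 0 ≤ K := by positivity
  have hO : ContDiff ℝ ∞ fun w => K * outerFun n c w := contDiff_const.mul (contDiff_outerFun hc)
  choose bO hbO using fun k => exists_bound_iteratedFDeriv_comp_compactMap hO k
  choose bL hbL using fun k => exists_bound_iteratedFDeriv_localized hχ hχR bG k
  -- bounds `H_h P` for `|ξ| ≤ 1`
  set m : ℝ := |bO 1 + bL 1| * F + 1 with hm
  have hm0 : 0 < m := by positivity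
  set B : ℝ := min (min (1 / 2) (√γ / 4)) (1 / m) with hB
  have hB0 : 0 < B := lt_min (lt_min (by norm_num) (by positivity)) (by positivity)
  have hB2 : B ≤ 1 / 2 := (min_le_left _ _).trans (min_le_left _ _)
  refine ⟨fun k => bO k + bL k, B, hB0, by linarith, fun a ha hτ => ?_⟩
  obtain ⟨G, hG, hGb, hGR⟩ := hbG a ha hτ
  have hO' : ContDiff ℝ ∞ ((fun w => K * outerFun n c w) ∘ compactMap (n := n)) :=
    hO.comp contDiff_compactMap
  have hL' : ContDiff ℝ ∞ (localized χ G) := contDiff_localized hχ hG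
  set P : E n × E n → ℝ := (fun w => K * outerFun n c w) ∘ compactMap + localized χ G with hP
  have hPs : ContDiff ℝ ∞ P := hO'.add hL'
  have hPb : ∀ k x ξ, ‖ξ‖ ≤ 2 → ‖iteratedFDeriv ℝ k P (x, ξ)‖ ≤ bO k + bL k := by
    intro k x ξ hξ
    rw [hP, iteratedFDeriv_add_apply (hO'.contDiffAt.of_le (by exact_mod_cast le_top))
      (hL'.contDiffAt.of_le (by exact_mod_cast le_top))]
    exact (norm_add_le _ _).trans
      (add_le_add (hbO k x ξ hξ) (hbL k G hG hGb x ξ hξ))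
  refine ⟨P, hPs, fun x ξ hξ s hs => ?_, hPb, fun x ξ => ?_⟩
  · simp only [hP, Pi.add_apply, Function.comp_apply, localized, sphereMap, outerFun, compactMap,
      unitMap_smul hξ hs]
  rcases le_or_gt 1 ‖ξ‖ with hξ | hξ
  · have hgl := growth_of_glue hγ hC ha hχ hG (A := A) (K := K) hD0 hR0 (hR ▸ le_rfl) hD hχ0 hχ1 hχR
      (fun z => by
        rw [← Real.norm_eq_abs, ← norm_iteratedFDeriv_zero (𝕜 := ℝ)]
        exact (hGb 0 z).trans (le_max_left _ 0)) hGR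
      (by rw [← hFdef, ← hcdef, hK, div_mul_cancel₀ _ (by positivity)]) hK0 (x := x) hξ
    have e : fderiv ℝ P (x, ξ) (hamField a (x, ξ)) =
        K * fderiv ℝ (outerSymbol n c) (x, ξ) (hamField a (x, ξ)) +
          fderiv ℝ (localized χ G) (x, ξ) (hamField a (x, ξ)) := by
      have h1 := ((((contDiff_outerSymbol (n := n) hc).differentiable (by simp))
        (x, ξ)).hasFDerivAt.const_mul K).add ((hL'.differentiable (by simp)) (x, ξ)).hasFDerivAt
      have h2 : fderiv ℝ P (x, ξ) = _ := h1.fderiv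
      rw [h2]; simp
    rw [e]
    refine le_trans ?_ hgl
    have h1 : B * ‖ξ‖ / (1 + ‖x‖ ^ 2) ≤ min 1 (√γ / 4) * ‖ξ‖ / (1 + ‖x‖ ^ 2) := by
      gcongr
      exact le_min (by linarith) ((min_le_left _ _).trans (min_le_right _ _))
    have h2 : 0 < 1 / B := by positivity
    linarith
  · have h1 : ‖fderiv ℝ P (x, ξ)‖ ≤ |bO 1 + bL 1| := by
      rw [← norm_iteratedFDeriv_one]
      exact (hPb 1 x ξ (by linarith)).trans (le_abs_self _)
    have h2 : |fderiv ℝ P (x, ξ) (hamField a (x, ξ))| ≤ |bO 1 + bL 1| * F :=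
      ((fderiv ℝ P (x, ξ)).le_opNorm _).trans
        (mul_le_mul h1 (ha.norm_hamField_le hγ hC hξ.le) (norm_nonneg _) (abs_nonneg _))
    have h3 : m ≤ 1 / B := by
      rw [le_div_iff₀ hB0, mul_comm, ← le_div_iff₀ hm0]
      exact min_le_right _ _
    have h4 : B * ‖ξ‖ / (1 + ‖x‖ ^ 2) ≤ 1 := by
      refine (div_le_self (by positivity) (by nlinarith [sq_nonneg ‖x‖])).trans ?_
      nlinarith [norm_nonneg ξ]
    have h5 := (abs_le.1 h2).1
    linarith

end Glue

end Doi

theorem mainTheorem4 (n M : ℕ) :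
    ∃ N : ℕ, ∀ γ C₁ : ℝ, 0 < γ → 0 < C₁ →
      ∃ Cstar B : (ℝ → ℝ≥0) → ℝ, (∀ τ, 0 < B τ ∧ B τ < 1) ∧
        ∀ a : Fin n → Fin n → Doi.E n → ℝ,
          Doi.IsElliptic γ a → Doi.IsRegular N C₁ a → Doi.IsAsymptoticallyFlat C₁ a →
          Doi.NonTrapping (Doi.quadSymbol a) →
          (∃ τ : ℝ → ℝ≥0, Doi.ControlsEscape (Doi.quadSymbol a) τ) ∧
          ∀ τ : ℝ → ℝ≥0, Doi.ControlsEscape (Doi.quadSymbol a) τ →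
            ∃ p : Doi.E n → Doi.E n → ℝ,
              Doi.IsSymbol 0 p ∧
              (∀ α β : List (Fin n), α.length + β.length ≤ M → ∀ x ξ : Doi.E n,
                |Doi.symbolDeriv p β α x ξ| ≤ Cstar τ * (1 + ‖ξ‖) ^ (-(α.length : ℝ))) ∧
              ∀ x ξ : Doi.E n,
                B τ * ‖ξ‖ / (1 + ‖x‖ ^ 2) - 1 / B τ ≤
                  Doi.hamiltonian (Doi.quadSymbol a) p x ξ := by
  refine ⟨2, fun γ C₁ hγ hC => ?_⟩
  choose b B hB0 hB1 hb using Doi.exists_escapeFunction (n := n) hγ hC.le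
  refine ⟨fun τ => 3 ^ M * ∑ k ∈ Finset.range (M + 1), |b τ k|, B,
    fun τ => ⟨hB0 τ, hB1 τ⟩, fun a hell hreg hflat hnt => ?_⟩
  have ha : Doi.Admissible γ C₁ a := ⟨hell, hreg, hflat⟩
  refine ⟨⟨fun μ => (Doi.escapeTime (Doi.quadSymbol a) μ).toNNReal, fun μ => ?_⟩, fun τ hτ => ?_⟩
  · rw [ENNReal.coe_toNNReal (Doi.escapeTime_ne_top hγ hC.le ha hnt μ)]
  obtain ⟨P, hP, hhom, hPb, hPH⟩ := hb τ a ha hτ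
  have hS := fun β α => Doi.abs_symbolDeriv_le_of_homogeneous hP hhom β α
    (hPb (β.length + α.length))
  refine ⟨fun x ξ => P (x, ξ), ⟨hP, fun α β =>
    ⟨3 ^ α.length * b τ (β.length + α.length), fun x ξ => ?_⟩⟩, fun α β hM x ξ => ?_,
    fun x ξ => ?_⟩
  · rw [zero_sub]
    exact hS β α x ξ
  · refine (hS β α x ξ).trans ?_
    have h1 : b τ (β.length + α.length) ≤ ∑ k ∈ Finset.range (M + 1), |b τ k| :=
      (le_abs_self _).trans (Finset.single_le_sum (f := fun k => |b τ k|)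
        (fun k _ => abs_nonneg _) (Finset.mem_range.2 (by omega)))
    have h2 : (0 : ℝ) ≤ b τ (β.length + α.length) :=
      (norm_nonneg _).trans (hPb _ 0 0 (by simp))
    refine mul_le_mul_of_nonneg_right (mul_le_mul ?_ h1 h2 (by positivity)) (by positivity)
    exact pow_le_pow_right₀ (by norm_num) (by omega)
  · rw [Doi.hamiltonian_eq_fderiv ha.differentiable ((hP.differentiable (by simp)) _)]
    exact hPH x ξ
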